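/- Let $\sigma_L,\sigma_R>0$, let $\beta_L,\beta_R\in\mathbb C\setminus\{0\}$ satisfy $\beta_R\sqrt{\sigma_L}+\beta_L\sqrt{\sigma_R}\neq0$ (automatic when $\beta_L,\beta_R$ are positive), let $\gamma_L,\gamma_R\in\mathbb C$, and let $q_0^L$ on $(-\infty,0)$ and $q_0^R$ on $(0,\infty)$ be such that $v_0^L=q_0^L-\gamma_L$ and $v_0^R=q_0^R-\gamma_R$ are integrable. Consider the interface problem $$iq^L_t=\sigma_Lq^L_{xx}\ (x<0,\ t>0),\qquad iq^R_t=\sigma_Rq^R_{xx}\ (x>0,\ t>0),$$ $$\lim_{x\to-\infty}q^L(x,t)=\gamma_L,\quad \lim_{x\to\infty}q^R(x,t)=\gamma_R,\qquad q^L(0,t)=q^R(0,t),\quad \beta_Lq^L_x(0,t)=\beta_Rq^R_x(0,t)\quad(t>0),$$ $$q^L(x,0)=q^L_0(x)\ (x<0),\qquad q^R(x,0)=q^R_0(x)\ (x>0).$$ A *solution* is a pair $(q^L,q^R)$ of functions that are $C^1$ in $t$ and $C^2$ in $x$ (with $q,q_t,q_x,q_{xx}$ jointly continuous) for $t>0$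 on the open half-lines, for which $q$ and $q_x$ extend continuously to $x=0$ for $t>0$, which take the initial values continuously as $t\downarrow0$ at each fixed $x\ne0$, which satisfy all the above conditions, and which have polynomial growth in mean square, uniformly on bounded time intervals: for each $T>0$ there are $m\in\mathbb N$ and $C$ with $\int|q(x,t)|^2(1+|x|)^{-m}\,dx\le C$ for $0<t\le T$, on each half-line. Put $\lambda_L(k)=-i\sigma_Lk^2$, $\lambda_R(k)=-i\sigma_Rk^2$, $$\hat v_0^L(k)=\int_{-\infty}^0e^{-ikx}v_0^L(x)\,dx,\qquad \hat v_0^R(k)=\int_0^\infty e^{-ikx}v_0^R(x)\,dx,$$ $$\phi(\sigma,x,t)=-\operatorname{sgn}(x)+\frac{e^{i\pi/4}}{\sqrt{\pi\sigma t}}\int_0^xe^{-iy^2/(4\sigma t)}\,dy\quad(t>0),\qquad \phi(\sigma,x,0)=0.$$ Let $D=\{k\in\mathbb C:\operatorname{Re}(-ik^2)<0\}$ and let $D^+$, $D^-$ be its parts in the upper and lower half-plane (the open second and fourth quadrants), with positively oriented boundaries: $\partial D^-$ runs from $+\infty$ to $0$ and then from $0$ to $-i\infty$, and $\partial D^+$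 runs from $-\infty$ to $0$ and then from $0$ to $i\infty$. All integrals over $k$ are improper integrals, taken separately along each ray from $0$. Consider, for $x<0$, $$\begin{aligned}q^L(x,t)=\gamma_L&+\frac{\beta_R\sigma_L(\gamma_R-\gamma_L)}{\beta_R\sigma_L+\beta_L\sqrt{\sigma_L\sigma_R}}\,\phi(\sigma_L,x,t)+\frac1{2\pi}\int_{-\infty}^\infty e^{ikx-\lambda_Lt}\hat v_0^L(k)\,dk\\&+\frac{\beta_R\sigma_L-\beta_L\sqrt{\sigma_L\sigma_R}}{2\pi(\beta_R\sigma_L+\beta_L\sqrt{\sigma_L\sigma_R})}\int_{\partial D^-}e^{ikx-\lambda_Lt}\hat v_0^L(-k)\,dk\\&-\frac{\beta_R\sigma_L}{\pi(\beta_L\sigma_R+\beta_R\sqrt{\sigma_L\sigma_R})}\int_{\partial D^-}e^{ikx-\lambda_Lt}\hat v_0^R\Big(k\sqrt{\tfrac{\sigma_L}{\sigma_R}}\Big)dk\end{aligned}\tag{1}$$ and, for $x>0$, $$\begin{aligned}q^R(x,t)=\gamma_R&+\frac{\beta_L\sqrt{\sigma_L\sigma_R}(\gamma_R-\gamma_L)}{\beta_R\sigma_L+\beta_L\sqrt{\sigma_R\sigma_L}}\,\phi(\sigma_R,x,t)+\frac1{2\pi}\int_{-\infty}^\infty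 e^{ikx-\lambda_Rt}\hat v_0^R(k)\,dk\\&+\frac{\beta_L\sigma_R}{\pi(\beta_R\sigma_L+\beta_L\sqrt{\sigma_R\sigma_L})}\int_{\partial D^+}e^{ikx-\lambda_Rt}\hat v_0^L\Big(k\sqrt{\tfrac{\sigma_R}{\sigma_L}}\Big)dk\\&+\frac{\beta_R\sigma_L-\beta_L\sqrt{\sigma_L\sigma_R}}{2\pi(\beta_R\sigma_L+\beta_L\sqrt{\sigma_R\sigma_L})}\int_{\partial D^+}e^{ikx-\lambda_Rt}\hat v_0^R(-k)\,dk.\end{aligned}\tag{2}$$ Then: (a) for every $t>0$ all the integrals over $k$ in (1) (for $x<0$) and in (2) (for $x>0$) converge; (b) every solution $(q^L,q^R)$ of the interface problem is given by (1) and (2) for all $t>0$; (c) if moreover $q_0^L$, $q_0^R$ are $C^1$ on the open half-lines with integrable derivatives, and $x^2v_0^L(x)$, $x^2v_0^R(x)$ are integrable, then the integrals also converge for $t=0$, and the functions defined by (1) and (2) for $t\ge0$ are a solution of the interface problem. -/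

import Mathlib

open Set Filter Topology MeasureTheory

noncomputable section

namespace LSInterface

/-! ### The interface problem -/

/-- Partial derivative in the space variable of `q = q(x, t)`. -/
def dx (q : ℝ → ℝ → ℂ) (x t : ℝ) : ℂ := deriv (fun y => q y t) x

/-- Partial derivative in the time variable of `q = q(x, t)`. -/
def dt (q : ℝ → ℝ → ℂ) (x t : ℝ) : ℂ := deriv (fun s => q x s) t

/-- `q` is a classical (`C¹` in time, `C²` in space) solution of `i q_t = σ q_xx`
on `S × (0, ∞)`, where `S` is an open set of positions. -/
structure IsClassicalSolutionOn (S : Set ℝ) (σ : ℝ) (q : ℝ → ℝ → ℂ) : Prop where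
  differentiable_t : ∀ x ∈ S, ∀ t > 0, DifferentiableAt ℝ (fun s => q x s) t
  differentiable_x : ∀ x ∈ S, ∀ t > 0, DifferentiableAt ℝ (fun y => q y t) x
  differentiable_xx : ∀ x ∈ S, ∀ t > 0, DifferentiableAt ℝ (fun y => dx q y t) x
  continuous_q : ContinuousOn (Function.uncurry q) (S ×ˢ Ioi 0)
  continuous_dt : ContinuousOn (Function.uncurry (dt q)) (S ×ˢ Ioi 0)
  continuous_dx : ContinuousOn (Function.uncurry (dx q)) (S ×ˢ Ioi 0)
  continuous_dxx : ContinuousOn (Function.uncurry (dx (dx q))) (S ×ˢ Ioi 0)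
  equation : ∀ x ∈ S, ∀ t > 0, Complex.I * dt q x t = (σ : ℂ) * dx (dx q) x t

/-- Polynomial growth in mean square, uniformly on bounded time intervals: for every `T > 0`
there are `m` and `C` with `∫_S |q(x,t)|² (1+|x|)^(-m) dx ≤ C` for all `0 < t ≤ T`.
Functions that are bounded for `0 < t ≤ T`, and functions whose `L²` norm is, have it. -/
def HasTemperedGrowthOn (S : Set ℝ) (q : ℝ → ℝ → ℂ) : Prop :=
  ∀ T > (0 : ℝ), ∃ m : ℕ, ∃ C : ℝ, ∀ t ∈ Ioc 0 T,
    ∫⁻ x in S, ENNReal.ofReal (‖q x t‖ ^ 2 / (1 + |x|) ^ m) ≤ ENNReal.ofReal C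

/-- `(qL, qR)` solves the two semi-infinite domain problem with dispersion coefficients `σL, σR`,
interface coefficients `βL, βR`, limits `γL, γR` at infinity and initial data `q0L, q0R`.
Only the values of `qL` at `x < 0` and of `qR` at `x > 0` matter; the interface values
`q(0, t)`, `q_x(0, t)` are the boundary values from each side, `q` and `q_x` being continuous
up to the interface for `t > 0`. -/
structure IsSolution (σL σR : ℝ) (βL βR γL γR : ℂ) (q0L q0R : ℝ → ℂ)
    (qL qR : ℝ → ℝ → ℂ) : Prop where
  left_equation : IsClassicalSolutionOn (Iio 0) σL qL
  right_equation : IsClassicalSolutionOn (Ioi 0) σR qR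
  left_limit : ∀ t > 0, Tendsto (fun x => qL x t) atBot (𝓝 γL)
  right_limit : ∀ t > 0, Tendsto (fun x => qR x t) atTop (𝓝 γR)
  left_initial : ∀ x < 0, qL x 0 = q0L x ∧ Tendsto (fun t => qL x t) (𝓝[>] 0) (𝓝 (q0L x))
  right_initial : ∀ x > 0, qR x 0 = q0R x ∧ Tendsto (fun t => qR x t) (𝓝[>] 0) (𝓝 (q0R x))
  interface_value : ∀ t > (0 : ℝ), ∃ a : ℂ,
    Tendsto (Function.uncurry qL) (𝓝[Iio 0 ×ˢ Ioi 0] (0, t)) (𝓝 a) ∧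
    Tendsto (Function.uncurry qR) (𝓝[Ioi 0 ×ˢ Ioi 0] (0, t)) (𝓝 a)
  interface_slope : ∀ t > (0 : ℝ), ∃ bL bR : ℂ,
    Tendsto (Function.uncurry (dx qL)) (𝓝[Iio 0 ×ˢ Ioi 0] (0, t)) (𝓝 bL) ∧
    Tendsto (Function.uncurry (dx qR)) (𝓝[Ioi 0 ×ˢ Ioi 0] (0, t)) (𝓝 bR) ∧
    βL * bL = βR * bR
  left_growth : HasTemperedGrowthOn (Iio 0) qL
  right_growth : HasTemperedGrowthOn (Ioi 0) qR

/-- Initial data on the half-line `S` that are `C¹`, with integrable derivative, and that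
approach `γ` so fast that `x² (q₀(x) - γ)` is integrable. -/
structure IsRegularDatum (S : Set ℝ) (γ : ℂ) (q0 : ℝ → ℂ) : Prop where
  contDiffOn : ContDiffOn ℝ 1 q0 S
  integrable_deriv : IntegrableOn (deriv q0) S
  integrable_moment : IntegrableOn (fun x : ℝ => (x : ℂ) ^ 2 * (q0 x - γ)) S

/-! ### The ingredients of the solution formula -/

/-- `λ(k) = -i σ k²`. -/
def lam (σ : ℝ) (k : ℂ) : ℂ := -Complex.I * σ * k ^ 2

/-- The half-line Fourier transform `∫_{-∞}^0 e^{-ikx} v(x) dx`. -/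
def hatL (v : ℝ → ℂ) (k : ℂ) : ℂ := ∫ x in Iio (0 : ℝ), Complex.exp (-Complex.I * k * x) * v x

/-- The half-line Fourier transform `∫_0^∞ e^{-ikx} v(x) dx`. -/
def hatR (v : ℝ → ℂ) (k : ℂ) : ℂ := ∫ x in Ioi (0 : ℝ), Complex.exp (-Complex.I * k * x) * v x

/-- The Fresnel-type function `φ(σ, x, t)`. -/
def phi (σ x t : ℝ) : ℂ :=
  if 0 < t then
    -(Real.sign x : ℂ) + 1 / (Real.sqrt (Real.pi * σ * t) : ℂ) *
      Complex.exp (Complex.I * Real.pi / 4) *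
      ∫ y in (0 : ℝ)..x, Complex.exp (-Complex.I * (y : ℂ) ^ 2 / (4 * σ * t))
  else 0

/-- The integral of `f` along the segment from `0` to `R ω`. -/
def segmentIntegral (f : ℂ → ℂ) (ω : ℂ) (R : ℝ) : ℂ := ∫ s in (0 : ℝ)..R, f (s * ω) * ω

/-- The improper integral of `f` along the ray from `0` to `∞ ω` converges. -/
def RayConverges (f : ℂ → ℂ) (ω : ℂ) : Prop :=
  ∃ I : ℂ, Tendsto (segmentIntegral f ω) atTop (𝓝 I)

/-- The improper integral of `f` along the ray from `0` to `∞ ω`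
(meaningful when `RayConverges f ω`). -/
def rayIntegral (f : ℂ → ℂ) (ω : ℂ) : ℂ := limUnder atTop (segmentIntegral f ω)

/-- Convergence of the improper integral along the real line, both ends separately. -/
def LineConverges (f : ℂ → ℂ) : Prop := RayConverges f 1 ∧ RayConverges f (-1)

/-- `∫_{-∞}^{∞} f(k) dk` as an improper integral. -/
def lineIntegral (f : ℂ → ℂ) : ℂ := rayIntegral f 1 - rayIntegral f (-1)

/-- Convergence of the improper integral along both rays of `∂D⁻`. -/
def DMinusConverges (f : ℂ → ℂ) : Prop := RayConverges f 1 ∧ RayConverges f (-Complex.I)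

/-- The integral along `∂D⁻`. Here `D = {k : Re(-i k²) < 0} = {k : Re k * Im k < 0}`, and `D⁻`
is its part in the lower half-plane, the open fourth quadrant. The boundary is positively
oriented (`D⁻` lies to the left): it runs from `+∞` to `0` and then from `0` to `-i∞`. -/
def dMinusIntegral (f : ℂ → ℂ) : ℂ := -rayIntegral f 1 + rayIntegral f (-Complex.I)

/-- Convergence of the improper integral along both rays of `∂D⁺`. -/
def DPlusConverges (f : ℂ → ℂ) : Prop := RayConverges f (-1) ∧ RayConverges f Complex.I

/-- The integral along `∂D⁺`, where `D⁺`, the part of `D` in the upper half-plane, is the open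
second quadrant. The boundary is positively oriented (`D⁺` lies to the left): it runs from
`-∞` to `0` and then from `0` to `i∞`. -/
def dPlusIntegral (f : ℂ → ℂ) : ℂ := -rayIntegral f (-1) + rayIntegral f Complex.I

/-! ### The integrands and the formulas -/

/-- `k ↦ e^{ikx - λ(k)t} h(k)`. -/
def integrand (σ x t : ℝ) (h : ℂ → ℂ) (k : ℂ) : ℂ :=
  Complex.exp (Complex.I * k * x - lam σ k * t) * h k

/-- The three integrals in the formula for `qL(x, t)` converge
(`vL`, `vR` are the shifted initial data). -/
def LeftIntegralsConverge (σL σR : ℝ) (vL vR : ℝ → ℂ) (x t : ℝ) : Prop :=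
  LineConverges (integrand σL x t (fun k => hatL vL k)) ∧
  DMinusConverges (integrand σL x t (fun k => hatL vL (-k))) ∧
  DMinusConverges (integrand σL x t (fun k => hatR vR (k * Real.sqrt (σL / σR))))

/-- The three integrals in the formula for `qR(x, t)` converge. -/
def RightIntegralsConverge (σL σR : ℝ) (vL vR : ℝ → ℂ) (x t : ℝ) : Prop :=
  LineConverges (integrand σR x t (fun k => hatR vR k)) ∧
  DPlusConverges (integrand σR x t (fun k => hatL vL (k * Real.sqrt (σR / σL)))) ∧
  DPlusConverges (integrand σR x t (fun k => hatR vR (-k)))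

/-- The right-hand side of the formula for `qL(x, t)`, `x < 0`. -/
def formulaL (σL σR : ℝ) (βL βR γL γR : ℂ) (vL vR : ℝ → ℂ) (x t : ℝ) : ℂ :=
  γL
  + βR * σL * (γR - γL) / (βR * σL + βL * Real.sqrt (σL * σR)) * phi σL x t
  + 1 / (2 * Real.pi) * lineIntegral (integrand σL x t (fun k => hatL vL k))
  + (βR * σL - βL * Real.sqrt (σL * σR)) /
      (2 * Real.pi * (βR * σL + βL * Real.sqrt (σL * σR))) *
      dMinusIntegral (integrand σL x t (fun k => hatL vL (-k)))
  - βR * σL / (Real.pi * (βL * σR + βR * Real.sqrt (σL * σR))) *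
      dMinusIntegral (integrand σL x t (fun k => hatR vR (k * Real.sqrt (σL / σR))))

/-- The right-hand side of the formula for `qR(x, t)`, `x > 0`. -/
def formulaR (σL σR : ℝ) (βL βR γL γR : ℂ) (vL vR : ℝ → ℂ) (x t : ℝ) : ℂ :=
  γR
  + βL * Real.sqrt (σL * σR) * (γR - γL) / (βR * σL + βL * Real.sqrt (σR * σL)) * phi σR x t
  + 1 / (2 * Real.pi) * lineIntegral (integrand σR x t (fun k => hatR vR k))
  + βL * σR / (Real.pi * (βR * σL + βL * Real.sqrt (σR * σL))) *
      dPlusIntegral (integrand σR x t (fun k => hatL vL (k * Real.sqrt (σR / σL))))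
  + (βR * σL - βL * Real.sqrt (σL * σR)) /
      (2 * Real.pi * (βR * σL + βL * Real.sqrt (σR * σL))) *
      dPlusIntegral (integrand σR x t (fun k => hatR vR (-k)))

end LSInterface

end

/-!
The formulas are a disguise for the method of images. Put `H(w, z) = (4πw)^(-1/2) exp(-z²/(4w))`,
the heat kernel at a complex time `w` with `Re w ≥ 0`, so that `H(-iσt, z)` is the Schrödinger
kernel (`heatKernel`). By Fubini every integral over `k` in the formulas is the integral of a datum
against the same integral of the plane wave `exp(ikz + iτk²)`. Along the real line this is
`2π H(-iτ, z)`; along the boundaries of the quadrants it is `∓2π H(-iτ, z)`, because for `z` of the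
sign that occurs the imaginary ray may be exchanged for the opposite real ray: both ray integrals
solve the same first order equation in `z`. All truncated integrals are bounded through those of
the Fresnel integral (`fresnel`), which gives convergence, and for `t > 0` the formulas become a
free evolution, a reflected and a transmitted one, plus an error function carrying the jump
`γR - γL` (`formulaL_of_pos`, `formulaR_of_pos`, with `leftFlow`, `rightFlow`). At `t = 0` the
plane waves integrate to Dirichlet kernels, and convergence to the datum is Dini's test.

Existence: under the second moment condition `leftFlow` and `rightFlow` are classical solutions
for all real `x`, and the interface conditions are an identity between the coefficients. They tend
to their limits at infinity by the Riemann–Lebesgue lemma. As `t → 0` one integrates by parts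
once, so that the datum enters through its integrable derivative and the kernel through a bounded
primitive (`isSolution_formula`).

Uniqueness: a solution is paired with the backward flow made of kernels `H(ε - iσ(T - s), x - cy)`,
combined so as to satisfy the adjoint interface conditions. For `ε > 0` it decays like a Gaussian,
so Green's identity with a polynomial cut-off shows that the pairing is conserved for
`0 < s ≤ T` (`green_halfLine`), and the mean square growth bound allows the limit `s → 0`
(`tendsto_pairing_initial`, `IsSolution.duality`). As `ε → 0` the final values of the backward flow
concentrate at the point `x` and at image points on the wrong side of the interface, where they
see nothing, while the initial values become Schrödinger kernels. These are not integrable, so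
the solution with data `γL`, `γR` is first subtracted (`IsSolution.representation`); it is known
explicitly, and adding it back gives the formulas (`IsSolution.eq_formula`).
-/


noncomputable section

namespace LSInterface

/-! ### The heat kernel with complex time -/

/-- The heat kernel `(4πw)^(-1/2) e^{-z²/(4w)}` at the complex time `w`, with the principal branch
of the power. For `w = -iσt` it is the fundamental solution of `i q_t = σ q_xx`. -/
def heatKernel (w : ℂ) (z : ℝ) : ℂ :=
  (4 * Real.pi * w) ^ (-(1 / 2) : ℂ) * Complex.exp (-(z : ℂ) ^ 2 / (4 * w))

/-- The derivative of `heatKernel w` in space. -/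
def heatKernel₁ (w : ℂ) (z : ℝ) : ℂ := -(z / (2 * w)) * heatKernel w z

/-- The second derivative of `heatKernel w` in space. -/
def heatKernel₂ (w : ℂ) (z : ℝ) : ℂ := ((z / (2 * w)) ^ 2 - 1 / (2 * w)) * heatKernel w z

lemma hasDerivAt_heatKernel (w : ℂ) (z : ℝ) :
    HasDerivAt (heatKernel w) (heatKernel₁ w z) z := by
  have h : HasDerivAt (fun y : ℝ => -(y : ℂ) ^ 2 / (4 * w)) (-(2 * (z : ℂ)) / (4 * w)) z := by
    have := (((hasDerivAt_id z).ofReal_comp.pow 2).neg).div_const (4 * w)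
    simpa using this
  refine (h.cexp.const_mul ((4 * Real.pi * w) ^ (-(1 / 2) : ℂ))).congr_deriv ?_
  rw [heatKernel₁, heatKernel]
  rcases eq_or_ne w 0 with rfl | hw
  · simp
  · field_simp
    ring

lemma hasDerivAt_heatKernel₁ (w : ℂ) (z : ℝ) :
    HasDerivAt (heatKernel₁ w) (heatKernel₂ w z) z := by
  have h : HasDerivAt (fun y : ℝ => -((y : ℂ) / (2 * w))) (-(1 / (2 * w))) z := by
    simpa using ((hasDerivAt_id z).ofReal_comp.div_const (2 * w)).fun_neg
  refine (h.mul (hasDerivAt_heatKernel w z)).congr_deriv ?_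
  rw [heatKernel₂, heatKernel₁]
  ring

lemma four_pi_mul_mem_slitPlane {w : ℂ} (hw : w ∈ Complex.slitPlane) :
    4 * Real.pi * w ∈ Complex.slitPlane := by
  have h : (4 * Real.pi * w : ℂ) = ((4 * Real.pi : ℝ) : ℂ) * w := by push_cast; ring
  have hp : (0 : ℝ) < 4 * Real.pi := by positivity
  rw [h, Complex.mem_slitPlane_iff] at *
  rw [Complex.re_ofReal_mul, Complex.im_ofReal_mul]
  rcases hw with hw | hw
  · left; positivity
  · right; positivity

/-- The heat equation in complex time. -/
lemma hasDerivAt_heatKernel_time {w : ℂ} (hw : w ∈ Complex.slitPlane) (z : ℝ) :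
    HasDerivAt (fun w => heatKernel w z) (heatKernel₂ w z) w := by
  have hw0 : w ≠ 0 := Complex.slitPlane_ne_zero hw
  have hpi : (Real.pi : ℂ) ≠ 0 := by exact_mod_cast Real.pi_ne_zero
  have h1 : HasDerivAt (fun w : ℂ => 4 * Real.pi * w) (4 * Real.pi : ℂ) w := by
    simpa using (hasDerivAt_id w).const_mul (4 * Real.pi : ℂ)
  have h2 := h1.cpow_const (c := (-(1 / 2) : ℂ)) (four_pi_mul_mem_slitPlane hw)
  have h3 : HasDerivAt (fun w : ℂ => -(z : ℂ) ^ 2 / (4 * w)) ((z : ℂ) ^ 2 / (4 * w ^ 2)) w := by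
    have := ((hasDerivAt_inv hw0).const_mul (-(z : ℂ) ^ 2 / 4))
    refine (this.congr_deriv ?_).congr_of_eventuallyEq ?_
    · field_simp
    · filter_upwards [isOpen_ne.mem_nhds hw0] with y hy
      field_simp
  refine (h2.mul h3.cexp).congr_deriv ?_
  rw [heatKernel₂, heatKernel, Complex.cpow_sub _ _ (by simp [hw0, hpi]), Complex.cpow_one]
  field_simp
  ring

lemma continuousAt_heatKernel {w : ℂ} (hw : w ∈ Complex.slitPlane) (z : ℝ) :
    ContinuousAt (fun p : ℂ × ℝ => heatKernel p.1 p.2) (w, z) := by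
  have hw0 : w ≠ 0 := Complex.slitPlane_ne_zero hw
  refine ContinuousAt.mul ?_ (ContinuousAt.cexp (ContinuousAt.div ?_ ?_ ?_))
  · refine ContinuousAt.cpow ?_ continuousAt_const ?_
    · fun_prop
    · exact four_pi_mul_mem_slitPlane hw
  · fun_prop
  · fun_prop
  · simpa using hw0

lemma continuousAt_heatKernel₁ {w : ℂ} (hw : w ∈ Complex.slitPlane) (z : ℝ) :
    ContinuousAt (fun p : ℂ × ℝ => heatKernel₁ p.1 p.2) (w, z) := by
  have hw0 : w ≠ 0 := Complex.slitPlane_ne_zero hw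
  refine ContinuousAt.mul (ContinuousAt.neg (ContinuousAt.div ?_ ?_ ?_))
    (continuousAt_heatKernel hw z)
  · fun_prop
  · fun_prop
  · simpa using hw0

lemma continuousAt_heatKernel₂ {w : ℂ} (hw : w ∈ Complex.slitPlane) (z : ℝ) :
    ContinuousAt (fun p : ℂ × ℝ => heatKernel₂ p.1 p.2) (w, z) := by
  have hw0 : w ≠ 0 := Complex.slitPlane_ne_zero hw
  refine ContinuousAt.mul (ContinuousAt.sub (ContinuousAt.pow (ContinuousAt.div ?_ ?_ ?_) 2)
    (ContinuousAt.div ?_ ?_ ?_)) (continuousAt_heatKernel hw z)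
  all_goals first | fun_prop | simpa using hw0

lemma continuous_heatKernel (w : ℂ) : Continuous (heatKernel w) :=
  continuous_iff_continuousAt.2 fun z => (hasDerivAt_heatKernel w z).continuousAt

lemma continuous_heatKernel₁ (w : ℂ) : Continuous (heatKernel₁ w) :=
  continuous_iff_continuousAt.2 fun z => (hasDerivAt_heatKernel₁ w z).continuousAt

lemma continuous_heatKernel₂ (w : ℂ) : Continuous (heatKernel₂ w) := by
  have := continuous_heatKernel w
  unfold heatKernel₂
  fun_prop

lemma heatKernel_neg (w : ℂ) (z : ℝ) : heatKernel w (-z) = heatKernel w z := by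
  simp [heatKernel]

lemma heatKernel₁_neg (w : ℂ) (z : ℝ) : heatKernel₁ w (-z) = -heatKernel₁ w z := by
  simp [heatKernel₁, heatKernel_neg, neg_div]

lemma norm_heatKernel {w : ℂ} (hw : w ≠ 0) (z : ℝ) :
    ‖heatKernel w z‖ =
      (4 * Real.pi * ‖w‖) ^ (-(1 / 2) : ℝ) * Real.exp (-(w.re / (4 * ‖w‖ ^ 2)) * z ^ 2) := by
  have hpi : (Real.pi : ℂ) ≠ 0 := by exact_mod_cast Real.pi_ne_zero
  have he : (-(1 / 2) : ℂ) = ((-(1 / 2) : ℝ) : ℂ) := by push_cast; ring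
  rw [heatKernel, norm_mul, Complex.norm_exp, he, Complex.norm_cpow_real]
  congr 2
  · simp [abs_of_pos Real.pi_pos]
  · have : -(z : ℂ) ^ 2 / (4 * w) = ((-z ^ 2 / 4 : ℝ) : ℂ) * w⁻¹ := by
      push_cast; field_simp
    rw [this, Complex.re_ofReal_mul, Complex.inv_re, Complex.normSq_eq_norm_sq]
    have : ‖w‖ ≠ 0 := by simpa using hw
    field_simp

lemma norm_heatKernel_le {w : ℂ} (hw : w ≠ 0) (hre : 0 ≤ w.re) (z : ℝ) :
    ‖heatKernel w z‖ ≤ (4 * Real.pi * ‖w‖) ^ (-(1 / 2) : ℝ) := by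
  rw [norm_heatKernel hw]
  refine mul_le_of_le_one_right (by positivity) ?_
  rw [Real.exp_le_one_iff]
  have : 0 ≤ w.re / (4 * ‖w‖ ^ 2) := by positivity
  nlinarith [sq_nonneg z]

/-! ### The Schrödinger kernel -/

lemma schrodingerTime_mem_slitPlane {τ : ℝ} (hτ : 0 < τ) :
    -Complex.I * τ ∈ Complex.slitPlane := by
  rw [Complex.mem_slitPlane_iff]; right; simp; positivity

/-- At the time `w = -iτ` the heat kernel is the Schrödinger kernel
`e^{iπ/4} (4πτ)^(-1/2) e^{-iz²/(4τ)}`. -/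
lemma heatKernel_neg_I_mul {τ : ℝ} (hτ : 0 < τ) (z : ℝ) :
    heatKernel (-Complex.I * τ) z =
      Complex.exp (Complex.I * Real.pi / 4) / (Real.sqrt (4 * Real.pi * τ) : ℂ) *
        Complex.exp (-Complex.I * (z : ℂ) ^ 2 / (4 * τ)) := by
  have hpi := Real.pi_pos
  have h4 : (4 * Real.pi * (-Complex.I * τ) : ℂ) = ((4 * Real.pi * τ : ℝ) : ℂ) * (-Complex.I) := by
    push_cast; ring
  have hτ' : (τ : ℂ) ≠ 0 := by exact_mod_cast hτ.ne'
  have h1 : (Real.log (4 * Real.pi * τ) : ℂ) * (-(1 / 2)) =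
      ((Real.log (4 * Real.pi * τ) * (-(1 / 2)) : ℝ) : ℂ) := by
    push_cast; ring
  have h2 : Real.exp (Real.log (4 * Real.pi * τ) * (-(1 / 2))) =
      (Real.sqrt (4 * Real.pi * τ))⁻¹ := by
    rw [Real.sqrt_eq_rpow, ← Real.rpow_neg (by positivity), Real.rpow_def_of_pos (by positivity)]
  have h3 : -(z : ℂ) ^ 2 / (4 * (-Complex.I * τ)) = -Complex.I * (z : ℂ) ^ 2 / (4 * τ) := by
    field_simp
    rw [Complex.I_sq]
    ring
  have h5 : ((4 * Real.pi * τ : ℝ) : ℂ) ≠ 0 := by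
    exact_mod_cast (by positivity : (0 : ℝ) < 4 * Real.pi * τ).ne'
  rw [heatKernel, h3, h4, Complex.cpow_def_of_ne_zero (by simpa using h5),
    Complex.log_ofReal_mul (by positivity) (by simp), add_mul, Complex.exp_add,
    Complex.log_neg_I, h1,
    ← Complex.ofReal_exp, h2]
  have h6 : -(Real.pi / 2 : ℂ) * Complex.I * (-(1 / 2)) = Complex.I * Real.pi / 4 := by ring
  push_cast
  rw [h6]
  ring

/-! ### Fresnel integrals -/

/-- The Fresnel integral `∫₀ˢ e^{iηu²} du`. -/
def fresnel (η s : ℝ) : ℂ := ∫ u in (0 : ℝ)..s, Complex.exp (η * Complex.I * (u : ℂ) ^ 2)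

lemma norm_exp_I_mul_sq (η u : ℝ) : ‖Complex.exp (η * Complex.I * (u : ℂ) ^ 2)‖ = 1 := by
  have : (η * Complex.I * (u : ℂ) ^ 2) = ((η * u ^ 2 : ℝ) : ℂ) * Complex.I := by push_cast; ring
  rw [this, Complex.norm_exp_ofReal_mul_I]

lemma hasDerivAt_fresnel (η s : ℝ) :
    HasDerivAt (fresnel η) (Complex.exp (η * Complex.I * (s : ℂ) ^ 2)) s := by
  have hc : Continuous fun u : ℝ => Complex.exp (η * Complex.I * (u : ℂ) ^ 2) := by fun_prop
  exact intervalIntegral.integral_hasDerivAt_right (hc.intervalIntegrable _ _)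
    (hc.stronglyMeasurableAtFilter _ _) hc.continuousAt

lemma continuous_fresnel (η : ℝ) : Continuous (fresnel η) :=
  continuous_iff_continuousAt.2 fun s => (hasDerivAt_fresnel η s).continuousAt

lemma fresnel_zero (η : ℝ) : fresnel η 0 = 0 := by simp [fresnel]

lemma fresnel_neg (η s : ℝ) : fresnel η (-s) = -fresnel η s := by
  have := intervalIntegral.integral_comp_neg (a := 0) (b := s)
    (fun u : ℝ => Complex.exp (η * Complex.I * (u : ℂ) ^ 2))
  rw [fresnel, fresnel, intervalIntegral.integral_symm, neg_inj]
  simpa using this.symm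

/-- The Fresnel integral converges: up to an oscillating term of size `1/s` its derivative is
absolutely integrable. -/
lemma exists_tendsto_fresnel {η : ℝ} (hη : η ≠ 0) : ∃ l, Tendsto (fresnel η) atTop (𝓝 l) := by
  have hη' : (η : ℂ) ≠ 0 := by exact_mod_cast hη
  set B : ℝ → ℂ := fun s => Complex.exp (η * Complex.I * (s : ℂ) ^ 2) / (2 * η * Complex.I * s)
  have hB : ∀ s ∈ Ioi (0 : ℝ), HasDerivAt (fun s => fresnel η s - B s)
      (Complex.exp (η * Complex.I * (s : ℂ) ^ 2) / (2 * η * Complex.I * s ^ 2)) s := by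
    intro s hs
    have hs' : (s : ℂ) ≠ 0 := by exact_mod_cast (ne_of_gt hs)
    have h1 : HasDerivAt (fun u : ℝ => η * Complex.I * (u : ℂ) ^ 2)
        (η * Complex.I * (2 * s)) s := by
      simpa using ((hasDerivAt_id s).ofReal_comp.pow 2).const_mul (η * Complex.I)
    have h2 : HasDerivAt (fun u : ℝ => 2 * η * Complex.I * (u : ℂ)) (2 * η * Complex.I) s := by
      simpa using ((hasDerivAt_id s).ofReal_comp).const_mul (2 * η * Complex.I)
    refine ((hasDerivAt_fresnel η s).sub (h1.cexp.div h2 (by simp [hη', hs']))).congr_deriv ?_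
    field_simp
    ring
  have hint : IntegrableOn (fun s : ℝ => Complex.exp (η * Complex.I * (s : ℂ) ^ 2) /
      (2 * η * Complex.I * s ^ 2)) (Ioi 1) := by
    have h := (integrableOn_Ioi_rpow_of_lt (a := -2) (by norm_num) (zero_lt_one)).const_mul
      (1 / (2 * |η|))
    refine Integrable.mono' h ?_ ?_
    · refine Measurable.aestronglyMeasurable ?_
      fun_prop
    · refine (ae_restrict_mem measurableSet_Ioi).mono fun s hs => ?_
      have hs0 : (0 : ℝ) < s := lt_trans one_pos hs
      rw [norm_div, norm_exp_I_mul_sq, Real.rpow_neg hs0.le]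
      simp [mul_comm]
  have hB0 : Tendsto B atTop (𝓝 0) := by
    rw [tendsto_zero_iff_norm_tendsto_zero]
    have : (fun s => ‖B s‖) = fun s : ℝ => (1 / (2 * |η|)) * |s|⁻¹ := by
      funext s
      simp only [B]
      rw [norm_div, norm_exp_I_mul_sq]
      simp [mul_comm]
    rw [this]
    simpa using (tendsto_inv_atTop_zero.comp tendsto_abs_atTop_atTop).const_mul (1 / (2 * |η|))
  have := tendsto_limUnder_of_hasDerivAt_of_integrableOn_Ioi (a := 1)
    (fun s hs => hB s (lt_trans one_pos (mem_Ioi.1 hs))) hint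
  exact ⟨_, by simpa using this.add hB0⟩

lemma exists_norm_fresnel_le {η : ℝ} (hη : η ≠ 0) : ∃ C, 0 ≤ C ∧ ∀ s, ‖fresnel η s‖ ≤ C := by
  obtain ⟨l, hl⟩ := exists_tendsto_fresnel hη
  obtain ⟨N, hN⟩ := (eventually_atTop.1 (hl.norm.eventually (gt_mem_nhds (lt_add_one ‖l‖))))
  obtain ⟨M, hM⟩ := (isCompact_Icc (a := (0 : ℝ)) (b := N)).exists_bound_of_continuousOn
    (continuous_fresnel η).continuousOn
  have key : ∀ s ≥ 0, ‖fresnel η s‖ ≤ max M (‖l‖ + 1) := by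
    intro s hs
    rcases le_total s N with h | h
    · exact (hM s ⟨hs, h⟩).trans (le_max_left _ _)
    · exact (hN s h).le.trans (le_max_right _ _)
  refine ⟨max M (‖l‖ + 1), (norm_nonneg _).trans (key 0 le_rfl), fun s => ?_⟩
  rcases le_total 0 s with h | h
  · exact key s h
  · have := key (-s) (by linarith)
    rwa [fresnel_neg, norm_neg] at this

/-- Abel summation of the Fresnel integral: the absolutely convergent Gaussian integral is an
average of the values of the Fresnel integral. -/
lemma integral_gaussian_eq_integral_fresnel {η : ℝ} (hη : η ≠ 0) {ε : ℝ} (hε : 0 < ε) :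
    ∫ u in Ioi (0 : ℝ), Complex.exp (-(ε - η * Complex.I) * (u : ℂ) ^ 2) =
      ∫ u in Ioi (0 : ℝ), ((2 * u * Real.exp (-u ^ 2) : ℝ) : ℂ) * fresnel η (u / Real.sqrt ε) := by
  obtain ⟨C, hC0, hC⟩ := exists_norm_fresnel_le hη
  have hint : Integrable fun u : ℝ => 2 * ε * u * Real.exp (-ε * u ^ 2) := by
    have := (integrable_mul_exp_neg_mul_sq hε).const_mul (2 * ε)
    refine this.congr (.of_forall fun u => ?_)
    ring
  have hpart := integral_Ioi_mul_deriv_eq_deriv_mul (a := (0 : ℝ)) (a' := 0) (b' := 0)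
    (u := fun u : ℝ => ((Real.exp (-ε * u ^ 2) : ℝ) : ℂ)) (v := fresnel η)
    (u' := fun u : ℝ => ((-(2 * ε * u * Real.exp (-ε * u ^ 2)) : ℝ) : ℂ))
    (v' := fun u : ℝ => Complex.exp (η * Complex.I * (u : ℂ) ^ 2)) ?_ ?_ ?_ ?_ ?_ ?_
  · have h1 : ∀ u : ℝ, Complex.exp (-(ε - η * Complex.I) * (u : ℂ) ^ 2) =
        ((Real.exp (-ε * u ^ 2) : ℝ) : ℂ) * Complex.exp (η * Complex.I * (u : ℂ) ^ 2) := by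
      intro u
      rw [Complex.ofReal_exp, ← Complex.exp_add]
      congr 1; push_cast; ring
    simp_rw [h1]
    rw [hpart]
    have hs : 0 < Real.sqrt ε := Real.sqrt_pos.2 hε
    have h2 := integral_comp_mul_left_Ioi (fun u : ℝ => ((2 * u * Real.exp (-u ^ 2) : ℝ) : ℂ) *
      fresnel η (u / Real.sqrt ε)) 0 hs
    rw [mul_zero] at h2
    have h3 : (∫ u in Ioi (0 : ℝ), ((2 * u * Real.exp (-u ^ 2) : ℝ) : ℂ) *
        fresnel η (u / Real.sqrt ε)) = Real.sqrt ε • ∫ x in Ioi (0 : ℝ),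
        (fun u : ℝ => ((2 * u * Real.exp (-u ^ 2) : ℝ) : ℂ) * fresnel η (u / Real.sqrt ε))
          (Real.sqrt ε * x) := by
      rw [h2, smul_smul, mul_inv_cancel₀ hs.ne', one_smul]
    rw [h3, ← integral_smul, sub_zero, zero_sub, ← integral_neg]
    refine integral_congr_ae (.of_forall fun u => ?_)
    have h4 : (Real.sqrt ε * u) ^ 2 = ε * u ^ 2 := by rw [mul_pow, Real.sq_sqrt hε.le]
    have h5 : Real.sqrt ε * u / Real.sqrt ε = u := by field_simp
    have h6 : (ε : ℂ) = (Real.sqrt ε : ℂ) * (Real.sqrt ε : ℂ) := by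
      exact_mod_cast (Real.mul_self_sqrt hε.le).symm
    simp only [h4, h5, Complex.real_smul, neg_mul]
    push_cast
    rw [h6]
    ring
  · intro u _
    refine HasDerivAt.ofReal_comp ?_
    have : HasDerivAt (fun u : ℝ => -ε * u ^ 2) (-ε * (2 * u)) u := by
      simpa using ((hasDerivAt_id u).pow 2).const_mul (-ε)
    refine this.exp.congr_deriv ?_
    ring
  · exact fun u _ => hasDerivAt_fresnel η u
  · refine Integrable.integrableOn ?_
    refine Integrable.mono' (integrable_exp_neg_mul_sq hε) ?_ (.of_forall fun u => ?_)
    · exact Continuous.aestronglyMeasurable (by simp only [Pi.mul_def]; fun_prop)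
    · rw [Pi.mul_apply, norm_mul, norm_exp_I_mul_sq, mul_one, Complex.norm_real,
        Real.norm_of_nonneg (Real.exp_pos _).le]
  · refine Integrable.integrableOn ?_
    refine Integrable.mono' (hint.norm.const_mul C) ?_ (.of_forall fun u => ?_)
    · have := continuous_fresnel η
      exact Continuous.aestronglyMeasurable (by simp only [Pi.mul_def]; fun_prop)
    · rw [Pi.mul_apply, norm_mul, mul_comm, Complex.norm_real, norm_neg]
      exact mul_le_mul_of_nonneg_right (hC u) (norm_nonneg _)
  · have h : Continuous ((fun u : ℝ => ((Real.exp (-ε * u ^ 2) : ℝ) : ℂ)) * fresnel η) := by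
      have := continuous_fresnel η
      simp only [Pi.mul_def]; fun_prop
    have := h.tendsto 0
    simp only [Pi.mul_apply, fresnel_zero, mul_zero] at this
    exact this.mono_left nhdsWithin_le_nhds
  · rw [tendsto_zero_iff_norm_tendsto_zero]
    have h0 : Tendsto (fun u : ℝ => Real.exp (-ε * u ^ 2)) atTop (𝓝 0) := by
      refine Real.tendsto_exp_atBot.comp ?_
      exact (tendsto_pow_atTop two_ne_zero).const_mul_atTop_of_neg (by linarith)
    refine squeeze_zero (fun _ => norm_nonneg _) (fun u => ?_)
      (mul_zero C ▸ h0.const_mul C)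
    rw [Pi.mul_apply, norm_mul, mul_comm, Complex.norm_real,
      Real.norm_of_nonneg (Real.exp_pos _).le]
    exact mul_le_mul_of_nonneg_right (hC u) (Real.exp_pos _).le

lemma tendsto_fresnel_cpow {η : ℝ} (hη : η ≠ 0) :
    Tendsto (fresnel η) atTop (𝓝 ((Real.pi / (-(η * Complex.I))) ^ (1 / 2 : ℂ) / 2)) := by
  obtain ⟨l, hl⟩ := exists_tendsto_fresnel hη
  obtain ⟨C, hC0, hC⟩ := exists_norm_fresnel_le hη
  have hη' : (η : ℂ) ≠ 0 := by exact_mod_cast hη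
  have hint : IntegrableOn (fun u : ℝ => 2 * u * Real.exp (-u ^ 2)) (Ioi 0) := by
    have := ((integrable_mul_exp_neg_mul_sq one_pos).const_mul 2).integrableOn (s := Ioi 0)
    refine this.congr (.of_forall fun u => ?_)
    simp only [neg_mul, one_mul]
    ring
  have hone : ∫ u in Ioi (0 : ℝ), ((2 * u * Real.exp (-u ^ 2) : ℝ) : ℂ) = 1 := by
    have := integral_mul_cexp_neg_mul_sq (b := 1) (by simp)
    have h2 : ∀ u : ℝ, ((2 * u * Real.exp (-u ^ 2) : ℝ) : ℂ) =
        2 * ((u : ℂ) * Complex.exp (-1 * (u : ℂ) ^ 2)) := by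
      intro u; push_cast; rw [neg_one_mul]; ring
    simp_rw [h2]
    rw [integral_const_mul, this]
    norm_num
  have h1 : Tendsto (fun ε : ℝ => ∫ u in Ioi (0 : ℝ),
      Complex.exp (-(ε - η * Complex.I) * (u : ℂ) ^ 2)) (𝓝[>] 0) (𝓝 l) := by
    have hlim : Tendsto (fun ε : ℝ => ∫ u in Ioi (0 : ℝ), ((2 * u * Real.exp (-u ^ 2) : ℝ) : ℂ) *
        fresnel η (u / Real.sqrt ε)) (𝓝[>] 0)
        (𝓝 (∫ u in Ioi (0 : ℝ), ((2 * u * Real.exp (-u ^ 2) : ℝ) : ℂ) * l)) := by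
      refine tendsto_integral_filter_of_dominated_convergence
        (fun u => (2 * u * Real.exp (-u ^ 2)) * C) ?_ ?_ (hint.mul_const C) ?_
      · refine .of_forall fun ε => ?_
        have := continuous_fresnel η
        exact Continuous.aestronglyMeasurable (by fun_prop)
      · refine .of_forall fun ε => (ae_restrict_mem measurableSet_Ioi).mono fun u hu => ?_
        have hu' : (0 : ℝ) < u := hu
        rw [norm_mul, Complex.norm_real, Real.norm_of_nonneg (by positivity)]
        exact mul_le_mul_of_nonneg_left (hC _) (by positivity)
      · refine (ae_restrict_mem measurableSet_Ioi).mono fun u hu => ?_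
        refine (hl.comp ?_).const_mul _
        have : Tendsto (fun ε : ℝ => (Real.sqrt ε)⁻¹) (𝓝[>] 0) atTop := by
          refine tendsto_inv_nhdsGT_zero.comp ?_
          refine tendsto_nhdsWithin_iff.2 ⟨?_, ?_⟩
          · have := Real.continuous_sqrt.tendsto 0
            rw [Real.sqrt_zero] at this
            exact this.mono_left nhdsWithin_le_nhds
          · exact eventually_nhdsWithin_of_forall fun ε hε => Real.sqrt_pos.2 hε
        exact this.const_mul_atTop hu
    rw [integral_mul_const, hone, one_mul] at hlim
    refine hlim.congr' ?_
    exact eventually_nhdsWithin_of_forall fun ε hε =>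
      (integral_gaussian_eq_integral_fresnel hη hε).symm
  have h2 : Tendsto (fun ε : ℝ => ∫ u in Ioi (0 : ℝ),
      Complex.exp (-(ε - η * Complex.I) * (u : ℂ) ^ 2)) (𝓝[>] 0)
      (𝓝 ((Real.pi / (-(η * Complex.I))) ^ (1 / 2 : ℂ) / 2)) := by
    have hc : ContinuousAt (fun ε : ℝ => (Real.pi / (ε - η * Complex.I)) ^ (1 / 2 : ℂ) / 2) 0 := by
      refine ContinuousAt.div_const (ContinuousAt.cpow (ContinuousAt.div continuousAt_const
        (by fun_prop) (by simp [hη])) continuousAt_const ?_) 2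
      rw [Complex.mem_slitPlane_iff]
      right
      simp [Complex.div_im, hη, Real.pi_ne_zero]
    have := hc.tendsto.mono_left (nhdsWithin_le_nhds (s := Ioi (0 : ℝ)))
    simp only [Complex.ofReal_zero, zero_sub] at this
    refine this.congr' ?_
    exact eventually_nhdsWithin_of_forall fun ε hε =>
      (integral_gaussian_complex_Ioi (by simpa using hε)).symm
  rwa [tendsto_nhds_unique h2 h1]

/-- The limit `√π/2 · e^{iπη/4}` of the Fresnel integrals, for `η = ±1`. -/
lemma tendsto_fresnel {η : ℝ} (hη : η = 1 ∨ η = -1) :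
    Tendsto (fresnel η) atTop
      (𝓝 ((Real.sqrt Real.pi : ℂ) / 2 * Complex.exp (η * (Complex.I * Real.pi / 4)))) := by
  have hη0 : η ≠ 0 := by rcases hη with rfl | rfl <;> norm_num
  convert tendsto_fresnel_cpow hη0 using 2
  have h0 : (Real.pi / (-(η * Complex.I)) : ℂ) = (Real.pi : ℂ) * (η * Complex.I) := by
    rcases hη with rfl | rfl <;> simp [div_eq_mul_inv]
  have h1 : Complex.log (η * Complex.I) = η * (Real.pi / 2 * Complex.I) := by
    rcases hη with rfl | rfl
    · simp [Complex.log_I]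
    · simp [Complex.log_neg_I]
  have hI : (η * Complex.I : ℂ) ≠ 0 := by simp [hη0]
  have hpi : (Real.pi : ℂ) ≠ 0 := by exact_mod_cast Real.pi_ne_zero
  rw [h0, Complex.cpow_def_of_ne_zero (mul_ne_zero hpi hI), Complex.log_ofReal_mul Real.pi_pos hI,
    add_mul, Complex.exp_add, h1]
  have h2 : (Real.log Real.pi : ℂ) * (1 / 2) = ((Real.log Real.pi * (1 / 2) : ℝ) : ℂ) := by
    push_cast; ring
  rw [h2, ← Complex.ofReal_exp, Real.sqrt_eq_rpow, Real.rpow_def_of_pos Real.pi_pos]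
  have h3 : (η * (Real.pi / 2 * Complex.I) * (1 / 2) : ℂ) = η * (Complex.I * Real.pi / 4) := by
    ring
  rw [h3]
  ring

/-! ### Integrals of plane waves along rays -/

/-- The plane wave `e^{ikz + iτk²}`, as a function of the wave number `k`. -/
def planeWave (τ z : ℝ) (k : ℂ) : ℂ := Complex.exp (Complex.I * k * z + Complex.I * τ * k ^ 2)

lemma segmentIntegral_planeWave_neg (τ z : ℝ) (ω : ℂ) (R : ℝ) :
    segmentIntegral (planeWave τ z) (-ω) R = -segmentIntegral (planeWave τ (-z)) ω R := by
  rw [segmentIntegral, segmentIntegral, ← intervalIntegral.integral_neg]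
  refine intervalIntegral.integral_congr fun s _ => ?_
  simp only [planeWave, mul_neg, neg_mul, Complex.ofReal_neg, even_two, Even.neg_pow]

lemma continuous_segmentIntegral_planeWave (τ : ℝ) (ω : ℂ) (R : ℝ) :
    Continuous fun z => segmentIntegral (planeWave τ z) ω R := by
  unfold segmentIntegral
  refine intervalIntegral.continuous_parametric_intervalIntegral_of_continuous' ?_ 0 R
  unfold planeWave
  simp only [Function.uncurry_def]
  fun_prop

/-- The value of `∫₀^∞ e^{ikz + iτk²} dk`, for `τ > 0`. -/
def rayValue (τ z : ℝ) : ℂ :=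
  Complex.exp (-Complex.I * (z : ℂ) ^ 2 / (4 * τ)) / (Real.sqrt τ : ℂ) *
    ((Real.sqrt Real.pi : ℂ) / 2 * Complex.exp (Complex.I * Real.pi / 4) -
      fresnel 1 (z / (2 * Real.sqrt τ)))

/-- Completing the square. -/
lemma segmentIntegral_planeWave_one {τ : ℝ} (hτ : 0 < τ) (z R : ℝ) :
    segmentIntegral (planeWave τ z) 1 R =
      Complex.exp (-Complex.I * (z : ℂ) ^ 2 / (4 * τ)) / (Real.sqrt τ : ℂ) *
        (fresnel 1 (Real.sqrt τ * R + z / (2 * Real.sqrt τ)) -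
          fresnel 1 (z / (2 * Real.sqrt τ))) := by
  have hs : 0 < Real.sqrt τ := Real.sqrt_pos.2 hτ
  have hs' : (Real.sqrt τ : ℂ) ≠ 0 := by exact_mod_cast hs.ne'
  have hτs : (τ : ℂ) = (Real.sqrt τ : ℂ) ^ 2 := by exact_mod_cast (Real.sq_sqrt hτ.le).symm
  have hc : ∀ a b : ℝ, IntervalIntegrable
      (fun u : ℝ => Complex.exp ((1 : ℝ) * Complex.I * (u : ℂ) ^ 2)) volume a b := fun a b =>
    Continuous.intervalIntegrable (by fun_prop) a b
  have h := intervalIntegral.integral_comp_mul_add (a := 0) (b := R)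
    (fun u : ℝ => Complex.exp ((1 : ℝ) * Complex.I * (u : ℂ) ^ 2)) hs.ne'
    (z / (2 * Real.sqrt τ))
  rw [fresnel, fresnel, intervalIntegral.integral_interval_sub_left (hc _ _) (hc _ _)]
  rw [mul_zero, zero_add] at h
  rw [Complex.real_smul, Complex.ofReal_inv] at h
  rw [div_eq_mul_inv, mul_assoc, ← h, segmentIntegral, ← intervalIntegral.integral_const_mul]
  refine intervalIntegral.integral_congr fun s _ => ?_
  simp only [planeWave, ← Complex.exp_add, mul_one]
  congr 1
  push_cast
  rw [hτs]
  field_simp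
  ring

lemma tendsto_segmentIntegral_planeWave_one {τ : ℝ} (hτ : 0 < τ) (z : ℝ) :
    Tendsto (segmentIntegral (planeWave τ z) 1) atTop (𝓝 (rayValue τ z)) := by
  have hs : 0 < Real.sqrt τ := Real.sqrt_pos.2 hτ
  have h1 : Tendsto (fun R : ℝ => Real.sqrt τ * R + z / (2 * Real.sqrt τ)) atTop atTop :=
    tendsto_atTop_add_const_right _ _ (tendsto_id.const_mul_atTop hs)
  have h2 := (tendsto_fresnel (η := 1) (Or.inl rfl)).comp h1
  rw [Complex.ofReal_one, one_mul] at h2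
  refine ((h2.sub_const (fresnel 1 (z / (2 * Real.sqrt τ)))).const_mul
    (Complex.exp (-Complex.I * (z : ℂ) ^ 2 / (4 * τ)) / (Real.sqrt τ : ℂ))).congr fun R => ?_
  exact (segmentIntegral_planeWave_one hτ z R).symm

lemma norm_exp_neg_I_mul_sq_div (z τ : ℝ) :
    ‖Complex.exp (-Complex.I * (z : ℂ) ^ 2 / (4 * τ))‖ = 1 := by
  have : -Complex.I * (z : ℂ) ^ 2 / (4 * τ) = ((-(z ^ 2) / (4 * τ) : ℝ) : ℂ) * Complex.I := by
    push_cast; ring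
  rw [this, Complex.norm_exp_ofReal_mul_I]

lemma exists_norm_segmentIntegral_planeWave_one_le {τ : ℝ} (hτ : 0 < τ) :
    ∃ C, ∀ z R, ‖segmentIntegral (planeWave τ z) 1 R‖ ≤ C := by
  obtain ⟨C, -, hC⟩ := exists_norm_fresnel_le (η := 1) one_ne_zero
  refine ⟨1 / Real.sqrt τ * (C + C), fun z R => ?_⟩
  rw [segmentIntegral_planeWave_one hτ, norm_mul, norm_div, norm_exp_neg_I_mul_sq_div,
    Complex.norm_real, Real.norm_of_nonneg (Real.sqrt_nonneg _)]
  refine mul_le_mul_of_nonneg_left ?_ (by positivity)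
  exact (norm_sub_le _ _).trans (add_le_add (hC _) (hC _))

lemma rayValue_add_rayValue_neg {τ : ℝ} (hτ : 0 < τ) (z : ℝ) :
    rayValue τ z + rayValue τ (-z) = 2 * Real.pi * heatKernel (-Complex.I * τ) z := by
  have hs : 0 < Real.sqrt τ := Real.sqrt_pos.2 hτ
  have hs' : (Real.sqrt τ : ℂ) ≠ 0 := by exact_mod_cast hs.ne'
  have hp' : (Real.sqrt Real.pi : ℂ) ≠ 0 := by
    exact_mod_cast (Real.sqrt_pos.2 Real.pi_pos).ne'
  have hpi : (Real.pi : ℂ) = (Real.sqrt Real.pi : ℂ) ^ 2 := by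
    exact_mod_cast (Real.sq_sqrt Real.pi_pos.le).symm
  have h4 : Real.sqrt (4 * Real.pi * τ) = 2 * Real.sqrt Real.pi * Real.sqrt τ := by
    rw [Real.sqrt_mul (by positivity), Real.sqrt_mul (by norm_num),
      show (4 : ℝ) = 2 ^ 2 by norm_num, Real.sqrt_sq (by norm_num)]
  rw [heatKernel_neg_I_mul hτ, rayValue, rayValue, neg_div, fresnel_neg, h4]
  simp only [Complex.ofReal_neg, even_two, Even.neg_pow, Complex.ofReal_mul, Complex.ofReal_ofNat]
  generalize Complex.exp (Complex.I * Real.pi / 4) = A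
  rw [hpi]
  field_simp
  ring

/-! Along the imaginary axis the plane waves decay, for the appropriate sign of `z`. -/

lemma norm_exp_neg_mul_sub (a τ s : ℝ) :
    ‖Complex.exp (-(a * s) - Complex.I * τ * (s : ℂ) ^ 2)‖ = Real.exp (-a * s) := by
  have : (-(a * s) - Complex.I * τ * (s : ℂ) ^ 2) =
      ((-a * s : ℝ) : ℂ) + ((-(τ * s ^ 2) : ℝ) : ℂ) * Complex.I := by push_cast; ring
  rw [this, Complex.exp_add, norm_mul, Complex.norm_exp_ofReal_mul_I, mul_one,
    ← Complex.ofReal_exp, Complex.norm_real, Real.norm_of_nonneg (Real.exp_pos _).le]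

lemma integrableOn_exp_neg_mul_sub {a : ℝ} (ha : 0 < a) (τ : ℝ) :
    IntegrableOn (fun s : ℝ => Complex.exp (-(a * s) - Complex.I * τ * (s : ℂ) ^ 2)) (Ioi 0) := by
  refine Integrable.mono' (exp_neg_integrableOn_Ioi 0 ha)
    (Continuous.aestronglyMeasurable (by fun_prop)) (.of_forall fun s => ?_)
  rw [norm_exp_neg_mul_sub]

/-- The Laplace transform `∫₀^∞ e^{-as - iτs²} ds` of an oscillating Gaussian. -/
def chirpLaplace (τ a : ℝ) : ℂ :=
  ∫ s in Ioi (0 : ℝ), Complex.exp (-(a * s) - Complex.I * τ * (s : ℂ) ^ 2)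

lemma integral_Ioi_exp_neg_mul {a : ℝ} (ha : 0 < a) :
    ∫ s in Ioi (0 : ℝ), Real.exp (-a * s) = 1 / a := by
  have := integral_exp_mul_Ioi (a := -a) (by linarith) 0
  rw [this]
  simp [neg_div_neg_eq]

lemma norm_chirpLaplace_le {a : ℝ} (ha : 0 < a) (τ : ℝ) : ‖chirpLaplace τ a‖ ≤ 1 / a := by
  rw [← integral_Ioi_exp_neg_mul ha]
  refine norm_integral_le_of_norm_le (exp_neg_integrableOn_Ioi 0 ha) (.of_forall fun s => ?_)
  rw [norm_exp_neg_mul_sub]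

lemma segmentIntegral_planeWave_neg_I (τ a R : ℝ) :
    segmentIntegral (planeWave τ (-a)) (-Complex.I) R =
      -Complex.I * ∫ s in (0 : ℝ)..R, Complex.exp (-(a * s) - Complex.I * τ * (s : ℂ) ^ 2) := by
  rw [segmentIntegral, ← intervalIntegral.integral_const_mul]
  refine intervalIntegral.integral_congr fun s _ => ?_
  simp only [planeWave]
  rw [mul_comm (-Complex.I)]
  congr 2
  push_cast
  ring_nf
  simp only [Complex.I_sq, Complex.I_pow_three]
  ring

lemma tendsto_segmentIntegral_planeWave_neg_I {a : ℝ} (ha : 0 < a) (τ : ℝ) :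
    Tendsto (segmentIntegral (planeWave τ (-a)) (-Complex.I)) atTop
      (𝓝 (-Complex.I * chirpLaplace τ a)) := by
  have := intervalIntegral_tendsto_integral_Ioi 0 (integrableOn_exp_neg_mul_sub ha τ) tendsto_id
  exact (this.const_mul (-Complex.I)).congr fun R =>
    (segmentIntegral_planeWave_neg_I τ a R).symm

lemma norm_segmentIntegral_planeWave_neg_I_le {a : ℝ} (ha : 0 < a) (τ : ℝ) {R : ℝ} (hR : 0 ≤ R) :
    ‖segmentIntegral (planeWave τ (-a)) (-Complex.I) R‖ ≤ 1 / a := by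
  rw [segmentIntegral_planeWave_neg_I, norm_mul, norm_neg, Complex.norm_I, one_mul,
    intervalIntegral.integral_of_le hR, ← integral_Ioi_exp_neg_mul ha]
  calc _ ≤ ∫ s in Ioc 0 R, Real.exp (-a * s) := by
        refine norm_integral_le_of_norm_le ((exp_neg_integrableOn_Ioi 0 ha).mono_set
          Ioc_subset_Ioi_self) (.of_forall fun s => ?_)
        rw [norm_exp_neg_mul_sub]
    _ ≤ _ := setIntegral_mono_set (exp_neg_integrableOn_Ioi 0 ha)
        (.of_forall fun s => (Real.exp_pos _).le) (Ioc_subset_Ioi_self.eventuallyLE)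

/-- The Laplace transform of the oscillating Gaussian solves a first-order linear equation. -/
lemma hasDerivAt_chirpLaplace {τ a : ℝ} (hτ : τ ≠ 0) (ha : 0 < a) :
    HasDerivAt (chirpLaplace τ) ((a * chirpLaplace τ a - 1) / (2 * Complex.I * τ)) a := by
  have hτ' : (τ : ℂ) ≠ 0 := by exact_mod_cast hτ
  have ha2 : 0 < a / 2 := by positivity
  have hbound : IntegrableOn (fun s : ℝ => s * Real.exp (-(a / 2) * s)) (Ioi 0) := by
    have := integrableOn_rpow_mul_exp_neg_mul_rpow (s := 1) (p := 1) (b := a / 2) (by norm_num)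
      one_pos ha2
    simpa using this
  have hder := hasDerivAt_integral_of_dominated_loc_of_deriv_le
    (μ := volume.restrict (Ioi (0 : ℝ))) (x₀ := a) (s := Metric.ball a (a / 2))
    (F := fun (b s : ℝ) => Complex.exp (-(b * s) - Complex.I * τ * (s : ℂ) ^ 2))
    (F' := fun (b s : ℝ) => -(s : ℂ) * Complex.exp (-(b * s) - Complex.I * τ * (s : ℂ) ^ 2))
    (bound := fun s => s * Real.exp (-(a / 2) * s))
    (Metric.ball_mem_nhds _ ha2)
    (.of_forall fun b => Continuous.aestronglyMeasurable (by fun_prop))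
    (integrableOn_exp_neg_mul_sub ha τ) (Continuous.aestronglyMeasurable (by fun_prop)) ?_
    hbound ?_
  · obtain ⟨hint, hder⟩ := hder
    refine hder.congr_deriv ?_
    have hd : ∀ s ∈ Ici (0 : ℝ), HasDerivAt
        (fun s : ℝ => Complex.exp (-(a * s) - Complex.I * τ * (s : ℂ) ^ 2))
        (-a * Complex.exp (-(a * s) - Complex.I * τ * (s : ℂ) ^ 2) + 2 * Complex.I * τ *
          (-(s : ℂ) * Complex.exp (-(a * s) - Complex.I * τ * (s : ℂ) ^ 2))) s := by
      intro s _
      have h1 : HasDerivAt (fun s : ℝ => -((a : ℂ) * s) - Complex.I * τ * (s : ℂ) ^ 2)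
          (-a - Complex.I * τ * (2 * s)) s := by
        have h2 := ((hasDerivAt_id s).ofReal_comp.const_mul (a : ℂ)).fun_neg
        have h3 := ((hasDerivAt_id s).ofReal_comp.pow 2).const_mul (Complex.I * τ)
        simpa using h2.fun_sub h3
      refine h1.cexp.congr_deriv ?_
      ring
    have hI := integral_Ioi_of_hasDerivAt_of_tendsto' hd
      (((integrableOn_exp_neg_mul_sub ha τ).const_mul _).add (hint.const_mul _)) (m := 0) ?_
    · rw [integral_add ((integrableOn_exp_neg_mul_sub ha τ).const_mul _) (hint.const_mul _),
        integral_const_mul, integral_const_mul] at hI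
      simp only [Complex.ofReal_zero, mul_zero, neg_zero, ne_eq, OfNat.ofNat_ne_zero,
        not_false_eq_true, zero_pow, sub_self, Complex.exp_zero, zero_sub] at hI
      rw [chirpLaplace, eq_div_iff (by simp [hτ'])]
      linear_combination hI
    · rw [tendsto_zero_iff_norm_tendsto_zero]
      simp_rw [norm_exp_neg_mul_sub]
      exact Real.tendsto_exp_atBot.comp (tendsto_id.const_mul_atTop_of_neg (by linarith))
  · refine (ae_restrict_mem measurableSet_Ioi).mono fun s hs b hb => ?_
    have hs' : (0 : ℝ) < s := hs
    rw [norm_mul, norm_exp_neg_mul_sub, norm_neg, Complex.norm_real, Real.norm_of_nonneg hs'.le]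
    refine mul_le_mul_of_nonneg_left (Real.exp_le_exp.2 ?_) hs'.le
    rw [Metric.mem_ball, Real.dist_eq, abs_lt] at hb
    nlinarith
  · refine .of_forall fun s b _ => ?_
    have h1 : HasDerivAt (fun b : ℝ => -((b : ℂ) * s) - Complex.I * τ * (s : ℂ) ^ 2)
        (-(s : ℂ)) b := by
      simpa using (((hasDerivAt_id b).ofReal_comp.mul_const (s : ℂ)).fun_neg).sub_const
        (Complex.I * τ * (s : ℂ) ^ 2)
    refine h1.cexp.congr_deriv ?_
    ring

lemma hasDerivAt_rayValue {τ : ℝ} (hτ : 0 < τ) (a : ℝ) :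
    HasDerivAt (rayValue τ) (-(Complex.I * a / (2 * τ)) * rayValue τ a - 1 / (2 * τ)) a := by
  have hs : 0 < Real.sqrt τ := Real.sqrt_pos.2 hτ
  have hs' : (Real.sqrt τ : ℂ) ≠ 0 := by exact_mod_cast hs.ne'
  have hτs : (τ : ℂ) = (Real.sqrt τ : ℂ) ^ 2 := by exact_mod_cast (Real.sq_sqrt hτ.le).symm
  have h1 : HasDerivAt (fun z : ℝ => -Complex.I * (z : ℂ) ^ 2 / (4 * τ))
      (-Complex.I * (2 * a) / (4 * τ)) a := by
    simpa using (((hasDerivAt_id a).ofReal_comp.pow 2).const_mul (-Complex.I)).div_const (4 * τ : ℂ)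
  have h2 : HasDerivAt (fun z : ℝ => z / (2 * Real.sqrt τ)) (1 / (2 * Real.sqrt τ)) a :=
    (hasDerivAt_id a).div_const _
  have h3 := (hasDerivAt_fresnel 1 (a / (2 * Real.sqrt τ))).scomp a h2
  have h4 := (h1.cexp.div_const (Real.sqrt τ : ℂ)).mul
    (h3.const_sub ((Real.sqrt Real.pi : ℂ) / 2 * Complex.exp (Complex.I * Real.pi / 4)))
  refine h4.congr_deriv ?_
  have h5 : Complex.exp (-Complex.I * (a : ℂ) ^ 2 / (4 * τ)) *
      Complex.exp ((1 : ℝ) * Complex.I * ((a / (2 * Real.sqrt τ) : ℝ) : ℂ) ^ 2) = 1 := by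
    rw [← Complex.exp_add, Complex.exp_eq_one_iff]
    refine ⟨0, ?_⟩
    push_cast
    rw [hτs]
    field_simp
    ring
  rw [rayValue, Complex.real_smul]
  simp only [Function.comp_apply]
  generalize Complex.exp ((1 : ℝ) * Complex.I * ((a / (2 * Real.sqrt τ) : ℝ) : ℂ) ^ 2) = E2 at *
  generalize Complex.exp (-Complex.I * (a : ℂ) ^ 2 / (4 * τ)) = E1 at *
  push_cast
  rw [hτs]
  field_simp
  linear_combination (-8 * (Real.sqrt τ : ℂ)) * h5

lemma tendsto_rayValue_atTop {τ : ℝ} (hτ : 0 < τ) : Tendsto (rayValue τ) atTop (𝓝 0) := by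
  have hs : 0 < Real.sqrt τ := Real.sqrt_pos.2 hτ
  have h1 : Tendsto (fun z : ℝ => z / (2 * Real.sqrt τ)) atTop atTop :=
    tendsto_id.atTop_div_const (by positivity)
  have h2 := (tendsto_fresnel (η := 1) (Or.inl rfl)).comp h1
  rw [Complex.ofReal_one, one_mul] at h2
  have h3 := (h2.const_sub ((Real.sqrt Real.pi : ℂ) / 2 *
    Complex.exp (Complex.I * Real.pi / 4))).norm.const_mul (1 / Real.sqrt τ)
  rw [sub_self, norm_zero, mul_zero] at h3
  rw [tendsto_zero_iff_norm_tendsto_zero]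
  refine h3.congr fun z => ?_
  rw [rayValue, norm_mul, norm_div, norm_exp_neg_I_mul_sq_div, Complex.norm_real,
    Real.norm_of_nonneg (Real.sqrt_nonneg _)]
  rfl

/-- Rotation of the ray of integration from the real to the imaginary axis. Both sides solve the
same first-order linear equation in `a` and vanish at infinity. -/
lemma I_mul_chirpLaplace {τ a : ℝ} (hτ : 0 < τ) (ha : 0 < a) :
    Complex.I * chirpLaplace τ a = rayValue τ a := by
  have hτ' : (τ : ℂ) ≠ 0 := by exact_mod_cast hτ.ne'
  set d : ℝ → ℂ := fun b => (Complex.I * chirpLaplace τ b - rayValue τ b) *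
    Complex.exp (Complex.I * (b : ℂ) ^ 2 / (4 * τ)) with hd
  have hder : ∀ b ∈ Ioi (0 : ℝ), HasDerivAt d 0 b := by
    intro b hb
    have h1 : HasDerivAt (fun z : ℝ => Complex.I * (z : ℂ) ^ 2 / (4 * τ))
        (Complex.I * (2 * b) / (4 * τ)) b := by
      simpa using (((hasDerivAt_id b).ofReal_comp.pow 2).const_mul Complex.I).div_const (4 * τ : ℂ)
    refine ((((hasDerivAt_chirpLaplace hτ.ne' hb).const_mul Complex.I).sub
      (hasDerivAt_rayValue hτ b)).mul h1.cexp).congr_deriv ?_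
    field_simp
    simp only [Pi.sub_apply]
    field_simp
    ring_nf
    simp only [Complex.I_sq]
    ring
  have hconst : ∀ b ∈ Ioi (0 : ℝ), d b = d a := fun b hb =>
    isOpen_Ioi.is_const_of_deriv_eq_zero isPreconnected_Ioi
      (fun b hb => (hder b hb).differentiableAt.differentiableWithinAt)
      (fun b hb => (hder b hb).deriv) hb ha
  have hlim : Tendsto d atTop (𝓝 0) := by
    rw [tendsto_zero_iff_norm_tendsto_zero]
    have h1 : Tendsto (fun b : ℝ => 1 / b + ‖rayValue τ b‖) atTop (𝓝 0) := by
      have := tendsto_inv_atTop_zero.add (tendsto_rayValue_atTop hτ).norm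
      simpa using this
    refine squeeze_zero' (.of_forall fun _ => norm_nonneg _) ?_ h1
    filter_upwards [eventually_gt_atTop 0] with b hb
    have h2 : ‖Complex.exp (Complex.I * (b : ℂ) ^ 2 / (4 * τ))‖ = 1 := by
      have := norm_exp_neg_I_mul_sq_div b (-τ)
      rwa [Complex.ofReal_neg, mul_neg, div_neg, neg_mul, neg_div, neg_neg] at this
    rw [hd, norm_mul, h2, mul_one]
    refine (norm_sub_le _ _).trans ?_
    rw [norm_mul, Complex.norm_I, one_mul]
    exact add_le_add_left (norm_chirpLaplace_le hb τ) _
  have hda : d a = 0 := by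
    refine tendsto_nhds_unique (tendsto_const_nhds.congr' ?_) hlim
    filter_upwards [eventually_gt_atTop 0] with b hb
    exact (hconst b hb).symm
  have := (mul_eq_zero.1 hda).resolve_right (Complex.exp_ne_zero _)
  exact sub_eq_zero.1 this

lemma chirpLaplace_zero {a : ℝ} (ha : 0 < a) : chirpLaplace 0 a = 1 / a := by
  have h := integral_Ioi_exp_neg_mul ha
  have h2 : (∫ s in Ioi (0 : ℝ), ((Real.exp (-a * s) : ℝ) : ℂ)) = ((1 / a : ℝ) : ℂ) := by
    rw [integral_complex_ofReal, h]
  rw [chirpLaplace]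
  push_cast at h2
  simpa using h2

/-! ### Improper integrals over wave numbers -/

/-- The Fourier transform `∫ e^{-ikcy} g(y) dy` of `g`, in the wave number `ck`. -/
def dilatedFourier (c : ℝ) (g : ℝ → ℂ) (k : ℂ) : ℂ :=
  ∫ y : ℝ, Complex.exp (-Complex.I * k * (c * y)) * g y

/-- The superposition `∫ E(x - cy, σt) g(y) dy` of Schrödinger kernels. -/
def propagate (σ c : ℝ) (g : ℝ → ℂ) (x t : ℝ) : ℂ :=
  ∫ y : ℝ, heatKernel (-Complex.I * (σ * t : ℝ)) (x - c * y) * g y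

lemma integrand_eq_integral (σ x t c : ℝ) (g : ℝ → ℂ) (k : ℂ) :
    integrand σ x t (dilatedFourier c g) k = ∫ y : ℝ, g y * planeWave (σ * t) (x - c * y) k := by
  rw [integrand, dilatedFourier, ← integral_const_mul]
  refine integral_congr_ae (.of_forall fun y => ?_)
  simp only [planeWave]
  rw [← mul_assoc, ← Complex.exp_add, mul_comm]
  congr 2
  rw [lam]
  push_cast
  ring

/-- Fubini's theorem for the truncated integrals over wave numbers. -/
lemma segmentIntegral_integrand {g : ℝ → ℂ} (hg : Integrable g) (σ x t c : ℝ) {ω : ℂ} {R : ℝ}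
    (hR : 0 ≤ R) (hω : ∀ y, g y ≠ 0 → 0 ≤ -(ω.im * (c * y))) :
    segmentIntegral (integrand σ x t (dilatedFourier c g)) ω R =
      ∫ y : ℝ, g y * segmentIntegral (planeWave (σ * t) (x - c * y)) ω R := by
  obtain ⟨C, hC⟩ := (isCompact_Icc (a := (0 : ℝ)) (b := R)).exists_bound_of_continuousOn
    (f := fun s : ℝ => planeWave (σ * t) x (s * ω) * ω) (by
      unfold planeWave; fun_prop)
  have hF : AEStronglyMeasurable (Function.uncurry fun (s y : ℝ) =>
      g y * (planeWave (σ * t) (x - c * y) (s * ω) * ω))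
      ((volume.restrict (uIoc 0 R)).prod volume) := by
    refine AEStronglyMeasurable.mul ?_ (Continuous.aestronglyMeasurable ?_)
    · exact hg.aestronglyMeasurable.comp_snd
    · unfold planeWave; fun_prop
  have hint : Integrable (Function.uncurry fun (s y : ℝ) =>
      g y * (planeWave (σ * t) (x - c * y) (s * ω) * ω))
      ((volume.restrict (uIoc 0 R)).prod volume) := by
    have hgC : Integrable (fun p : ℝ × ℝ => C * ‖g p.2‖)
        ((volume.restrict (uIoc 0 R)).prod volume) := by
      have : IsFiniteMeasure (volume.restrict (uIoc 0 R)) :=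
        ⟨by rw [Measure.restrict_apply_univ, uIoc_of_le hR]; exact measure_Ioc_lt_top⟩
      have : Integrable (fun _ : ℝ => C) (volume.restrict (uIoc 0 R)) := integrable_const C
      exact this.mul_prod hg.norm
    refine hgC.mono' hF ?_
    have hae : ∀ᵐ p ∂((volume.restrict (uIoc 0 R)).prod (volume : Measure ℝ)),
        p.1 ∈ uIoc 0 R := by
      have := Measure.quasiMeasurePreserving_fst
        (μ := volume.restrict (uIoc 0 R)) (ν := (volume : Measure ℝ))
      exact this.ae (ae_restrict_mem measurableSet_uIoc)
    filter_upwards [hae] with p hp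
    rw [uIoc_of_le hR] at hp
    simp only [Function.uncurry]
    rw [norm_mul, mul_comm]
    by_cases hgp : g p.2 = 0
    · simp [hgp]
    refine mul_le_mul_of_nonneg_right (le_trans ?_ (hC p.1 ⟨hp.1.le, hp.2⟩)) (norm_nonneg _)
    rw [norm_mul, norm_mul]
    refine mul_le_mul_of_nonneg_right ?_ (norm_nonneg _)
    simp only [planeWave]
    rw [Complex.norm_exp, Complex.norm_exp, Real.exp_le_exp]
    have h1 := mul_nonneg hp.1.le (hω _ hgp)
    simp [-neg_mul, Complex.mul_re, Complex.mul_im] at h1 ⊢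
    nlinarith
  rw [segmentIntegral]
  calc _ = ∫ s in (0 : ℝ)..R, ∫ y : ℝ, g y * (planeWave (σ * t) (x - c * y) (s * ω) * ω) := by
        refine intervalIntegral.integral_congr fun s _ => ?_
        simp only [integrand_eq_integral]
        rw [← integral_mul_const]
        refine integral_congr_ae (.of_forall fun y => ?_)
        simp only [mul_assoc]
    _ = ∫ y : ℝ, ∫ s in (0 : ℝ)..R, g y * (planeWave (σ * t) (x - c * y) (s * ω) * ω) :=
        intervalIntegral_integral_swap hint
    _ = _ := by
        refine integral_congr_ae (.of_forall fun y => ?_)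
        simp only [segmentIntegral, intervalIntegral.integral_const_mul]

lemma tendsto_segmentIntegral_integrand {g : ℝ → ℂ} (hg : Integrable g) (σ x t c : ℝ) {ω : ℂ}
    (hω : ∀ y, g y ≠ 0 → 0 ≤ -(ω.im * (c * y))) {A : ℝ → ℂ} {C : ℝ}
    (hC : ∀ y, g y ≠ 0 → ∀ R ≥ 0, ‖segmentIntegral (planeWave (σ * t) (x - c * y)) ω R‖ ≤ C)
    (hA : ∀ y, g y ≠ 0 →
      Tendsto (segmentIntegral (planeWave (σ * t) (x - c * y)) ω) atTop (𝓝 (A y))) :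
    Tendsto (segmentIntegral (integrand σ x t (dilatedFourier c g)) ω) atTop
      (𝓝 (∫ y : ℝ, g y * A y)) := by
  have h : Tendsto (fun R => ∫ y : ℝ, g y * segmentIntegral (planeWave (σ * t) (x - c * y)) ω R)
      atTop (𝓝 (∫ y : ℝ, g y * A y)) := by
    refine tendsto_integral_filter_of_dominated_convergence (fun y => ‖g y‖ * C) ?_ ?_
      (hg.norm.mul_const C) ?_
    · refine .of_forall fun R => hg.aestronglyMeasurable.mul (Continuous.aestronglyMeasurable ?_)
      exact (continuous_segmentIntegral_planeWave (σ * t) ω R).comp (by fun_prop)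
    · filter_upwards [eventually_ge_atTop 0] with R hR
      refine .of_forall fun y => ?_
      by_cases hy : g y = 0
      · simp [hy]
      rw [norm_mul]
      exact mul_le_mul_of_nonneg_left (hC y hy R hR) (norm_nonneg _)
    · refine .of_forall fun y => ?_
      by_cases hy : g y = 0
      · simp [hy]
      exact (hA y hy).const_mul _
  refine h.congr' ?_
  filter_upwards [eventually_ge_atTop 0] with R hR
  exact (segmentIntegral_integrand hg σ x t c hR hω).symm

lemma RayConverges.of_tendsto {f : ℂ → ℂ} {ω I : ℂ}
    (h : Tendsto (segmentIntegral f ω) atTop (𝓝 I)) : RayConverges f ω := ⟨I, h⟩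

lemma rayIntegral_eq {f : ℂ → ℂ} {ω I : ℂ} (h : Tendsto (segmentIntegral f ω) atTop (𝓝 I)) :
    rayIntegral f ω = I := h.limUnder_eq

/-! For positive times, all the ray integrals are superpositions of `rayValue`. -/

section PositiveTime

variable {g : ℝ → ℂ} {σ x t c : ℝ}

lemma tendsto_ray_one (hg : Integrable g) (hτ : 0 < σ * t) (x c : ℝ) :
    Tendsto (segmentIntegral (integrand σ x t (dilatedFourier c g)) 1) atTop
      (𝓝 (∫ y : ℝ, g y * rayValue (σ * t) (x - c * y))) := by
  obtain ⟨C, hC⟩ := exists_norm_segmentIntegral_planeWave_one_le hτ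
  exact tendsto_segmentIntegral_integrand hg σ x t c (by simp) (fun y _ R _ => hC _ R)
    fun y _ => tendsto_segmentIntegral_planeWave_one hτ _

lemma tendsto_ray_neg_one (hg : Integrable g) (hτ : 0 < σ * t) (x c : ℝ) :
    Tendsto (segmentIntegral (integrand σ x t (dilatedFourier c g)) (-1)) atTop
      (𝓝 (∫ y : ℝ, g y * -rayValue (σ * t) (-(x - c * y)))) := by
  obtain ⟨C, hC⟩ := exists_norm_segmentIntegral_planeWave_one_le hτ
  refine tendsto_segmentIntegral_integrand hg σ x t c (by simp) (C := C)
    (fun y _ R _ => ?_) fun y _ => ?_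
  · rw [segmentIntegral_planeWave_neg, norm_neg]
    exact hC _ R
  · exact (tendsto_segmentIntegral_planeWave_one hτ _).neg.congr fun R =>
      (segmentIntegral_planeWave_neg _ _ _ R).symm

lemma tendsto_ray_neg_I (hg : Integrable g) (hx : x < 0)
    (hsupp : ∀ y, g y ≠ 0 → 0 ≤ c * y) :
    Tendsto (segmentIntegral (integrand σ x t (dilatedFourier c g)) (-Complex.I)) atTop
      (𝓝 (∫ y : ℝ, g y * (-Complex.I * chirpLaplace (σ * t) (-(x - c * y))))) := by
  have hpos : ∀ y, g y ≠ 0 → -x ≤ -(x - c * y) := fun y hy => by linarith [hsupp y hy]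
  refine tendsto_segmentIntegral_integrand hg σ x t c (by simpa using hsupp) (C := 1 / -x)
    (fun y hy R hR => ?_) fun y hy => ?_
  · have := norm_segmentIntegral_planeWave_neg_I_le (a := -(x - c * y))
      (by linarith [hpos y hy]) (σ * t) hR
    rw [neg_neg] at this
    exact this.trans (one_div_le_one_div_of_le (by linarith) (hpos y hy))
  · have := tendsto_segmentIntegral_planeWave_neg_I (a := -(x - c * y))
      (by linarith [hpos y hy]) (σ * t)
    rwa [neg_neg] at this

lemma tendsto_ray_I (hg : Integrable g) (hx : 0 < x) (hsupp : ∀ y, g y ≠ 0 → c * y ≤ 0) :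
    Tendsto (segmentIntegral (integrand σ x t (dilatedFourier c g)) Complex.I) atTop
      (𝓝 (∫ y : ℝ, g y * (Complex.I * chirpLaplace (σ * t) (x - c * y)))) := by
  have hpos : ∀ y, g y ≠ 0 → x ≤ x - c * y := fun y hy => by linarith [hsupp y hy]
  have hneg : ∀ y R, segmentIntegral (planeWave (σ * t) (x - c * y)) Complex.I R =
      -segmentIntegral (planeWave (σ * t) (-(x - c * y))) (-Complex.I) R := fun y R => by
    have := segmentIntegral_planeWave_neg (σ * t) (x - c * y) (-Complex.I) R
    rwa [neg_neg] at this
  refine tendsto_segmentIntegral_integrand hg σ x t c (by simpa using hsupp) (C := 1 / x)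
    (fun y hy R hR => ?_) fun y hy => ?_
  · rw [hneg, norm_neg]
    exact (norm_segmentIntegral_planeWave_neg_I_le (by linarith [hpos y hy]) (σ * t) hR).trans
      (one_div_le_one_div_of_le (by linarith) (hpos y hy))
  · have := (tendsto_segmentIntegral_planeWave_neg_I (a := x - c * y)
      (by linarith [hpos y hy]) (σ * t)).neg
    rw [neg_mul, neg_neg] at this
    exact this.congr fun R => (hneg y R).symm

lemma integrable_mul_rayValue (hg : Integrable g) (hτ : 0 < σ * t) (x c : ℝ) :
    Integrable fun y => g y * rayValue (σ * t) (x - c * y) := by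
  obtain ⟨C, hC⟩ := exists_norm_segmentIntegral_planeWave_one_le hτ
  have hcont : Continuous (rayValue (σ * t)) :=
    continuous_iff_continuousAt.2 fun a => (hasDerivAt_rayValue hτ a).continuousAt
  refine (hg.norm.mul_const C).mono'
    (hg.aestronglyMeasurable.mul (hcont.comp (by fun_prop)).aestronglyMeasurable)
    (.of_forall fun y => ?_)
  rw [norm_mul]
  exact mul_le_mul_of_nonneg_left (le_of_tendsto
    (tendsto_segmentIntegral_planeWave_one hτ (x - c * y)).norm (.of_forall fun R => hC _ R))
    (norm_nonneg _)

lemma integral_rayValue_add (hg : Integrable g) (hτ : 0 < σ * t) (x c : ℝ) :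
    (∫ y : ℝ, g y * rayValue (σ * t) (x - c * y)) -
      (∫ y : ℝ, g y * -rayValue (σ * t) (-(x - c * y))) = 2 * Real.pi * propagate σ c g x t := by
  have h2 : Integrable fun y => g y * -rayValue (σ * t) (-(x - c * y)) := by
    refine (integrable_mul_rayValue hg hτ (-x) (-c)).neg.congr (.of_forall fun y => ?_)
    simp only [Pi.neg_apply, mul_neg]
    ring_nf
  rw [← integral_sub (integrable_mul_rayValue hg hτ x c) h2, propagate, ← integral_const_mul]
  refine integral_congr_ae (.of_forall fun y => ?_)
  simp only
  have := rayValue_add_rayValue_neg hτ (x - c * y)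
  linear_combination (g y) * this

lemma lineConverges_of_pos (hg : Integrable g) (hτ : 0 < σ * t) (x c : ℝ) :
    LineConverges (integrand σ x t (dilatedFourier c g)) :=
  ⟨.of_tendsto (tendsto_ray_one hg hτ x c), .of_tendsto (tendsto_ray_neg_one hg hτ x c)⟩

lemma lineIntegral_of_pos (hg : Integrable g) (hτ : 0 < σ * t) (x c : ℝ) :
    lineIntegral (integrand σ x t (dilatedFourier c g)) =
      2 * Real.pi * propagate σ c g x t := by
  rw [lineIntegral, rayIntegral_eq (tendsto_ray_one hg hτ x c),
    rayIntegral_eq (tendsto_ray_neg_one hg hτ x c), integral_rayValue_add hg hτ]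

lemma dMinusConverges_of_pos (hg : Integrable g) (hτ : 0 < σ * t) (hx : x < 0)
    (hsupp : ∀ y, g y ≠ 0 → 0 ≤ c * y) :
    DMinusConverges (integrand σ x t (dilatedFourier c g)) :=
  ⟨.of_tendsto (tendsto_ray_one hg hτ x c), .of_tendsto (tendsto_ray_neg_I hg hx hsupp)⟩

/-- For `x < 0` the ray to `-i∞` may be rotated to the negative real axis, so that the contour
`∂D⁻` becomes the real line, traversed backwards. -/
lemma dMinusIntegral_of_pos (hg : Integrable g) (hτ : 0 < σ * t) (hx : x < 0)
    (hsupp : ∀ y, g y ≠ 0 → 0 ≤ c * y) :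
    dMinusIntegral (integrand σ x t (dilatedFourier c g)) =
      -(2 * Real.pi * propagate σ c g x t) := by
  have h : (∫ y : ℝ, g y * (-Complex.I * chirpLaplace (σ * t) (-(x - c * y)))) =
      ∫ y : ℝ, g y * -rayValue (σ * t) (-(x - c * y)) := by
    refine integral_congr_ae (.of_forall fun y => ?_)
    by_cases hy : g y = 0
    · simp [hy]
    simp only
    rw [neg_mul, I_mul_chirpLaplace hτ (by linarith [hsupp y hy])]
  rw [dMinusIntegral, rayIntegral_eq (tendsto_ray_one hg hτ x c),
    rayIntegral_eq (tendsto_ray_neg_I hg hx hsupp), h, ← integral_rayValue_add hg hτ]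
  ring

lemma dPlusConverges_of_pos (hg : Integrable g) (hτ : 0 < σ * t) (hx : 0 < x)
    (hsupp : ∀ y, g y ≠ 0 → c * y ≤ 0) :
    DPlusConverges (integrand σ x t (dilatedFourier c g)) :=
  ⟨.of_tendsto (tendsto_ray_neg_one hg hτ x c), .of_tendsto (tendsto_ray_I hg hx hsupp)⟩

/-- For `x > 0` the ray to `i∞` may be rotated to the positive real axis, so that the contour
`∂D⁺` becomes the real line. -/
lemma dPlusIntegral_of_pos (hg : Integrable g) (hτ : 0 < σ * t) (hx : 0 < x)
    (hsupp : ∀ y, g y ≠ 0 → c * y ≤ 0) :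
    dPlusIntegral (integrand σ x t (dilatedFourier c g)) =
      2 * Real.pi * propagate σ c g x t := by
  have h : (∫ y : ℝ, g y * (Complex.I * chirpLaplace (σ * t) (x - c * y))) =
      ∫ y : ℝ, g y * rayValue (σ * t) (x - c * y) := by
    refine integral_congr_ae (.of_forall fun y => ?_)
    by_cases hy : g y = 0
    · simp [hy]
    simp only
    rw [I_mul_chirpLaplace hτ (by linarith [hsupp y hy])]
  rw [dPlusIntegral, rayIntegral_eq (tendsto_ray_neg_one hg hτ x c),
    rayIntegral_eq (tendsto_ray_I hg hx hsupp), h, ← integral_rayValue_add hg hτ]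
  ring

end PositiveTime

/-! ### The integrals over wave numbers at time zero -/

/-- The Riemann–Lebesgue lemma. -/
lemma tendsto_integral_exp_I_mul (f : ℝ → ℂ) {l : Filter ℝ} (hl : l ≤ cocompact ℝ) :
    Tendsto (fun R : ℝ => ∫ y : ℝ, Complex.exp (Complex.I * R * y) * f y) l (𝓝 0) := by
  have h1 : Tendsto (fun R : ℝ => -(2 * Real.pi)⁻¹ * R) (cocompact ℝ) (cocompact ℝ) := by
    have hne : -(2 * Real.pi)⁻¹ ≠ 0 := by
      have := Real.pi_pos
      simp [this.ne']
    exact (Homeomorph.mulLeft₀ _ hne).isClosedEmbedding.tendsto_cocompact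
  refine (((Real.tendsto_integral_exp_smul_cocompact f).comp h1).mono_left hl).congr fun R => ?_
  refine integral_congr_ae (.of_forall fun y => ?_)
  simp only [Circle.smul_def, Real.fourierChar_apply, smul_eq_mul]
  congr 2
  have : (Real.pi : ℂ) ≠ 0 := by exact_mod_cast Real.pi_ne_zero
  push_cast
  field_simp

lemma atTop_le_cocompact_real : (atTop : Filter ℝ) ≤ cocompact ℝ := by
  rw [cocompact_eq_atBot_atTop]; exact le_sup_right

lemma atBot_le_cocompact_real : (atBot : Filter ℝ) ≤ cocompact ℝ := by
  rw [cocompact_eq_atBot_atTop]; exact le_sup_left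

lemma tendsto_integral_exp_I_mul_sub (f : ℝ → ℂ) (x : ℝ) {c : ℝ} (hc : c ≠ 0) {l : Filter ℝ}
    (hl : l ≤ cocompact ℝ) :
    Tendsto (fun R : ℝ => ∫ y : ℝ, Complex.exp (Complex.I * R * (x - c * y : ℝ)) * f y) l
      (𝓝 0) := by
  have h1 : Tendsto (fun R : ℝ => -c * R) (cocompact ℝ) (cocompact ℝ) :=
    (Homeomorph.mulLeft₀ _ (neg_ne_zero.2 hc)).isClosedEmbedding.tendsto_cocompact
  have h2 := (tendsto_integral_exp_I_mul f (l := l.map fun R : ℝ => -c * R)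
    ((map_mono hl).trans h1)).comp tendsto_map
  rw [tendsto_zero_iff_norm_tendsto_zero] at h2 ⊢
  refine h2.congr fun R => ?_
  have h3 : (fun y : ℝ => Complex.exp (Complex.I * R * (x - c * y : ℝ)) * f y) = fun y : ℝ =>
      Complex.exp ((R * x : ℝ) * Complex.I) *
        (Complex.exp (Complex.I * (-c * R : ℝ) * y) * f y) := by
    funext y
    rw [← mul_assoc, ← Complex.exp_add]
    congr 2
    push_cast
    ring
  rw [h3, integral_const_mul, norm_mul, Complex.norm_exp_ofReal_mul_I, one_mul]
  rfl

lemma segmentIntegral_planeWave_zero_one {z : ℝ} (hz : z ≠ 0) (R : ℝ) :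
    segmentIntegral (planeWave 0 z) 1 R =
      (Complex.exp (Complex.I * R * z) - 1) * (-Complex.I * (z : ℂ)⁻¹) := by
  have hz' : (z : ℂ) ≠ 0 := by exact_mod_cast hz
  have h := integral_exp_mul_complex (a := 0) (b := R) (c := Complex.I * z)
    (by simp [hz'])
  rw [segmentIntegral]
  calc _ = ∫ s in (0 : ℝ)..R, Complex.exp (Complex.I * z * s) := by
        refine intervalIntegral.integral_congr fun s _ => ?_
        simp only [planeWave]
        rw [mul_one, mul_one, Complex.ofReal_zero]
        congr 1
        ring
    _ = _ := by
        rw [h, Complex.ofReal_zero, mul_zero, Complex.exp_zero, div_eq_mul_inv, mul_inv,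
          Complex.inv_I]
        congr 3
        ring

lemma segmentIntegral_planeWave_zero_neg_one {z : ℝ} (hz : z ≠ 0) (R : ℝ) :
    segmentIntegral (planeWave 0 z) (-1) R =
      (Complex.exp (Complex.I * (-R : ℝ) * z) - 1) * (-Complex.I * (z : ℂ)⁻¹) := by
  rw [segmentIntegral_planeWave_neg, segmentIntegral_planeWave_zero_one (neg_ne_zero.2 hz)]
  push_cast
  rw [inv_neg]
  ring_nf

lemma tendsto_integral_exp_sub_one {f : ℝ → ℂ} (hf : Integrable f) (x : ℝ) {c : ℝ} (hc : c ≠ 0)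
    {l : Filter ℝ} (hl : l ≤ cocompact ℝ) :
    Tendsto (fun R : ℝ => ∫ y : ℝ, (Complex.exp (Complex.I * R * (x - c * y : ℝ)) - 1) * f y) l
      (𝓝 (-∫ y, f y)) := by
  have h := (tendsto_integral_exp_I_mul_sub f x hc hl).sub_const (∫ y, f y)
  rw [zero_sub] at h
  refine h.congr fun R => ?_
  rw [← integral_sub _ hf]
  · refine integral_congr_ae (.of_forall fun y => ?_)
    simp only
    ring
  · refine hf.norm.mono' (AEStronglyMeasurable.mul
      (Continuous.aestronglyMeasurable (by fun_prop)) hf.aestronglyMeasurable)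
      (.of_forall fun y => ?_)
    have : Complex.I * R * (x - c * y : ℝ) = ((R * (x - c * y) : ℝ) : ℂ) * Complex.I := by
      push_cast; ring
    rw [norm_mul, this, Complex.norm_exp_ofReal_mul_I, one_mul]

section TimeZero

variable {g : ℝ → ℂ} {x c δ : ℝ}

lemma integrable_mul_inv_sub (hg : Integrable g) (hδ : 0 < δ)
    (hsep : ∀ y, g y ≠ 0 → δ ≤ |x - c * y|) :
    Integrable fun y : ℝ => g y * (-Complex.I * ((x - c * y : ℝ) : ℂ)⁻¹) := by
  refine (hg.norm.mul_const δ⁻¹).mono' (hg.aestronglyMeasurable.mul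
    (Measurable.aestronglyMeasurable (by fun_prop))) (.of_forall fun y => ?_)
  by_cases hy : g y = 0
  · simp [hy]
  rw [norm_mul, norm_mul, norm_neg, Complex.norm_I, one_mul, norm_inv, Complex.norm_real,
    Real.norm_eq_abs]
  exact mul_le_mul_of_nonneg_left (inv_anti₀ hδ (hsep y hy)) (norm_nonneg _)

lemma tendsto_ray_one_zero (hg : Integrable g) (σ : ℝ) (hc : c ≠ 0) (hδ : 0 < δ)
    (hsep : ∀ y, g y ≠ 0 → δ ≤ |x - c * y|) :
    Tendsto (segmentIntegral (integrand σ x 0 (dilatedFourier c g)) 1) atTop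
      (𝓝 (-∫ y : ℝ, g y * (-Complex.I * ((x - c * y : ℝ) : ℂ)⁻¹))) := by
  refine (tendsto_integral_exp_sub_one (integrable_mul_inv_sub hg hδ hsep) x hc
    atTop_le_cocompact_real).congr' ?_
  filter_upwards [eventually_ge_atTop 0] with R hR
  rw [segmentIntegral_integrand hg σ x 0 c hR (by simp), mul_zero]
  refine integral_congr_ae (.of_forall fun y => ?_)
  by_cases hy : g y = 0
  · simp [hy]
  simp only
  rw [segmentIntegral_planeWave_zero_one (abs_pos.1 (hδ.trans_le (hsep y hy)))]
  ring

lemma tendsto_ray_neg_one_zero (hg : Integrable g) (σ : ℝ) (hc : c ≠ 0) (hδ : 0 < δ)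
    (hsep : ∀ y, g y ≠ 0 → δ ≤ |x - c * y|) :
    Tendsto (segmentIntegral (integrand σ x 0 (dilatedFourier c g)) (-1)) atTop
      (𝓝 (-∫ y : ℝ, g y * (-Complex.I * ((x - c * y : ℝ) : ℂ)⁻¹))) := by
  refine ((tendsto_integral_exp_sub_one (integrable_mul_inv_sub hg hδ hsep) x hc
    atBot_le_cocompact_real).comp tendsto_neg_atTop_atBot).congr' ?_
  filter_upwards [eventually_ge_atTop 0] with R hR
  rw [segmentIntegral_integrand hg σ x 0 c hR (by simp), mul_zero]
  refine integral_congr_ae (.of_forall fun y => ?_)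
  by_cases hy : g y = 0
  · simp [hy]
  simp only
  rw [segmentIntegral_planeWave_zero_neg_one (abs_pos.1 (hδ.trans_le (hsep y hy)))]
  ring

lemma dMinus_zero (hg : Integrable g) (σ : ℝ) (hc : c ≠ 0) (hx : x < 0)
    (hsupp : ∀ y, g y ≠ 0 → 0 ≤ c * y) :
    DMinusConverges (integrand σ x 0 (dilatedFourier c g)) ∧
      dMinusIntegral (integrand σ x 0 (dilatedFourier c g)) = 0 := by
  have hneg : ∀ y, g y ≠ 0 → 0 < -(x - c * y) := fun y hy => by linarith [hsupp y hy]
  have h1 := tendsto_ray_one_zero hg σ hc (δ := -x) (x := x) (by linarith) (fun y hy => by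
    rw [abs_of_nonpos (by linarith [hneg y hy])]; linarith [hsupp y hy])
  have h2 := tendsto_ray_neg_I (t := 0) (σ := σ) hg hx hsupp
  refine ⟨⟨.of_tendsto h1, .of_tendsto h2⟩, ?_⟩
  rw [dMinusIntegral, rayIntegral_eq h1, rayIntegral_eq h2, mul_zero, neg_neg,
    ← eq_neg_iff_add_eq_zero, ← integral_neg]
  refine integral_congr_ae (.of_forall fun y => ?_)
  by_cases hy : g y = 0
  · simp [hy]
  simp only
  rw [chirpLaplace_zero (hneg y hy)]
  push_cast
  rw [one_div, ← neg_inv]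
  ring

lemma dPlus_zero (hg : Integrable g) (σ : ℝ) (hc : c ≠ 0) (hx : 0 < x)
    (hsupp : ∀ y, g y ≠ 0 → c * y ≤ 0) :
    DPlusConverges (integrand σ x 0 (dilatedFourier c g)) ∧
      dPlusIntegral (integrand σ x 0 (dilatedFourier c g)) = 0 := by
  have hpos : ∀ y, g y ≠ 0 → 0 < x - c * y := fun y hy => by linarith [hsupp y hy]
  have h1 := tendsto_ray_neg_one_zero hg σ hc (δ := x) (x := x) hx (fun y hy => by
    rw [abs_of_pos (hpos y hy)]; linarith [hsupp y hy])
  have h2 := tendsto_ray_I (t := 0) (σ := σ) hg hx hsupp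
  refine ⟨⟨.of_tendsto h1, .of_tendsto h2⟩, ?_⟩
  rw [dPlusIntegral, rayIntegral_eq h1, rayIntegral_eq h2, mul_zero, neg_neg,
    ← eq_neg_iff_add_eq_zero, ← integral_neg]
  refine integral_congr_ae (.of_forall fun y => ?_)
  by_cases hy : g y = 0
  · simp [hy]
  simp only
  rw [chirpLaplace_zero (hpos y hy)]
  push_cast
  rw [one_div]
  ring

end TimeZero

/-! Pointwise Fourier inversion, by Dini's criterion. -/

/-- The integral over `(-1, 1)` of the truncated integrals `∫₀ᴿ e^{ikz} dk`; it tends to `π`. -/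
def dirichletMass (R : ℝ) : ℂ :=
  ∫ z : ℝ, (Ioo (-1) 1).indicator (fun z => segmentIntegral (planeWave 0 z) 1 R) z

/-- The difference quotient of `g` at `x`, with the value `g x` cut off to the unit neighbourhood
of `x` to make it decay. -/
def diniQuotient (g : ℝ → ℂ) (x y : ℝ) : ℂ :=
  (g y - (Ioo (-1) 1).indicator (fun _ => g x) (x - y)) * (-Complex.I * ((x - y : ℝ) : ℂ)⁻¹)

lemma integrable_indicator_Ioo_comp_sub {f : ℝ → ℂ} (hf : Continuous f) (x : ℝ) :
    Integrable fun y => (Ioo (-1) 1).indicator f (x - y) := by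
  have : Integrable ((Ioo (-1) 1).indicator f) := by
    rw [integrable_indicator_iff measurableSet_Ioo]
    exact (hf.integrableOn_Icc (a := -1) (b := 1)).mono_set Ioo_subset_Icc_self
  exact this.comp_sub_left x

/-- Differentiability is one way to satisfy Dini's criterion. -/
lemma integrable_diniQuotient {g : ℝ → ℂ} (hg : Integrable g) {x : ℝ}
    (hd : DifferentiableAt ℝ g x) : Integrable (diniQuotient g x) := by
  have hO := hd.hasDerivAt.isBigO_sub
  obtain ⟨C, hC0, hC⟩ := hO.exists_pos
  rw [Asymptotics.IsBigOWith, Metric.eventually_nhds_iff] at hC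
  obtain ⟨ε, hε, hC⟩ := hC
  set δ := min ε 1
  have hδ : 0 < δ := lt_min hε one_pos
  have hind := integrable_indicator_Ioo_comp_sub (continuous_const (y := (1 : ℂ))) x
  have hindg := integrable_indicator_Ioo_comp_sub (continuous_const (y := g x)) x
  have hmeas : AEStronglyMeasurable (diniQuotient g x) := by
    refine (hg.sub hindg).aestronglyMeasurable.mul (Measurable.aestronglyMeasurable (by fun_prop))
  refine ((hind.norm.mul_const C).add ((hg.sub hindg).norm.mul_const δ⁻¹)).mono' hmeas
    (.of_forall fun y => ?_)
  have hnorm : ‖diniQuotient g x y‖ =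
      ‖g y - (Ioo (-1) 1).indicator (fun _ => g x) (x - y)‖ * |x - y|⁻¹ := by
    simp [diniQuotient, -Complex.ofReal_sub]
  rw [hnorm, Pi.add_apply]
  by_cases hy : |x - y| < δ
  · have hmem : x - y ∈ Ioo (-1 : ℝ) 1 := abs_lt.1 (hy.trans_le (min_le_right _ _))
    have hb := hC (y := y) (by
      rw [dist_comm, Real.dist_eq]; exact hy.trans_le (min_le_left _ _))
    rw [indicator_of_mem hmem, indicator_of_mem hmem, norm_one, one_mul]
    refine le_add_of_le_of_nonneg ?_ (by positivity)
    rcases eq_or_ne x y with rfl | hne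
    · simp [hC0.le]
    have : 0 < |x - y| := abs_pos.2 (sub_ne_zero.2 hne)
    rw [← div_eq_mul_inv, div_le_iff₀ this]
    rwa [Real.norm_eq_abs, abs_sub_comm] at hb
  · push Not at hy
    refine le_add_of_nonneg_of_le (by positivity) ?_
    exact mul_le_mul_of_nonneg_left (inv_anti₀ hδ hy) (norm_nonneg _)

lemma segmentIntegral_one_eq_dini {g : ℝ → ℂ} (hg : Integrable g) (σ x : ℝ) {R : ℝ} (hR : 0 ≤ R)
    (hq : Integrable (diniQuotient g x)) :
    segmentIntegral (integrand σ x 0 (dilatedFourier 1 g)) 1 R =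
      (∫ y : ℝ, (Complex.exp (Complex.I * R * (x - 1 * y : ℝ)) - 1) * diniQuotient g x y) +
        g x * dirichletMass R := by
  have hcont := continuous_segmentIntegral_planeWave 0 1 R
  have hS := integral_sub_left_eq_self
    ((Ioo (-1 : ℝ) 1).indicator (fun z => segmentIntegral (planeWave 0 z) 1 R)) volume x
  rw [segmentIntegral_integrand hg σ x 0 1 hR (by simp), mul_zero, dirichletMass, ← hS,
    ← integral_const_mul, ← integral_add]
  · have hne : ∀ᵐ y : ℝ, y ≠ x := by simp [ae_iff]
    refine integral_congr_ae (hne.mono fun y hy => ?_)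
    have hz : x - y ≠ 0 := sub_ne_zero.2 hy.symm
    simp only [one_mul, diniQuotient]
    rw [segmentIntegral_planeWave_zero_one hz]
    by_cases hm : x - y ∈ Ioo (-1 : ℝ) 1
    · rw [indicator_of_mem hm, indicator_of_mem hm, segmentIntegral_planeWave_zero_one hz]
      ring
    · rw [indicator_of_notMem hm, indicator_of_notMem hm]
      ring
  · refine (hq.norm.const_mul 2).mono' (AEStronglyMeasurable.mul
      (Continuous.aestronglyMeasurable (by fun_prop)) hq.aestronglyMeasurable)
      (.of_forall fun y => ?_)
    rw [norm_mul]
    refine mul_le_mul_of_nonneg_right ((norm_sub_le _ _).trans ?_) (norm_nonneg _)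
    have : Complex.I * R * (x - 1 * y : ℝ) = ((R * (x - 1 * y) : ℝ) : ℂ) * Complex.I := by
      push_cast; ring
    rw [this, Complex.norm_exp_ofReal_mul_I, norm_one]
    norm_num
  · exact (integrable_indicator_Ioo_comp_sub hcont x).const_mul _

lemma diniQuotient_comp_neg (g : ℝ → ℂ) (x y : ℝ) :
    diniQuotient (fun y => g (-y)) (-x) (-y) = -diniQuotient g x y := by
  have h : -x - -y = -(x - y) := by ring
  have h2 : -(x - y) ∈ Ioo (-1 : ℝ) 1 ↔ x - y ∈ Ioo (-1 : ℝ) 1 := by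
    simp only [mem_Ioo]; constructor <;> rintro ⟨h1, h2⟩ <;> constructor <;> linarith
  simp only [diniQuotient, neg_neg, h, indicator, h2]
  push_cast
  rw [← neg_inv]
  ring

lemma segmentIntegral_neg_one_eq_dini {g : ℝ → ℂ} (hg : Integrable g) (σ x : ℝ) {R : ℝ}
    (hR : 0 ≤ R) (hq : Integrable (diniQuotient g x)) :
    segmentIntegral (integrand σ x 0 (dilatedFourier 1 g)) (-1) R =
      (∫ y : ℝ, (Complex.exp (Complex.I * (-R : ℝ) * (x - 1 * y : ℝ)) - 1) *
        diniQuotient g x y) - g x * dirichletMass R := by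
  -- reflect `y` and `x`
  have hq' : Integrable (diniQuotient (fun y => g (-y)) (-x)) := by
    refine hq.comp_neg.neg.congr (.of_forall fun y => ?_)
    have := diniQuotient_comp_neg g x (-y)
    rw [neg_neg] at this
    simp only [Pi.neg_apply, this]
  have h := segmentIntegral_one_eq_dini hg.comp_neg σ (-x) hR hq'
  rw [segmentIntegral_integrand hg.comp_neg σ (-x) 0 1 hR (by simp)] at h
  rw [segmentIntegral_integrand hg σ x 0 1 hR (by simp)]
  have e1 : (∫ y : ℝ, g y * segmentIntegral (planeWave (σ * 0) (x - 1 * y)) (-1) R) =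
      -∫ y : ℝ, g (-y) * segmentIntegral (planeWave (σ * 0) (-x - 1 * y)) 1 R := by
    rw [← integral_neg, ← integral_neg_eq_self]
    refine integral_congr_ae (.of_forall fun y => ?_)
    simp only
    rw [segmentIntegral_planeWave_neg]
    ring_nf
  have e2 : (∫ y : ℝ, (Complex.exp (Complex.I * (-R : ℝ) * (x - 1 * y : ℝ)) - 1) *
        diniQuotient g x y) = -∫ y : ℝ, (Complex.exp (Complex.I * R * (-x - 1 * y : ℝ)) - 1) *
        diniQuotient (fun y => g (-y)) (-x) y := by
    rw [← integral_neg, ← integral_neg_eq_self]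
    refine integral_congr_ae (.of_forall fun y => ?_)
    have := diniQuotient_comp_neg g x (-y)
    rw [neg_neg] at this
    simp only [this]
    push_cast
    ring_nf
  rw [e1, h, e2, neg_neg]
  ring

lemma tendsto_dirichletMass : Tendsto dirichletMass atTop (𝓝 Real.pi) := by
  -- invert the Fourier transform of a Gaussian at the origin
  set g : ℝ → ℂ := fun y => Complex.exp (-1 * (y : ℂ) ^ 2) with hgdef
  have hg : Integrable g := integrable_cexp_neg_mul_sq (b := 1) (by simp)
  have hd : DifferentiableAt ℝ g 0 :=
    (((hasDerivAt_id (0 : ℝ)).ofReal_comp.pow 2).const_mul (-1 : ℂ)).cexp.differentiableAt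
  have hq := integrable_diniQuotient hg hd
  have hg0 : g 0 = 1 := by simp [hgdef]
  have hF : ∀ k : ℝ, dilatedFourier 1 g k =
      (Real.sqrt Real.pi : ℂ) * Complex.exp (-(1 / 4 : ℂ) * (k : ℂ) ^ 2) := by
    intro k
    have h := fourierIntegral_gaussian (b := 1) (by simp) (-k : ℂ)
    have h2 : ((Real.pi : ℂ) / 1) ^ (1 / 2 : ℂ) = (Real.sqrt Real.pi : ℂ) := by
      rw [div_one, Real.sqrt_eq_rpow, Complex.ofReal_cpow Real.pi_pos.le]
      push_cast; rfl
    rw [h2] at h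
    rw [dilatedFourier]
    convert h using 2
    · funext y
      simp only [hgdef]
      congr 2
      push_cast
      ring
    · congr 1
      ring
  have hint : IntegrableOn (fun k : ℝ => dilatedFourier 1 g k) (Ioi 0) := by
    simp_rw [hF]
    exact ((integrable_cexp_neg_mul_sq (b := 1 / 4) (by norm_num)).const_mul _).integrableOn
  have hval : ∫ k in Ioi (0 : ℝ), dilatedFourier 1 g k = Real.pi := by
    simp_rw [hF]
    rw [integral_const_mul, integral_gaussian_complex_Ioi (by norm_num)]
    have h3 : ((Real.pi : ℂ) / (1 / 4)) ^ (1 / 2 : ℂ) = 2 * (Real.sqrt Real.pi : ℂ) := by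
      have : ((Real.pi : ℂ) / (1 / 4)) = ((2 ^ 2 * Real.pi : ℝ) : ℂ) := by push_cast; ring
      have h4 : (1 / 2 : ℂ) = ((1 / 2 : ℝ) : ℂ) := by push_cast; ring
      rw [this, h4, ← Complex.ofReal_cpow (by positivity), ← Real.sqrt_eq_rpow,
        Real.sqrt_mul (by positivity), Real.sqrt_sq (by norm_num)]
      push_cast; rfl
    rw [h3]
    have : (Real.sqrt Real.pi : ℂ) * (Real.sqrt Real.pi : ℂ) = Real.pi := by
      exact_mod_cast Real.mul_self_sqrt Real.pi_pos.le
    linear_combination this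
  have hray : Tendsto (segmentIntegral (integrand 1 0 0 (dilatedFourier 1 g)) 1) atTop
      (𝓝 Real.pi) := by
    rw [← hval]
    refine (intervalIntegral_tendsto_integral_Ioi 0 hint tendsto_id).congr fun R => ?_
    refine intervalIntegral.integral_congr fun s _ => ?_
    simp [integrand, lam]
  have hodd : ∫ y, diniQuotient g 0 y = 0 := by
    have h : (fun y => diniQuotient g 0 y) = fun y => -diniQuotient g 0 (-y) := by
      funext y
      have := diniQuotient_comp_neg g 0 y
      have hg' : (fun y => g (-y)) = g := by funext y; simp [hgdef]
      rw [hg', neg_zero] at this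
      rw [this, neg_neg]
    have h2 := integral_neg_eq_self (diniQuotient g 0) volume
    have h3 : ∫ y, diniQuotient g 0 y = -∫ y, diniQuotient g 0 (-y) := by
      rw [← integral_neg, ← h]
    rw [h2] at h3
    linear_combination h3 / 2
  have hlim := tendsto_integral_exp_sub_one hq 0 one_ne_zero atTop_le_cocompact_real
  rw [hodd, neg_zero] at hlim
  have := hray.sub hlim
  rw [sub_zero] at this
  refine this.congr' ?_
  filter_upwards [eventually_ge_atTop 0] with R hR
  rw [segmentIntegral_one_eq_dini hg 1 0 hR hq, hg0]
  ring

/-- Pointwise Fourier inversion. -/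
lemma line_zero {g : ℝ → ℂ} (hg : Integrable g) (σ : ℝ) {x : ℝ} (hd : DifferentiableAt ℝ g x) :
    LineConverges (integrand σ x 0 (dilatedFourier 1 g)) ∧
      lineIntegral (integrand σ x 0 (dilatedFourier 1 g)) = 2 * Real.pi * g x := by
  have hq := integrable_diniQuotient hg hd
  have h1 : Tendsto (segmentIntegral (integrand σ x 0 (dilatedFourier 1 g)) 1) atTop
      (𝓝 (-(∫ y, diniQuotient g x y) + g x * Real.pi)) := by
    refine ((tendsto_integral_exp_sub_one hq x one_ne_zero atTop_le_cocompact_real).add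
      (tendsto_dirichletMass.const_mul (g x))).congr' ?_
    filter_upwards [eventually_ge_atTop 0] with R hR
    rw [segmentIntegral_one_eq_dini hg σ x hR hq]
  have h2 : Tendsto (segmentIntegral (integrand σ x 0 (dilatedFourier 1 g)) (-1)) atTop
      (𝓝 (-(∫ y, diniQuotient g x y) - g x * Real.pi)) := by
    refine (((tendsto_integral_exp_sub_one hq x one_ne_zero atBot_le_cocompact_real).comp
      tendsto_neg_atTop_atBot).sub (tendsto_dirichletMass.const_mul (g x))).congr' ?_
    filter_upwards [eventually_ge_atTop 0] with R hR
    rw [segmentIntegral_neg_one_eq_dini hg σ x hR hq]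
    rfl
  refine ⟨⟨.of_tendsto h1, .of_tendsto h2⟩, ?_⟩
  rw [lineIntegral, rayIntegral_eq h1, rayIntegral_eq h2]
  ring

/-! ### Building blocks of solutions on the whole line -/

/-- `Q` is a classical solution of `i q_t = σ q_xx` for all positions and all positive times,
and `Q₁`, `Q₂` are its first two derivatives in space. -/
structure IsFlow (σ : ℝ) (Q Q₁ Q₂ : ℝ → ℝ → ℂ) : Prop where
  hasDerivAt_x : ∀ x, ∀ t > 0, HasDerivAt (fun y => Q y t) (Q₁ x t) x
  hasDerivAt_xx : ∀ x, ∀ t > 0, HasDerivAt (fun y => Q₁ y t) (Q₂ x t) x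
  hasDerivAt_t : ∀ x, ∀ t > 0, HasDerivAt (fun s => Q x s) (-Complex.I * σ * Q₂ x t) t
  continuousAt : ∀ x, ∀ t > 0, ContinuousAt (Function.uncurry Q) (x, t)
  continuousAt₁ : ∀ x, ∀ t > 0, ContinuousAt (Function.uncurry Q₁) (x, t)
  continuousAt₂ : ∀ x, ∀ t > 0, ContinuousAt (Function.uncurry Q₂) (x, t)

namespace IsFlow

variable {σ : ℝ} {P P₁ P₂ Q Q₁ Q₂ : ℝ → ℝ → ℂ}

lemma add (hP : IsFlow σ P P₁ P₂) (hQ : IsFlow σ Q Q₁ Q₂) :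
    IsFlow σ (fun x t => P x t + Q x t) (fun x t => P₁ x t + Q₁ x t)
      (fun x t => P₂ x t + Q₂ x t) where
  hasDerivAt_x x t ht := (hP.hasDerivAt_x x t ht).add (hQ.hasDerivAt_x x t ht)
  hasDerivAt_xx x t ht := (hP.hasDerivAt_xx x t ht).add (hQ.hasDerivAt_xx x t ht)
  hasDerivAt_t x t ht := ((hP.hasDerivAt_t x t ht).add (hQ.hasDerivAt_t x t ht)).congr_deriv
    (by ring)
  continuousAt x t ht := (hP.continuousAt x t ht).add (hQ.continuousAt x t ht)
  continuousAt₁ x t ht := (hP.continuousAt₁ x t ht).add (hQ.continuousAt₁ x t ht)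
  continuousAt₂ x t ht := (hP.continuousAt₂ x t ht).add (hQ.continuousAt₂ x t ht)

lemma const_mul (a : ℂ) (hQ : IsFlow σ Q Q₁ Q₂) :
    IsFlow σ (fun x t => a * Q x t) (fun x t => a * Q₁ x t) (fun x t => a * Q₂ x t) where
  hasDerivAt_x x t ht := (hQ.hasDerivAt_x x t ht).const_mul a
  hasDerivAt_xx x t ht := (hQ.hasDerivAt_xx x t ht).const_mul a
  hasDerivAt_t x t ht := ((hQ.hasDerivAt_t x t ht).const_mul a).congr_deriv (by ring)
  continuousAt x t ht := (hQ.continuousAt x t ht).const_mul a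
  continuousAt₁ x t ht := (hQ.continuousAt₁ x t ht).const_mul a
  continuousAt₂ x t ht := (hQ.continuousAt₂ x t ht).const_mul a

lemma const (σ : ℝ) (a : ℂ) : IsFlow σ (fun _ _ => a) (fun _ _ => 0) (fun _ _ => 0) where
  hasDerivAt_x x _ _ := hasDerivAt_const x a
  hasDerivAt_xx x _ _ := hasDerivAt_const x 0
  hasDerivAt_t _ t _ := (hasDerivAt_const t a).congr_deriv (by simp)
  continuousAt _ _ _ := continuousAt_const
  continuousAt₁ _ _ _ := continuousAt_const
  continuousAt₂ _ _ _ := continuousAt_const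

/-- A function that agrees with a flow on an open set of positions is a classical solution
there. -/
lemma isClassicalSolutionOn (hQ : IsFlow σ Q Q₁ Q₂) {S : Set ℝ} (hS : IsOpen S)
    {q : ℝ → ℝ → ℂ} (hq : ∀ x ∈ S, ∀ t > 0, q x t = Q x t) :
    IsClassicalSolutionOn S σ q ∧ ∀ x ∈ S, ∀ t > 0, dx q x t = Q₁ x t := by
  have e0 : ∀ t > 0, ∀ x ∈ S, (fun y => q y t) =ᶠ[𝓝 x] fun y => Q y t := fun t ht x hx => by
    filter_upwards [hS.mem_nhds hx] with y hy using hq y hy t ht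
  have h1 : ∀ x ∈ S, ∀ t > 0, HasDerivAt (fun y => q y t) (Q₁ x t) x := fun x hx t ht =>
    (hQ.hasDerivAt_x x t ht).congr_of_eventuallyEq (e0 t ht x hx)
  have d1 : ∀ x ∈ S, ∀ t > 0, dx q x t = Q₁ x t := fun x hx t ht => (h1 x hx t ht).deriv
  have h2 : ∀ x ∈ S, ∀ t > 0, HasDerivAt (fun y => dx q y t) (Q₂ x t) x := fun x hx t ht =>
    (hQ.hasDerivAt_xx x t ht).congr_of_eventuallyEq (by
      filter_upwards [hS.mem_nhds hx] with y hy using d1 y hy t ht)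
  have d2 : ∀ x ∈ S, ∀ t > 0, dx (dx q) x t = Q₂ x t := fun x hx t ht => (h2 x hx t ht).deriv
  have ht' : ∀ x ∈ S, ∀ t > 0, HasDerivAt (fun s => q x s) (-Complex.I * σ * Q₂ x t) t :=
    fun x hx t ht => (hQ.hasDerivAt_t x t ht).congr_of_eventuallyEq (by
      filter_upwards [isOpen_Ioi.mem_nhds ht] with s hs using hq x hx s hs)
  have d3 : ∀ x ∈ S, ∀ t > 0, dt q x t = -Complex.I * σ * Q₂ x t := fun x hx t ht =>
    (ht' x hx t ht).deriv
  have hcont : ∀ {f F : ℝ → ℝ → ℂ}, (∀ x ∈ S, ∀ t > 0, f x t = F x t) →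
      (∀ x, ∀ t > 0, ContinuousAt (Function.uncurry F) (x, t)) →
      ContinuousOn (Function.uncurry f) (S ×ˢ Ioi 0) := by
    intro f F hfF hF
    refine ContinuousOn.congr (f := Function.uncurry F) ?_ ?_
    · rintro ⟨x, t⟩ ⟨-, ht⟩
      exact (hF x t ht).continuousWithinAt
    · rintro ⟨x, t⟩ ⟨hx, ht⟩
      exact hfF x hx t ht
  refine ⟨⟨fun x hx t ht => (ht' x hx t ht).differentiableAt,
    fun x hx t ht => (h1 x hx t ht).differentiableAt,
    fun x hx t ht => (h2 x hx t ht).differentiableAt,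
    hcont hq hQ.continuousAt,
    hcont d3 (fun x t ht => continuousAt_const.mul (hQ.continuousAt₂ x t ht)),
    hcont d1 hQ.continuousAt₁, hcont d2 hQ.continuousAt₂, fun x hx t ht => ?_⟩, d1⟩
  rw [d3 x hx t ht, d2 x hx t ht]
  linear_combination (-(σ : ℂ) * Q₂ x t) * Complex.I_mul_I

end IsFlow

/-! The Fresnel block. -/

/-- The solution `(2 e^{iπ/4} / √π) ∫₀^{x/√(4σt)} e^{-iu²} du`, which evolves from the sign
function. -/
def erfFlow (σ x t : ℝ) : ℂ :=
  2 * Complex.exp (Complex.I * Real.pi / 4) / (Real.sqrt Real.pi : ℂ) *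
    fresnel (-1) (x / Real.sqrt (4 * (σ * t)))

lemma phi_eq {σ t : ℝ} (hσ : 0 < σ) (ht : 0 < t) (x : ℝ) :
    phi σ x t = -(Real.sign x : ℂ) + erfFlow σ x t := by
  have hs : 0 < Real.sqrt (4 * (σ * t)) := Real.sqrt_pos.2 (by positivity)
  have hs' : (Real.sqrt (4 * (σ * t)) : ℂ) ≠ 0 := by exact_mod_cast hs.ne'
  have hsp : (Real.sqrt Real.pi : ℂ) ≠ 0 := by exact_mod_cast (Real.sqrt_pos.2 Real.pi_pos).ne'
  have hst : Real.sqrt (4 * (σ * t)) = 2 * Real.sqrt (σ * t) := by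
    rw [Real.sqrt_mul (by norm_num), show (4 : ℝ) = 2 ^ 2 by norm_num, Real.sqrt_sq (by norm_num)]
  have hst2 : (Real.sqrt (4 * (σ * t)) : ℂ) ^ 2 = 4 * σ * t := by
    have := Real.sq_sqrt (show 0 ≤ 4 * (σ * t) by positivity)
    rw [← Complex.ofReal_pow, this]; push_cast; ring
  rw [phi, if_pos ht, erfFlow, fresnel]
  congr 1
  have h := intervalIntegral.integral_comp_div (a := 0) (b := x)
    (fun u : ℝ => Complex.exp ((-1 : ℝ) * Complex.I * (u : ℂ) ^ 2)) hs.ne'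
  rw [zero_div] at h
  have h2 : (∫ y in (0 : ℝ)..x, Complex.exp (-Complex.I * (y : ℂ) ^ 2 / (4 * σ * t))) =
      Real.sqrt (4 * (σ * t)) • ∫ u in (0 : ℝ)..x / Real.sqrt (4 * (σ * t)),
        Complex.exp ((-1 : ℝ) * Complex.I * (u : ℂ) ^ 2) := by
    rw [← h]
    refine intervalIntegral.integral_congr fun y _ => ?_
    congr 1
    push_cast
    rw [div_pow, hst2]
    ring
  have h3 : Real.sqrt (Real.pi * σ * t) = Real.sqrt Real.pi * Real.sqrt (σ * t) := by
    rw [mul_assoc, Real.sqrt_mul Real.pi_pos.le]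
  have h4 : (Real.sqrt (σ * t) : ℂ) ≠ 0 := by
    exact_mod_cast (Real.sqrt_pos.2 (by positivity : 0 < σ * t)).ne'
  rw [h2, Complex.real_smul, h3, hst]
  push_cast
  field_simp

lemma exists_norm_erfFlow_le (σ : ℝ) : ∃ C, 0 ≤ C ∧ ∀ x t, ‖erfFlow σ x t‖ ≤ C := by
  obtain ⟨C, hC0, hC⟩ := exists_norm_fresnel_le (η := -1) (by norm_num)
  refine ⟨‖2 * Complex.exp (Complex.I * Real.pi / 4) / (Real.sqrt Real.pi : ℂ)‖ * C,
    by positivity, fun x t => ?_⟩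
  rw [erfFlow, norm_mul]
  exact mul_le_mul_of_nonneg_left (hC _) (norm_nonneg _)

lemma erfFlow_neg (σ x t : ℝ) : erfFlow σ (-x) t = -erfFlow σ x t := by
  rw [erfFlow, neg_div, fresnel_neg, erfFlow, mul_neg]

lemma erfFlow_zero (σ t : ℝ) : erfFlow σ 0 t = 0 := by
  rw [erfFlow, zero_div, fresnel_zero, mul_zero]

lemma tendsto_erf_atTop :
    Tendsto (fun s => 2 * Complex.exp (Complex.I * Real.pi / 4) / (Real.sqrt Real.pi : ℂ) *
      fresnel (-1) s) atTop (𝓝 1) := by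
  have h := (tendsto_fresnel (η := -1) (Or.inr rfl)).const_mul
    (2 * Complex.exp (Complex.I * Real.pi / 4) / (Real.sqrt Real.pi : ℂ))
  have hsp : (Real.sqrt Real.pi : ℂ) ≠ 0 := by exact_mod_cast (Real.sqrt_pos.2 Real.pi_pos).ne'
  convert h using 2
  have : Complex.exp (((-1 : ℝ) : ℂ) * (Complex.I * Real.pi / 4)) =
      (Complex.exp (Complex.I * Real.pi / 4))⁻¹ := by
    rw [← Complex.exp_neg]; push_cast; rw [neg_one_mul]
  rw [this]
  have := Complex.exp_ne_zero (Complex.I * Real.pi / 4)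
  field_simp

lemma tendsto_erfFlow_atTop {σ t : ℝ} (hσ : 0 < σ) (ht : 0 < t) :
    Tendsto (fun x => erfFlow σ x t) atTop (𝓝 1) :=
  tendsto_erf_atTop.comp (tendsto_id.atTop_div_const (Real.sqrt_pos.2 (by positivity)))

lemma tendsto_erfFlow_atBot {σ t : ℝ} (hσ : 0 < σ) (ht : 0 < t) :
    Tendsto (fun x => erfFlow σ x t) atBot (𝓝 (-1)) := by
  have := ((tendsto_erfFlow_atTop hσ ht).comp tendsto_neg_atBot_atTop).neg
  refine this.congr fun x => ?_
  simp only [Function.comp_apply, erfFlow_neg, neg_neg]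

lemma tendsto_erfFlow_zero {σ : ℝ} (hσ : 0 < σ) (x : ℝ) :
    Tendsto (fun t => erfFlow σ x t) (𝓝[>] 0) (𝓝 (Real.sign x)) := by
  have hpos : ∀ y : ℝ, 0 < y → Tendsto (fun t => erfFlow σ y t) (𝓝[>] 0) (𝓝 1) := by
    intro y hy
    refine tendsto_erf_atTop.comp ?_
    have h1 : Tendsto (fun t : ℝ => (Real.sqrt (4 * (σ * t)))⁻¹) (𝓝[>] 0) atTop := by
      refine tendsto_inv_nhdsGT_zero.comp (tendsto_nhdsWithin_iff.2 ⟨?_, ?_⟩)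
      · have : Continuous fun t : ℝ => Real.sqrt (4 * (σ * t)) := by fun_prop
        have := this.tendsto 0
        simp only [mul_zero, Real.sqrt_zero] at this
        exact this.mono_left nhdsWithin_le_nhds
      · refine eventually_nhdsWithin_of_forall fun t ht => Real.sqrt_pos.2 ?_
        have : (0 : ℝ) < t := ht
        positivity
    exact h1.const_mul_atTop hy
  rcases lt_trichotomy x 0 with hx | rfl | hx
  · rw [Real.sign_of_neg hx]
    have := (hpos (-x) (by linarith)).neg
    simp only [erfFlow_neg, neg_neg] at this
    simpa using this
  · simp [erfFlow_zero]
  · rw [Real.sign_of_pos hx]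
    simpa using hpos x hx

lemma continuousAt_kernel {K : ℂ → ℝ → ℂ}
    (hK : ∀ w ∈ Complex.slitPlane, ∀ z, ContinuousAt (fun p : ℂ × ℝ => K p.1 p.2) (w, z))
    {σ : ℝ} (hσ : 0 < σ) (a c : ℝ) (x : ℝ) {t : ℝ} (ht : 0 < t) :
    ContinuousAt (fun p : ℝ × ℝ => K (-Complex.I * (σ * p.2 : ℝ)) (a * p.1 - c)) (x, t) := by
  have h1 : ContinuousAt (fun p : ℝ × ℝ => ((-Complex.I * (σ * p.2 : ℝ) : ℂ), a * p.1 - c))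
      (x, t) := by fun_prop
  exact ContinuousAt.comp (f := fun p : ℝ × ℝ => ((-Complex.I * (σ * p.2 : ℝ) : ℂ), a * p.1 - c))
    (g := fun p : ℂ × ℝ => K p.1 p.2)
    (hK _ (schrodingerTime_mem_slitPlane (by positivity)) _) h1

lemma isFlow_erfFlow {σ : ℝ} (hσ : 0 < σ) :
    IsFlow σ (erfFlow σ) (fun x t => 2 * heatKernel (-Complex.I * (σ * t : ℝ)) x)
      (fun x t => 2 * heatKernel₁ (-Complex.I * (σ * t : ℝ)) x) := by
  have hsp : (Real.sqrt Real.pi : ℂ) ≠ 0 := by exact_mod_cast (Real.sqrt_pos.2 Real.pi_pos).ne'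
  have hexp : ∀ x t : ℝ, 0 < t →
      2 * Complex.exp (Complex.I * Real.pi / 4) / (Real.sqrt Real.pi : ℂ) *
        Complex.exp ((-1 : ℝ) * Complex.I * ((x / Real.sqrt (4 * (σ * t)) : ℝ) : ℂ) ^ 2) =
      Real.sqrt (4 * (σ * t)) * (2 * heatKernel (-Complex.I * (σ * t : ℝ)) x) := by
    intro x t ht
    have hs' : (Real.sqrt (4 * (σ * t)) : ℂ) ≠ 0 := by
      exact_mod_cast (Real.sqrt_pos.2 (by positivity : 0 < 4 * (σ * t))).ne'
    have hst2 : (Real.sqrt (4 * (σ * t)) : ℂ) ^ 2 = 4 * (σ * t : ℝ) := by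
      have := Real.sq_sqrt (show 0 ≤ 4 * (σ * t) by positivity)
      rw [← Complex.ofReal_pow, this]; push_cast; ring
    have h4 : Real.sqrt (4 * Real.pi * (σ * t)) =
        Real.sqrt Real.pi * Real.sqrt (4 * (σ * t)) := by
      rw [← Real.sqrt_mul Real.pi_pos.le]; congr 1; ring
    rw [heatKernel_neg_I_mul (by positivity), h4]
    have h5 : ((-1 : ℝ) * Complex.I * ((x / Real.sqrt (4 * (σ * t)) : ℝ) : ℂ) ^ 2) =
        -Complex.I * (x : ℂ) ^ 2 / (4 * (σ * t : ℝ)) := by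
      rw [Complex.ofReal_div, div_pow, hst2]; push_cast; ring
    rw [h5, Complex.ofReal_mul (Real.sqrt Real.pi)]
    generalize (Real.sqrt (4 * (σ * t)) : ℂ) = r at hs' ⊢
    field_simp
  have hcont0 := fun x t (ht : 0 < t) => continuousAt_kernel (K := heatKernel)
    (fun w hw z => continuousAt_heatKernel hw z) hσ 1 0 x ht
  have hcont1 := fun x t (ht : 0 < t) => continuousAt_kernel (K := heatKernel₁)
    (fun w hw z => continuousAt_heatKernel₁ hw z) hσ 1 0 x ht
  simp only [one_mul, sub_zero] at hcont0 hcont1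
  refine ⟨fun x t ht => ?_, fun x t ht => (hasDerivAt_heatKernel _ _).const_mul 2,
    fun x t ht => ?_, fun x t ht => ?_, fun x t ht => (hcont0 x t ht).const_mul 2,
    fun x t ht => (hcont1 x t ht).const_mul 2⟩
  · have hs : 0 < Real.sqrt (4 * (σ * t)) := Real.sqrt_pos.2 (by positivity)
    have hs' : (Real.sqrt (4 * (σ * t)) : ℂ) ≠ 0 := by exact_mod_cast hs.ne'
    have h1 : HasDerivAt (fun y : ℝ => y / Real.sqrt (4 * (σ * t)))
        (1 / Real.sqrt (4 * (σ * t))) x := (hasDerivAt_id x).div_const _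
    refine (((hasDerivAt_fresnel (-1) _).scomp x h1).const_mul
      (2 * Complex.exp (Complex.I * Real.pi / 4) / (Real.sqrt Real.pi : ℂ))).congr_deriv ?_
    rw [Complex.real_smul, mul_left_comm, hexp x t ht, Complex.ofReal_div, Complex.ofReal_one]
    generalize (Real.sqrt (4 * (σ * t)) : ℂ) = r at hs' ⊢
    field_simp
  · have hpos : 0 < 4 * (σ * t) := by positivity
    have hs : 0 < Real.sqrt (4 * (σ * t)) := Real.sqrt_pos.2 hpos
    have hs' : (Real.sqrt (4 * (σ * t)) : ℂ) ≠ 0 := by exact_mod_cast hs.ne'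
    have h0 : HasDerivAt (fun s : ℝ => 4 * (σ * s)) (4 * σ) t := by
      simpa using ((hasDerivAt_id t).const_mul σ).const_mul 4
    have h1 : HasDerivAt (fun s : ℝ => x / Real.sqrt (4 * (σ * s)))
        (-(x / (2 * t)) / Real.sqrt (4 * (σ * t))) t := by
      have := ((h0.sqrt hpos.ne').inv hs.ne').const_mul x
      refine this.congr_deriv ?_
      rw [Real.sq_sqrt hpos.le]
      field_simp
    refine (((hasDerivAt_fresnel (-1) _).scomp t h1).const_mul
      (2 * Complex.exp (Complex.I * Real.pi / 4) / (Real.sqrt Real.pi : ℂ))).congr_deriv ?_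
    rw [Complex.real_smul, mul_left_comm, hexp x t ht, heatKernel₁, Complex.ofReal_div]
    generalize (Real.sqrt (4 * (σ * t)) : ℂ) = r at hs' ⊢
    have hσ' : (σ : ℂ) ≠ 0 := by exact_mod_cast hσ.ne'
    have ht' : (t : ℂ) ≠ 0 := by exact_mod_cast ht.ne'
    push_cast
    field_simp
  · have hpos : 0 < 4 * (σ * t) := by positivity
    have hs : Real.sqrt (4 * (σ * t)) ≠ 0 := (Real.sqrt_pos.2 hpos).ne'
    have h1 : ContinuousAt (fun p : ℝ × ℝ => p.1 / Real.sqrt (4 * (σ * p.2))) (x, t) :=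
      ContinuousAt.div (by fun_prop) (by fun_prop) hs
    exact ((continuous_fresnel (-1)).continuousAt.comp h1).const_mul _

/-! Superpositions of Schrödinger kernels. -/

/-- The superposition of kernels `K(-iσt, x - cy)` with weight `g(y)`. -/
def superpose (K : ℂ → ℝ → ℂ) (σ c : ℝ) (g : ℝ → ℂ) (x t : ℝ) : ℂ :=
  ∫ y : ℝ, K (-Complex.I * (σ * t : ℝ)) (x - c * y) * g y

/-- At imaginary times the heat kernel and its derivatives grow at most quadratically, uniformly
away from time zero. -/
lemma exists_norm_kernel_le {a : ℝ} (ha : 0 < a) : ∃ C, 0 ≤ C ∧ ∀ τ ≥ a, ∀ z : ℝ,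
    ‖heatKernel (-Complex.I * (τ : ℝ)) z‖ ≤ C * (1 + z ^ 2) ∧
    ‖heatKernel₁ (-Complex.I * (τ : ℝ)) z‖ ≤ C * (1 + z ^ 2) ∧
    ‖heatKernel₂ (-Complex.I * (τ : ℝ)) z‖ ≤ C * (1 + z ^ 2) := by
  set M := (4 * Real.pi * a) ^ (-(1 / 2) : ℝ) with hM
  have hpi := Real.pi_pos
  have hM0 : 0 ≤ M := by positivity
  refine ⟨M * (1 + 1 / a + 1 / a ^ 2), by positivity, fun τ hτ z => ?_⟩
  have hτ0 : 0 < τ := ha.trans_le hτ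
  have hn : ‖(-Complex.I * (τ : ℝ) : ℂ)‖ = τ := by
    rw [norm_mul, norm_neg, Complex.norm_I, one_mul, Complex.norm_real,
      Real.norm_of_nonneg hτ0.le]
  have h0 : ‖heatKernel (-Complex.I * (τ : ℝ)) z‖ ≤ M := by
    refine (norm_heatKernel_le (Complex.slitPlane_ne_zero (schrodingerTime_mem_slitPlane hτ0))
      (by simp) z).trans ?_
    rw [hn, hM]
    exact Real.rpow_le_rpow_of_nonpos (by positivity) (by gcongr) (by norm_num)
  have i1 : 1 / τ ≤ 1 / a := one_div_le_one_div_of_le ha hτ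
  have i2 : 1 / τ ^ 2 ≤ 1 / a ^ 2 := one_div_le_one_div_of_le (by positivity) (by gcongr)
  have p1 : 0 < 1 / τ := by positivity
  have p2 : 0 < 1 / τ ^ 2 := by positivity
  have q1 : 0 < 1 / a := by positivity
  have q2 : 0 < 1 / a ^ 2 := by positivity
  have hz := sq_nonneg z
  have hz1 : |z| ≤ 1 + z ^ 2 := by
    nlinarith [sq_abs z, abs_nonneg z, sq_nonneg (|z| - 1)]
  refine ⟨?_, ?_, ?_⟩
  · refine h0.trans ?_
    rw [mul_assoc]
    refine le_mul_of_one_le_right hM0 ?_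
    nlinarith [mul_nonneg q1.le hz, mul_nonneg q2.le hz]
  · rw [heatKernel₁, norm_mul, norm_neg, norm_div, norm_mul, hn, mul_comm, mul_assoc]
    refine mul_le_mul h0 ?_ (by positivity) hM0
    rw [Complex.norm_real, Real.norm_eq_abs, Complex.norm_ofNat]
    calc |z| / (2 * τ) = (1 / 2) * (|z| * (1 / τ)) := by field_simp
      _ ≤ 1 * ((1 + z ^ 2) * (1 / a)) := by gcongr; norm_num
      _ ≤ _ := by nlinarith [mul_nonneg q2.le hz]
  · rw [heatKernel₂, norm_mul, mul_comm, mul_assoc]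
    refine mul_le_mul h0 ?_ (by positivity) hM0
    refine (norm_sub_le _ _).trans ?_
    rw [norm_pow, norm_div, norm_div, norm_mul, hn, Complex.norm_real, Real.norm_eq_abs,
      Complex.norm_ofNat, norm_one, div_pow, sq_abs]
    calc z ^ 2 / (2 * τ) ^ 2 + 1 / (2 * τ) = (1 / 4) * (z ^ 2 * (1 / τ ^ 2)) +
          (1 / 2) * (1 / τ) := by field_simp; ring
      _ ≤ 1 * (z ^ 2 * (1 / a ^ 2)) + 1 * (1 / a) := by gcongr <;> norm_num
      _ ≤ _ := by nlinarith [mul_nonneg q1.le hz]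

section Superpose

variable {g : ℝ → ℂ} {σ c : ℝ}

/-- A dominating function for superpositions at positions `|x| ≤ X`. -/
lemma integrable_moment_bound (hg : Integrable g) (hg2 : Integrable fun y : ℝ => (y : ℂ) ^ 2 * g y)
    (c X C : ℝ) : Integrable fun y : ℝ => C * ((1 + 2 * X ^ 2 + 2 * c ^ 2 * y ^ 2) * ‖g y‖) := by
  refine (((hg.norm.const_mul (1 + 2 * X ^ 2)).add (hg2.norm.const_mul (2 * c ^ 2))).congr
    (.of_forall fun y => ?_)).const_mul C
  simp only [Pi.add_apply, norm_mul, norm_pow, Complex.norm_real, Real.norm_eq_abs, sq_abs]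
  ring

lemma one_add_sq_sub_le {x X c y : ℝ} (hx : |x| ≤ X) :
    1 + (x - c * y) ^ 2 ≤ 1 + 2 * X ^ 2 + 2 * c ^ 2 * y ^ 2 := by
  have h1 : x ^ 2 ≤ X ^ 2 := sq_le_sq' (by linarith [(abs_le.1 hx).1]) (abs_le.1 hx).2
  nlinarith [sq_nonneg (x + c * y)]

lemma norm_kernel_mul_le {K : ℂ → ℝ → ℂ} {C x t X : ℝ}
    (hC : ∀ z : ℝ, ‖K (-Complex.I * (σ * t : ℝ)) z‖ ≤ C * (1 + z ^ 2)) (hC0 : 0 ≤ C)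
    (hx : |x| ≤ X) (y : ℝ) :
    ‖K (-Complex.I * (σ * t : ℝ)) (x - c * y) * g y‖ ≤
      C * ((1 + 2 * X ^ 2 + 2 * c ^ 2 * y ^ 2) * ‖g y‖) := by
  rw [norm_mul, ← mul_assoc]
  refine mul_le_mul_of_nonneg_right ((hC _).trans ?_) (norm_nonneg _)
  exact mul_le_mul_of_nonneg_left (one_add_sq_sub_le hx) hC0

lemma continuousAt_superpose {K : ℂ → ℝ → ℂ} (hK : ∀ w, Continuous (K w))
    (hKw : ∀ w ∈ Complex.slitPlane, ∀ z, ContinuousAt (fun p : ℂ × ℝ => K p.1 p.2) (w, z))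
    (hKb : ∀ a > 0, ∃ C, 0 ≤ C ∧ ∀ τ ≥ a, ∀ z : ℝ,
      ‖K (-Complex.I * (τ : ℝ)) z‖ ≤ C * (1 + z ^ 2))
    (hg : Integrable g) (hg2 : Integrable fun y : ℝ => (y : ℂ) ^ 2 * g y) (hσ : 0 < σ) (c x : ℝ)
    {t : ℝ} (ht : 0 < t) :
    ContinuousAt (Function.uncurry (superpose K σ c g)) (x, t) := by
  obtain ⟨C, hC0, hC⟩ := hKb (σ * (t / 2)) (by positivity)
  refine continuousAt_of_dominated (bound := fun y =>
    C * ((1 + 2 * (|x| + 1) ^ 2 + 2 * c ^ 2 * y ^ 2) * ‖g y‖)) ?_ ?_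
    (integrable_moment_bound hg hg2 c _ _) ?_
  · exact .of_forall fun p => ((hK _).comp (by fun_prop)).aestronglyMeasurable.mul
      hg.aestronglyMeasurable
  · have h1 : ∀ᶠ p : ℝ × ℝ in 𝓝 (x, t), |p.1| < |x| + 1 :=
      (continuous_abs.comp continuous_fst).continuousAt.eventually (gt_mem_nhds (by simp))
    have h2 : ∀ᶠ p : ℝ × ℝ in 𝓝 (x, t), t / 2 < p.2 :=
      continuous_snd.continuousAt.eventually (lt_mem_nhds (by simp [ht]))
    filter_upwards [h1, h2] with p hp1 hp2
    refine .of_forall fun y => norm_kernel_mul_le (fun z => hC _ ?_ z) hC0 hp1.le y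
    exact mul_le_mul_of_nonneg_left hp2.le hσ.le
  · refine .of_forall fun y => ContinuousAt.mul ?_ continuousAt_const
    have := continuousAt_kernel hKw hσ 1 (c * y) x ht
    simpa only [one_mul] using this

lemma hasDerivAt_superpose {K K' : ℂ → ℝ → ℂ} (hK' : ∀ w, Continuous (K' w))
    (hKd : ∀ w z, HasDerivAt (K w) (K' w z) z)
    (hKb : ∀ a > 0, ∃ C, 0 ≤ C ∧ ∀ τ ≥ a, ∀ z : ℝ,
      ‖K (-Complex.I * (τ : ℝ)) z‖ ≤ C * (1 + z ^ 2))
    (hKb' : ∀ a > 0, ∃ C, 0 ≤ C ∧ ∀ τ ≥ a, ∀ z : ℝ,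
      ‖K' (-Complex.I * (τ : ℝ)) z‖ ≤ C * (1 + z ^ 2))
    (hg : Integrable g) (hg2 : Integrable fun y : ℝ => (y : ℂ) ^ 2 * g y) (hσ : 0 < σ) (c x : ℝ)
    {t : ℝ} (ht : 0 < t) :
    HasDerivAt (fun x => superpose K σ c g x t) (superpose K' σ c g x t) x := by
  have hτ : 0 < σ * t := by positivity
  obtain ⟨C, hC0, hC⟩ := hKb _ hτ
  obtain ⟨C', hC0', hC'⟩ := hKb' _ hτ
  have hKc : ∀ w, Continuous (K w) := fun w =>
    continuous_iff_continuousAt.2 fun z => (hKd w z).continuousAt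
  have hmeas : ∀ x, AEStronglyMeasurable
      (fun y => K (-Complex.I * (σ * t : ℝ)) (x - c * y) * g y) := fun x =>
    ((hKc _).comp (by fun_prop)).aestronglyMeasurable.mul hg.aestronglyMeasurable
  refine (hasDerivAt_integral_of_dominated_loc_of_deriv_le (s := Metric.ball x 1)
    (F := fun x y => K (-Complex.I * (σ * t : ℝ)) (x - c * y) * g y)
    (F' := fun x y => K' (-Complex.I * (σ * t : ℝ)) (x - c * y) * g y)
    (bound := fun y => C' * ((1 + 2 * (|x| + 1) ^ 2 + 2 * c ^ 2 * y ^ 2) * ‖g y‖))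
    (Metric.ball_mem_nhds _ one_pos) (.of_forall hmeas) ?_ ?_ ?_
    (integrable_moment_bound hg hg2 c _ _) ?_).2
  · exact (integrable_moment_bound hg hg2 c |x| C).mono' (hmeas x)
      (.of_forall fun y => norm_kernel_mul_le (hC _ le_rfl) hC0 le_rfl y)
  · exact ((hK' _).comp (by fun_prop)).aestronglyMeasurable.mul hg.aestronglyMeasurable
  · refine .of_forall fun y u hu => norm_kernel_mul_le (hC' _ le_rfl) hC0' ?_ y
    rw [Metric.mem_ball, Real.dist_eq] at hu
    have := abs_add_le (u - x) x
    rw [sub_add_cancel] at this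
    linarith
  · refine .of_forall fun y u _ => HasDerivAt.mul_const ?_ _
    have h1 : HasDerivAt (fun u : ℝ => u - c * y) 1 u := (hasDerivAt_id u).sub_const _
    have := (hKd (-Complex.I * (σ * t : ℝ)) (u - c * y)).scomp u h1
    rwa [one_smul] at this

lemma hasDerivAt_propagate_time (hg : Integrable g)
    (hg2 : Integrable fun y : ℝ => (y : ℂ) ^ 2 * g y) (hσ : 0 < σ) (c x : ℝ)
    {t : ℝ} (ht : 0 < t) :
    HasDerivAt (fun s => superpose heatKernel σ c g x s)
      (-Complex.I * σ * superpose heatKernel₂ σ c g x t) t := by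
  obtain ⟨C, hC0, hC⟩ := exists_norm_kernel_le (a := σ * (t / 2)) (by positivity)
  have hmeas : ∀ s, AEStronglyMeasurable
      (fun y => heatKernel (-Complex.I * (σ * s : ℝ)) (x - c * y) * g y) := fun s =>
    ((continuous_heatKernel _).comp (by fun_prop)).aestronglyMeasurable.mul hg.aestronglyMeasurable
  have hle : ∀ s ∈ Metric.ball t (t / 2), σ * (t / 2) ≤ σ * s := by
    intro s hs
    rw [Metric.mem_ball, Real.dist_eq, abs_lt] at hs
    exact mul_le_mul_of_nonneg_left (by linarith) hσ.le
  have ht2 : 0 < t / 2 := by positivity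
  refine ((hasDerivAt_integral_of_dominated_loc_of_deriv_le (s := Metric.ball t (t / 2))
    (F := fun s y => heatKernel (-Complex.I * (σ * s : ℝ)) (x - c * y) * g y)
    (F' := fun s y => heatKernel₂ (-Complex.I * (σ * s : ℝ)) (x - c * y) * g y *
      (-Complex.I * σ))
    (bound := fun y => C * ((1 + 2 * |x| ^ 2 + 2 * c ^ 2 * y ^ 2) * ‖g y‖) * σ)
    (Metric.ball_mem_nhds _ ht2) (.of_forall hmeas) ?_ ?_ ?_
    ((integrable_moment_bound hg hg2 c _ _).mul_const σ) ?_).2).congr_deriv ?_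
  · exact (integrable_moment_bound hg hg2 c |x| C).mono' (hmeas t) (.of_forall fun y =>
      norm_kernel_mul_le (fun z => (hC _ (hle t (Metric.mem_ball_self ht2)) z).1) hC0 le_rfl y)
  · exact (((continuous_heatKernel₂ _).comp (by fun_prop)).aestronglyMeasurable.mul
      hg.aestronglyMeasurable).mul_const _
  · refine .of_forall fun y s hs => ?_
    rw [norm_mul, norm_mul (-Complex.I), norm_neg, Complex.norm_I, one_mul, Complex.norm_real,
      Real.norm_of_nonneg hσ.le]
    exact mul_le_mul_of_nonneg_right
      (norm_kernel_mul_le (fun z => (hC _ (hle s hs) z).2.2) hC0 le_rfl y) hσ.le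
  · refine .of_forall fun y s hs => ?_
    have hs0 : 0 < σ * s := lt_of_lt_of_le (by positivity) (hle s hs)
    have h1 : HasDerivAt (fun s : ℝ => -Complex.I * ((σ * s : ℝ) : ℂ)) (-Complex.I * σ) s := by
      have := (((hasDerivAt_id s).const_mul σ).ofReal_comp).const_mul (-Complex.I)
      simpa using this
    have := (HasDerivAt.comp s (hasDerivAt_heatKernel_time
      (schrodingerTime_mem_slitPlane hs0) (x - c * y)) h1).mul_const (g y)
    refine this.congr_deriv ?_
    ring
  · rw [integral_mul_const, mul_comm]
    rfl

/-- Superpositions with two moments solve the Schrödinger equation in the classical sense. -/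
lemma isFlow_propagate (hg : Integrable g) (hg2 : Integrable fun y : ℝ => (y : ℂ) ^ 2 * g y)
    (hσ : 0 < σ) (c : ℝ) :
    IsFlow σ (propagate σ c g) (superpose heatKernel₁ σ c g) (superpose heatKernel₂ σ c g) := by
  have b0 : ∀ a > 0, ∃ C, 0 ≤ C ∧ ∀ τ ≥ a, ∀ z : ℝ,
      ‖heatKernel (-Complex.I * (τ : ℝ)) z‖ ≤ C * (1 + z ^ 2) := fun a ha => by
    obtain ⟨C, hC0, hC⟩ := exists_norm_kernel_le ha
    exact ⟨C, hC0, fun τ hτ z => (hC τ hτ z).1⟩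
  have b1 : ∀ a > 0, ∃ C, 0 ≤ C ∧ ∀ τ ≥ a, ∀ z : ℝ,
      ‖heatKernel₁ (-Complex.I * (τ : ℝ)) z‖ ≤ C * (1 + z ^ 2) := fun a ha => by
    obtain ⟨C, hC0, hC⟩ := exists_norm_kernel_le ha
    exact ⟨C, hC0, fun τ hτ z => (hC τ hτ z).2.1⟩
  have b2 : ∀ a > 0, ∃ C, 0 ≤ C ∧ ∀ τ ≥ a, ∀ z : ℝ,
      ‖heatKernel₂ (-Complex.I * (τ : ℝ)) z‖ ≤ C * (1 + z ^ 2) := fun a ha => by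
    obtain ⟨C, hC0, hC⟩ := exists_norm_kernel_le ha
    exact ⟨C, hC0, fun τ hτ z => (hC τ hτ z).2.2⟩
  exact ⟨fun x t ht => hasDerivAt_superpose continuous_heatKernel₁ hasDerivAt_heatKernel b0 b1
      hg hg2 hσ c x ht,
    fun x t ht => hasDerivAt_superpose continuous_heatKernel₂ hasDerivAt_heatKernel₁ b1 b2
      hg hg2 hσ c x ht,
    fun x t ht => hasDerivAt_propagate_time hg hg2 hσ c x ht,
    fun x t ht => continuousAt_superpose continuous_heatKernel
      (fun w hw z => continuousAt_heatKernel hw z) b0 hg hg2 hσ c x ht,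
    fun x t ht => continuousAt_superpose continuous_heatKernel₁
      (fun w hw z => continuousAt_heatKernel₁ hw z) b1 hg hg2 hσ c x ht,
    fun x t ht => continuousAt_superpose continuous_heatKernel₂
      (fun w hw z => continuousAt_heatKernel₂ hw z) b2 hg hg2 hσ c x ht⟩

end Superpose

/-- Superpositions of Schrödinger kernels vanish at spatial infinity: completing the square turns
them into Fourier transforms. -/
lemma tendsto_propagate_cocompact {σ c t : ℝ} (hτ : 0 < σ * t) (hc : c ≠ 0) (g : ℝ → ℂ) :
    Tendsto (fun x => propagate σ c g x t) (cocompact ℝ) (𝓝 0) := by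
  set f : ℝ → ℂ := fun y => Complex.exp (-Complex.I * ((c * y : ℝ) : ℂ) ^ 2 / (4 * (σ * t : ℝ))) *
    g y
  set A : ℂ := Complex.exp (Complex.I * Real.pi / 4) / (Real.sqrt (4 * Real.pi * (σ * t)) : ℂ)
  have hτ' : ((σ * t : ℝ) : ℂ) ≠ 0 := by exact_mod_cast hτ.ne'
  have hb : c / (2 * (σ * t)) ≠ 0 := div_ne_zero hc (by positivity)
  have h1 : Tendsto (fun x : ℝ => c / (2 * (σ * t)) * x) (cocompact ℝ) (cocompact ℝ) :=
    (Homeomorph.mulLeft₀ _ hb).isClosedEmbedding.tendsto_cocompact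
  have h2 := ((tendsto_integral_exp_I_mul f le_rfl).comp h1).norm.const_mul ‖A‖
  rw [norm_zero, mul_zero] at h2
  rw [tendsto_zero_iff_norm_tendsto_zero]
  refine h2.congr fun x => ?_
  have h3 : propagate σ c g x t = (A * Complex.exp (-Complex.I * (x : ℂ) ^ 2 / (4 * (σ * t : ℝ)))) *
      ∫ y : ℝ, Complex.exp (Complex.I * (c / (2 * (σ * t)) * x : ℝ) * y) * f y := by
    rw [propagate, ← integral_const_mul]
    refine integral_congr_ae (.of_forall fun y => ?_)
    simp only [f]
    have h4 : Complex.exp (-Complex.I * ((x - c * y : ℝ) : ℂ) ^ 2 / (4 * (σ * t : ℝ))) =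
        Complex.exp (-Complex.I * (x : ℂ) ^ 2 / (4 * (σ * t : ℝ))) *
          Complex.exp (Complex.I * (c / (2 * (σ * t)) * x : ℝ) * y) *
          Complex.exp (-Complex.I * ((c * y : ℝ) : ℂ) ^ 2 / (4 * (σ * t : ℝ))) := by
      rw [← Complex.exp_add, ← Complex.exp_add]
      congr 1
      push_cast at hτ' ⊢
      have hs : (σ : ℂ) ≠ 0 := left_ne_zero_of_mul hτ'
      have ht : (t : ℂ) ≠ 0 := right_ne_zero_of_mul hτ'
      field_simp
      ring
    rw [heatKernel_neg_I_mul hτ, h4]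
    ring
  rw [h3, norm_mul, norm_mul A, norm_exp_neg_I_mul_sq_div, mul_one]
  rfl

/-! ### Behaviour near time zero -/

lemma propagate_comp_neg (σ c : ℝ) (g : ℝ → ℂ) (x t : ℝ) :
    propagate σ c (fun y => g (-y)) x t = propagate σ c g (-x) t := by
  rw [propagate, propagate, ← integral_neg_eq_self]
  refine integral_congr_ae (.of_forall fun y => ?_)
  simp only [neg_neg]
  rw [← heatKernel_neg]
  congr 2
  ring

/-- Data `v` on the positive half-line, with derivative `v'`, for which the superpositions of
kernels are solutions that take the initial values. -/
structure IsRegularProfile (v v' : ℝ → ℂ) : Prop where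
  hasDerivAt : ∀ y > 0, HasDerivAt v (v' y) y
  integrable : IntegrableOn v (Ioi 0)
  integrable_deriv : IntegrableOn v' (Ioi 0)
  integrable_moment : IntegrableOn (fun y : ℝ => (y : ℂ) ^ 2 * v y) (Ioi 0)

namespace IsRegularProfile

variable {v v' : ℝ → ℂ}

lemma integrable_indicator (h : IsRegularProfile v v') :
    Integrable ((Ioi (0 : ℝ)).indicator v) :=
  (integrable_indicator_iff measurableSet_Ioi).2 h.integrable

lemma integrable_moment_indicator (h : IsRegularProfile v v') :
    Integrable fun y : ℝ => (y : ℂ) ^ 2 * (Ioi (0 : ℝ)).indicator v y := by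
  have := (integrable_indicator_iff measurableSet_Ioi).2 h.integrable_moment
  refine this.congr (.of_forall fun y => ?_)
  simp only [indicator]
  split_ifs <;> simp

lemma tendsto_zero (h : IsRegularProfile v v') : Tendsto v atTop (𝓝 0) :=
  tendsto_zero_of_hasDerivAt_of_integrableOn_Ioi (fun y hy => h.hasDerivAt y hy)
    h.integrable_deriv h.integrable

lemma integral_deriv (h : IsRegularProfile v v') {y : ℝ} (hy : 0 < y) :
    ∫ u in Ioi y, v' u = -v y := by
  have := integral_Ioi_of_hasDerivAt_of_tendsto' (a := y) (f := v) (f' := v')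
    (fun u hu => h.hasDerivAt u (hy.trans_le hu))
    (h.integrable_deriv.mono_set (Ioi_subset_Ioi hy.le)) h.tendsto_zero
  rw [this, zero_sub]

lemma norm_le (h : IsRegularProfile v v') {y : ℝ} (hy : 0 < y) :
    ‖v y‖ ≤ ∫ u in Ioi (0 : ℝ), ‖v' u‖ := by
  rw [← norm_neg, ← h.integral_deriv hy]
  refine (norm_integral_le_integral_norm _).trans ?_
  exact setIntegral_mono_set h.integrable_deriv.norm (.of_forall fun _ => norm_nonneg _)
    (Ioi_subset_Ioi hy.le).eventuallyLE

/-- Integration by parts: the superposition is an integral of bounded kernels against the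
derivative of the data. -/
lemma propagate_eq (h : IsRegularProfile v v') {σ t c : ℝ} (hσ : 0 < σ) (ht : 0 < t) (hc : c ≠ 0)
    (x : ℝ) :
    propagate σ c ((Ioi (0 : ℝ)).indicator v) x t =
      ∫ y in Ioi (0 : ℝ), v' y * ((erfFlow σ (x - c * y) t - erfFlow σ x t) / (2 * c)) := by
  obtain ⟨B, hB0, hB⟩ := exists_norm_erfFlow_le σ
  have hc' : (c : ℂ) ≠ 0 := by exact_mod_cast hc
  set w : ℝ → ℂ := fun y => -((erfFlow σ (x - c * y) t - erfFlow σ x t) / (2 * c)) with hw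
  have hflow := isFlow_erfFlow hσ
  have hwd : ∀ y, HasDerivAt w (heatKernel (-Complex.I * (σ * t : ℝ)) (x - c * y)) y := by
    intro y
    have h1 : HasDerivAt (fun y : ℝ => x - c * y) (-c) y := by
      simpa using ((hasDerivAt_id y).const_mul c).const_sub x
    have h2 := (hflow.hasDerivAt_x (x - c * y) t ht).scomp y h1
    refine (((h2.sub_const (erfFlow σ x t)).div_const (2 * c : ℂ)).neg).congr_deriv ?_
    rw [Complex.real_smul]
    push_cast
    field_simp
  have hwc : Continuous w := continuous_iff_continuousAt.2 fun y => (hwd y).continuousAt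
  have hwB : ∀ y, ‖w y‖ ≤ (B + B) / (2 * |c|) := by
    intro y
    rw [hw, norm_neg, norm_div, norm_mul, Complex.norm_ofNat, Complex.norm_real, Real.norm_eq_abs]
    exact div_le_div_of_nonneg_right ((norm_sub_le _ _).trans (add_le_add (hB _ _) (hB _ _)))
      (by positivity)
  have hw0 : w 0 = 0 := by simp [hw]
  obtain ⟨M, hM⟩ : ∃ M, ∀ z : ℝ, ‖heatKernel (-Complex.I * (σ * t : ℝ)) z‖ ≤ M :=
    ⟨_, norm_heatKernel_le (Complex.slitPlane_ne_zero (schrodingerTime_mem_slitPlane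
      (by positivity : 0 < σ * t))) (by simp)⟩
  have hpart := integral_Ioi_mul_deriv_eq_deriv_mul (a := (0 : ℝ)) (a' := 0) (b' := 0)
    (u := v) (v := w) (u' := v')
    (v' := fun y => heatKernel (-Complex.I * (σ * t : ℝ)) (x - c * y))
    (fun y hy => h.hasDerivAt y hy) (fun y _ => hwd y) ?_ ?_ ?_ ?_
  · rw [propagate]
    calc _ = ∫ y in Ioi (0 : ℝ), v y * heatKernel (-Complex.I * (σ * t : ℝ)) (x - c * y) := by
          rw [← integral_indicator measurableSet_Ioi]
          refine integral_congr_ae (.of_forall fun y => ?_)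
          simp only [indicator]
          split_ifs
          · ring
          · simp
      _ = _ := by
          rw [hpart, sub_zero, zero_sub, ← integral_neg]
          refine integral_congr_ae (.of_forall fun y => ?_)
          simp only [hw]
          ring
  · refine (h.integrable.norm.mul_const M).mono' (h.integrable.aestronglyMeasurable.mul
      ((continuous_heatKernel _).comp (by fun_prop)).aestronglyMeasurable)
      (.of_forall fun y => ?_)
    rw [Pi.mul_apply, norm_mul]
    exact mul_le_mul_of_nonneg_left (hM _) (norm_nonneg _)
  · refine (h.integrable_deriv.norm.mul_const ((B + B) / (2 * |c|))).mono'
      (h.integrable_deriv.aestronglyMeasurable.mul hwc.aestronglyMeasurable)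
      (.of_forall fun y => ?_)
    rw [Pi.mul_apply, norm_mul]
    exact mul_le_mul_of_nonneg_left (hwB _) (norm_nonneg _)
  · have h1 : Tendsto (fun y => (∫ u in Ioi (0 : ℝ), ‖v' u‖) * ‖w y‖) (𝓝[>] 0) (𝓝 0) := by
      have := (hwc.tendsto 0).norm.const_mul (∫ u in Ioi (0 : ℝ), ‖v' u‖)
      rw [hw0, norm_zero, mul_zero] at this
      exact this.mono_left nhdsWithin_le_nhds
    refine squeeze_zero_norm' ?_ h1
    refine eventually_nhdsWithin_of_forall fun y hy => ?_
    rw [Pi.mul_apply, norm_mul]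
    exact mul_le_mul_of_nonneg_right (h.norm_le hy) (norm_nonneg _)
  · have h1 : Tendsto (fun y => ‖v y‖ * ((B + B) / (2 * |c|))) atTop (𝓝 0) := by
      have := h.tendsto_zero.norm.mul_const ((B + B) / (2 * |c|))
      rwa [norm_zero, zero_mul] at this
    refine squeeze_zero_norm (fun y => ?_) h1
    rw [Pi.mul_apply, norm_mul]
    exact mul_le_mul_of_nonneg_left (hwB _) (norm_nonneg _)

lemma exists_norm_propagate_le (h : IsRegularProfile v v') {σ c : ℝ} (hσ : 0 < σ) (hc : c ≠ 0) :
    ∃ B, ∀ x, ∀ t > 0, ‖propagate σ c ((Ioi (0 : ℝ)).indicator v) x t‖ ≤ B := by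
  obtain ⟨B, hB0, hB⟩ := exists_norm_erfFlow_le σ
  refine ⟨∫ y in Ioi (0 : ℝ), ‖v' y‖ * ((B + B) / (2 * |c|)), fun x t ht => ?_⟩
  rw [h.propagate_eq hσ ht hc]
  refine norm_integral_le_of_norm_le (h.integrable_deriv.norm.mul_const _)
    (.of_forall fun y => ?_)
  rw [norm_mul]
  refine mul_le_mul_of_nonneg_left ?_ (norm_nonneg _)
  rw [norm_div, norm_mul, Complex.norm_ofNat, Complex.norm_real, Real.norm_eq_abs]
  exact div_le_div_of_nonneg_right ((norm_sub_le _ _).trans (add_le_add (hB _ _) (hB _ _)))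
    (by positivity)

lemma tendsto_propagate (h : IsRegularProfile v v') {σ c : ℝ} (hσ : 0 < σ) (hc : c ≠ 0) (x : ℝ) :
    Tendsto (fun t => propagate σ c ((Ioi (0 : ℝ)).indicator v) x t) (𝓝[>] 0)
      (𝓝 (∫ y in Ioi (0 : ℝ),
        v' y * (((Real.sign (x - c * y) : ℂ) - (Real.sign x : ℂ)) / (2 * c)))) := by
  obtain ⟨B, hB0, hB⟩ := exists_norm_erfFlow_le σ
  have hlim : Tendsto (fun t => ∫ y in Ioi (0 : ℝ),
      v' y * ((erfFlow σ (x - c * y) t - erfFlow σ x t) / (2 * c))) (𝓝[>] 0)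
      (𝓝 (∫ y in Ioi (0 : ℝ),
        v' y * (((Real.sign (x - c * y) : ℂ) - (Real.sign x : ℂ)) / (2 * c)))) := by
    refine tendsto_integral_filter_of_dominated_convergence
      (fun y => ‖v' y‖ * ((B + B) / (2 * |c|))) ?_ ?_ (h.integrable_deriv.norm.mul_const _) ?_
    · refine .of_forall fun t => h.integrable_deriv.aestronglyMeasurable.mul
        (Continuous.aestronglyMeasurable ?_)
      have : Continuous fun x => erfFlow σ x t :=
        ((continuous_fresnel (-1)).comp (by fun_prop)).const_mul _
      have h1 : Continuous fun y => erfFlow σ (x - c * y) t := this.comp (by fun_prop)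
      fun_prop
    · refine .of_forall fun t => .of_forall fun y => ?_
      rw [norm_mul]
      refine mul_le_mul_of_nonneg_left ?_ (norm_nonneg _)
      rw [norm_div, norm_mul, Complex.norm_ofNat, Complex.norm_real, Real.norm_eq_abs]
      exact div_le_div_of_nonneg_right ((norm_sub_le _ _).trans (add_le_add (hB _ _) (hB _ _)))
        (by positivity)
    · exact .of_forall fun y => (((tendsto_erfFlow_zero hσ _).sub
        (tendsto_erfFlow_zero hσ _)).div_const _).const_mul _
  refine hlim.congr' ?_
  exact eventually_nhdsWithin_of_forall fun t ht => (h.propagate_eq hσ ht hc x).symm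

lemma tendsto_propagate_self (h : IsRegularProfile v v') {σ : ℝ} (hσ : 0 < σ) {x : ℝ}
    (hx : 0 < x) :
    Tendsto (fun t => propagate σ 1 ((Ioi (0 : ℝ)).indicator v) x t) (𝓝[>] 0) (𝓝 (v x)) := by
  have h1 := h.tendsto_propagate hσ one_ne_zero x
  have h2 : (∫ y in Ioi (0 : ℝ),
      v' y * (((Real.sign (x - 1 * y) : ℂ) - (Real.sign x : ℂ)) / (2 * (1 : ℝ)))) = v x := by
    rw [← neg_neg (v x), ← h.integral_deriv hx, ← integral_neg,
      ← integral_indicator measurableSet_Ioi, ← integral_indicator measurableSet_Ioi]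
    have hne : ∀ᵐ y : ℝ, y ≠ x := by simp [ae_iff]
    refine integral_congr_ae (hne.mono fun y hy => ?_)
    simp only [indicator, mem_Ioi]
    rcases lt_or_gt_of_ne hy with hlt | hgt
    · rw [Real.sign_of_pos hx, Real.sign_of_pos (by linarith), if_neg (not_lt.2 hlt.le)]
      simp
    · rw [Real.sign_of_pos hx, Real.sign_of_neg (by linarith), if_pos hgt,
        if_pos (hx.trans hgt)]
      push_cast
      ring
  rwa [h2] at h1

lemma tendsto_propagate_of_neg (h : IsRegularProfile v v') {σ c : ℝ} (hσ : 0 < σ) {x : ℝ}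
    (hcx : c * x < 0) :
    Tendsto (fun t => propagate σ c ((Ioi (0 : ℝ)).indicator v) x t) (𝓝[>] 0) (𝓝 0) := by
  have hc : c ≠ 0 := by rintro rfl; simp at hcx
  have h1 := h.tendsto_propagate hσ hc x
  have h2 : (∫ y in Ioi (0 : ℝ),
      v' y * (((Real.sign (x - c * y) : ℂ) - (Real.sign x : ℂ)) / (2 * c))) = 0 := by
    refine setIntegral_eq_zero_of_forall_eq_zero fun y hy => ?_
    have hy' : (0 : ℝ) < y := hy
    have hs : Real.sign (x - c * y) = Real.sign x := by
      rcases lt_trichotomy x 0 with hx | rfl | hx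
      · have : 0 < c := pos_of_mul_neg_left hcx hx.le
        rw [Real.sign_of_neg hx, Real.sign_of_neg (by nlinarith)]
      · simp at hcx
      · have : c < 0 := by
          by_contra hc'
          push Not at hc'
          nlinarith
        rw [Real.sign_of_pos hx, Real.sign_of_pos (by nlinarith)]
    simp [hs]
  rwa [h2] at h1

end IsRegularProfile

lemma IsRegularDatum.right_profile {γ : ℂ} {q0 : ℝ → ℂ} (h : IsRegularDatum (Ioi 0) γ q0)
    (hv : IntegrableOn (fun x => q0 x - γ) (Ioi 0)) :
    IsRegularProfile (fun x => q0 x - γ) (deriv q0) where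
  hasDerivAt y hy := by
    have := (h.contDiffOn.differentiableOn (by norm_num)).differentiableAt (Ioi_mem_nhds hy)
    exact this.hasDerivAt.sub_const γ
  integrable := hv
  integrable_deriv := h.integrable_deriv
  integrable_moment := h.integrable_moment

lemma integrableOn_Ioi_comp_neg {f : ℝ → ℂ} (hf : IntegrableOn f (Iio 0)) :
    IntegrableOn (fun y => f (-y)) (Ioi 0) := by
  rw [← integrable_indicator_iff measurableSet_Ioi]
  refine ((integrable_indicator_iff measurableSet_Iio).2 hf).comp_neg.congr
    (.of_forall fun y => ?_)
  simp [indicator]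

lemma IsRegularDatum.left_profile {γ : ℂ} {q0 : ℝ → ℂ} (h : IsRegularDatum (Iio 0) γ q0)
    (hv : IntegrableOn (fun x => q0 x - γ) (Iio 0)) :
    IsRegularProfile (fun x => q0 (-x) - γ) (fun x => -deriv q0 (-x)) where
  hasDerivAt y hy := by
    have := (h.contDiffOn.differentiableOn (by norm_num)).differentiableAt
      (Iio_mem_nhds (show -y < 0 by linarith))
    have h2 := (this.hasDerivAt.scomp y (hasDerivAt_neg y)).sub_const γ
    refine h2.congr_deriv ?_
    simp
  integrable := integrableOn_Ioi_comp_neg hv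
  integrable_deriv := (integrableOn_Ioi_comp_neg h.integrable_deriv).neg
  integrable_moment := by
    refine (integrableOn_Ioi_comp_neg h.integrable_moment).congr_fun (fun y _ => ?_)
      measurableSet_Ioi
    simp

/-- Bounded functions have polynomial growth in mean square. -/
lemma hasTemperedGrowthOn_of_bounded {S : Set ℝ} (hS : MeasurableSet S) {q : ℝ → ℝ → ℂ} {B : ℝ}
    (hB : ∀ x ∈ S, ∀ t > 0, ‖q x t‖ ≤ B) : HasTemperedGrowthOn S q := by
  intro T _
  have hint : Integrable fun x : ℝ => B ^ 2 / (1 + |x|) ^ 2 := by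
    have := (integrable_one_add_norm (E := ℝ) (μ := volume) (r := 2) (by simp)).const_mul (B ^ 2)
    refine this.congr (.of_forall fun x => ?_)
    simp only [Real.norm_eq_abs]
    rw [Real.rpow_neg (by positivity), div_eq_mul_inv]
    norm_num
  refine ⟨2, ∫ x : ℝ, B ^ 2 / (1 + |x|) ^ 2, fun t ht => ?_⟩
  rw [ofReal_integral_eq_lintegral_ofReal hint (.of_forall fun x => by positivity)]
  calc _ ≤ ∫⁻ x in S, ENNReal.ofReal (B ^ 2 / (1 + |x|) ^ 2) := by
        refine setLIntegral_mono' hS fun x hx => ENNReal.ofReal_le_ofReal ?_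
        have := hB x hx t ht.1
        gcongr
    _ ≤ _ := setLIntegral_le_lintegral _ _

/-! ### The formulas as superpositions of kernels -/

lemma heatKernel_scale {r τ : ℝ} (hr : 0 < r) (hτ : 0 < τ) (z : ℝ) :
    heatKernel (-Complex.I * (r ^ 2 * τ : ℝ)) (r * z) =
      (r : ℂ)⁻¹ * heatKernel (-Complex.I * (τ : ℝ)) z := by
  have hr' : (r : ℂ) ≠ 0 := by exact_mod_cast hr.ne'
  have hτ' : (τ : ℂ) ≠ 0 := by exact_mod_cast hτ.ne'
  have h1 : Real.sqrt (4 * Real.pi * (r ^ 2 * τ)) = r * Real.sqrt (4 * Real.pi * τ) := by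
    rw [show 4 * Real.pi * (r ^ 2 * τ) = r ^ 2 * (4 * Real.pi * τ) by ring,
      Real.sqrt_mul (by positivity), Real.sqrt_sq hr.le]
  rw [heatKernel_neg_I_mul (by positivity), heatKernel_neg_I_mul hτ, h1]
  have h2 : -Complex.I * ((r * z : ℝ) : ℂ) ^ 2 / (4 * (r ^ 2 * τ : ℝ)) =
      -Complex.I * (z : ℂ) ^ 2 / (4 * τ) := by
    push_cast
    field_simp
  rw [h2]
  push_cast
  rw [div_eq_mul_inv, mul_inv]
  ring

lemma heatKernel₁_scale {r τ : ℝ} (hr : 0 < r) (hτ : 0 < τ) (z : ℝ) :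
    heatKernel₁ (-Complex.I * (r ^ 2 * τ : ℝ)) (r * z) =
      ((r : ℂ)⁻¹) ^ 2 * heatKernel₁ (-Complex.I * (τ : ℝ)) z := by
  have hr' : (r : ℂ) ≠ 0 := by exact_mod_cast hr.ne'
  have hτ' : (τ : ℂ) ≠ 0 := by exact_mod_cast hτ.ne'
  rw [heatKernel₁, heatKernel₁, heatKernel_scale hr hτ]
  push_cast
  field_simp

/-- The value of the solution on the left half-line, in terms of Schrödinger kernels: the free
evolution, its reflection at the interface, and the transmitted part. -/
def leftFlow (σL σR : ℝ) (βL βR γL γR : ℂ) (gL gR : ℝ → ℂ) (x t : ℝ) : ℂ :=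
  γL + βR * Real.sqrt σL * (γR - γL) / (βR * Real.sqrt σL + βL * Real.sqrt σR) *
      (1 + erfFlow σL x t)
    + propagate σL 1 gL x t
    + -((βR * Real.sqrt σL - βL * Real.sqrt σR) / (βR * Real.sqrt σL + βL * Real.sqrt σR)) *
      propagate σL (-1) gL x t
    + 2 * βR * Real.sqrt σL ^ 2 / (Real.sqrt σR * (βR * Real.sqrt σL + βL * Real.sqrt σR)) *
      propagate σL (Real.sqrt (σL / σR)) gR x t

/-- The value of the solution on the right half-line, in terms of Schrödinger kernels. -/
def rightFlow (σL σR : ℝ) (βL βR γL γR : ℂ) (gL gR : ℝ → ℂ) (x t : ℝ) : ℂ :=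
  γR + βL * Real.sqrt σR * (γR - γL) / (βR * Real.sqrt σL + βL * Real.sqrt σR) *
      (-1 + erfFlow σR x t)
    + propagate σR 1 gR x t
    + (βR * Real.sqrt σL - βL * Real.sqrt σR) / (βR * Real.sqrt σL + βL * Real.sqrt σR) *
      propagate σR (-1) gR x t
    + 2 * βL * Real.sqrt σR ^ 2 / (Real.sqrt σL * (βR * Real.sqrt σL + βL * Real.sqrt σR)) *
      propagate σR (Real.sqrt (σR / σL)) gL x t

lemma hatL_mul (v : ℝ → ℂ) (c : ℝ) (k : ℂ) :
    hatL v (k * c) = dilatedFourier c ((Iio (0 : ℝ)).indicator v) k := by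
  rw [hatL, dilatedFourier, ← integral_indicator measurableSet_Iio]
  refine integral_congr_ae (.of_forall fun y => ?_)
  simp only [indicator]
  split_ifs
  · congr 2; ring
  · simp

lemma hatR_mul (v : ℝ → ℂ) (c : ℝ) (k : ℂ) :
    hatR v (k * c) = dilatedFourier c ((Ioi (0 : ℝ)).indicator v) k := by
  rw [hatR, dilatedFourier, ← integral_indicator measurableSet_Ioi]
  refine integral_congr_ae (.of_forall fun y => ?_)
  simp only [indicator]
  split_ifs
  · congr 2; ring
  · simp

lemma hatL_eq (v : ℝ → ℂ) :
    (fun k => hatL v k) = dilatedFourier 1 ((Iio (0 : ℝ)).indicator v) := by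
  funext k; rw [← hatL_mul]; simp

lemma hatR_eq (v : ℝ → ℂ) :
    (fun k => hatR v k) = dilatedFourier 1 ((Ioi (0 : ℝ)).indicator v) := by
  funext k; rw [← hatR_mul]; simp

lemma hatL_neg_eq (v : ℝ → ℂ) :
    (fun k => hatL v (-k)) = dilatedFourier (-1) ((Iio (0 : ℝ)).indicator v) := by
  funext k; rw [← hatL_mul]; simp

lemma hatR_neg_eq (v : ℝ → ℂ) :
    (fun k => hatR v (-k)) = dilatedFourier (-1) ((Ioi (0 : ℝ)).indicator v) := by
  funext k; rw [← hatR_mul]; simp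

lemma hatL_mul_eq (v : ℝ → ℂ) (c : ℝ) :
    (fun k => hatL v (k * c)) = dilatedFourier c ((Iio (0 : ℝ)).indicator v) := by
  funext k; rw [hatL_mul]

lemma hatR_mul_eq (v : ℝ → ℂ) (c : ℝ) :
    (fun k => hatR v (k * c)) = dilatedFourier c ((Ioi (0 : ℝ)).indicator v) := by
  funext k; rw [hatR_mul]

lemma nonneg_of_indicator_Ioi {v : ℝ → ℂ} {c : ℝ} (hc : 0 ≤ c) (y : ℝ)
    (hy : (Ioi (0 : ℝ)).indicator v y ≠ 0) : 0 ≤ c * y := by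
  have : (0 : ℝ) < y := mem_of_indicator_ne_zero hy
  positivity

lemma nonpos_of_indicator_Ioi {v : ℝ → ℂ} {c : ℝ} (hc : c ≤ 0) (y : ℝ)
    (hy : (Ioi (0 : ℝ)).indicator v y ≠ 0) : c * y ≤ 0 := by
  have : (0 : ℝ) < y := mem_of_indicator_ne_zero hy
  exact mul_nonpos_of_nonpos_of_nonneg hc this.le

lemma nonneg_of_indicator_Iio {v : ℝ → ℂ} {c : ℝ} (hc : c ≤ 0) (y : ℝ)
    (hy : (Iio (0 : ℝ)).indicator v y ≠ 0) : 0 ≤ c * y := by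
  have : y < (0 : ℝ) := mem_Iio.1 (mem_of_indicator_ne_zero hy)
  exact mul_nonneg_of_nonpos_of_nonpos hc this.le

lemma nonpos_of_indicator_Iio {v : ℝ → ℂ} {c : ℝ} (hc : 0 ≤ c) (y : ℝ)
    (hy : (Iio (0 : ℝ)).indicator v y ≠ 0) : c * y ≤ 0 := by
  have : y < (0 : ℝ) := mem_Iio.1 (mem_of_indicator_ne_zero hy)
  exact mul_nonpos_of_nonneg_of_nonpos hc this.le

section Formulas

variable {σL σR : ℝ} {βL βR γL γR : ℂ} {vL vR : ℝ → ℂ} {x t : ℝ}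

lemma leftIntegralsConverge_of_pos (hσL : 0 < σL) (hL : IntegrableOn vL (Iio 0))
    (hR : IntegrableOn vR (Ioi 0)) (hx : x < 0) (ht : 0 < t) :
    LeftIntegralsConverge σL σR vL vR x t := by
  have hL' := (integrable_indicator_iff measurableSet_Iio).2 hL
  have hR' := (integrable_indicator_iff measurableSet_Ioi).2 hR
  have hτ : 0 < σL * t := by positivity
  rw [LeftIntegralsConverge, hatL_eq, hatL_neg_eq, hatR_mul_eq]
  exact ⟨lineConverges_of_pos hL' hτ _ _,
    dMinusConverges_of_pos hL' hτ hx (nonneg_of_indicator_Iio (by norm_num)),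
    dMinusConverges_of_pos hR' hτ hx (nonneg_of_indicator_Ioi (Real.sqrt_nonneg _))⟩

lemma rightIntegralsConverge_of_pos (hσR : 0 < σR) (hL : IntegrableOn vL (Iio 0))
    (hR : IntegrableOn vR (Ioi 0)) (hx : 0 < x) (ht : 0 < t) :
    RightIntegralsConverge σL σR vL vR x t := by
  have hL' := (integrable_indicator_iff measurableSet_Iio).2 hL
  have hR' := (integrable_indicator_iff measurableSet_Ioi).2 hR
  have hτ : 0 < σR * t := by positivity
  rw [RightIntegralsConverge, hatR_eq, hatR_neg_eq, hatL_mul_eq]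
  exact ⟨lineConverges_of_pos hR' hτ _ _,
    dPlusConverges_of_pos hL' hτ hx (nonpos_of_indicator_Iio (Real.sqrt_nonneg _)),
    dPlusConverges_of_pos hR' hτ hx (nonpos_of_indicator_Ioi (by norm_num))⟩

lemma formulaL_of_pos (hσL : 0 < σL) (hσR : 0 < σR)
    (hβ : βR * Real.sqrt σL + βL * Real.sqrt σR ≠ 0) (hL : IntegrableOn vL (Iio 0))
    (hR : IntegrableOn vR (Ioi 0)) (hx : x < 0) (ht : 0 < t) :
    formulaL σL σR βL βR γL γR vL vR x t =
      leftFlow σL σR βL βR γL γR ((Iio (0 : ℝ)).indicator vL) ((Ioi (0 : ℝ)).indicator vR) x t := by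
  have hL' := (integrable_indicator_iff measurableSet_Iio).2 hL
  have hR' := (integrable_indicator_iff measurableSet_Ioi).2 hR
  have hτ : 0 < σL * t := by positivity
  have hpi : (Real.pi : ℂ) ≠ 0 := by exact_mod_cast Real.pi_ne_zero
  have hsL : (Real.sqrt σL : ℂ) ≠ 0 := by exact_mod_cast (Real.sqrt_pos.2 hσL).ne'
  have hsR : (Real.sqrt σR : ℂ) ≠ 0 := by exact_mod_cast (Real.sqrt_pos.2 hσR).ne'
  have eL : (σL : ℂ) = (Real.sqrt σL : ℂ) ^ 2 := by exact_mod_cast (Real.sq_sqrt hσL.le).symm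
  have eR : (σR : ℂ) = (Real.sqrt σR : ℂ) ^ 2 := by exact_mod_cast (Real.sq_sqrt hσR.le).symm
  rw [formulaL, hatL_eq, hatL_neg_eq, hatR_mul_eq, lineIntegral_of_pos hL' hτ,
    dMinusIntegral_of_pos hL' hτ hx (nonneg_of_indicator_Iio (by norm_num)),
    dMinusIntegral_of_pos hR' hτ hx (nonneg_of_indicator_Ioi (Real.sqrt_nonneg _)),
    phi_eq hσL ht, Real.sign_of_neg hx, leftFlow, Real.sqrt_mul hσL.le, Complex.ofReal_mul, eL, eR]
  generalize (Real.sqrt σL : ℂ) = sL at *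
  generalize (Real.sqrt σR : ℂ) = sR at *
  have d1 : βR * sL ^ 2 + βL * (sL * sR) = sL * (βR * sL + βL * sR) := by ring
  have d2 : βL * sR ^ 2 + βR * (sL * sR) = sR * (βR * sL + βL * sR) := by ring
  rw [d1, d2]
  generalize hD : βR * sL + βL * sR = D at *
  push_cast
  field_simp
  ring

lemma formulaR_of_pos (hσL : 0 < σL) (hσR : 0 < σR)
    (hβ : βR * Real.sqrt σL + βL * Real.sqrt σR ≠ 0) (hL : IntegrableOn vL (Iio 0))
    (hR : IntegrableOn vR (Ioi 0)) (hx : 0 < x) (ht : 0 < t) :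
    formulaR σL σR βL βR γL γR vL vR x t =
      rightFlow σL σR βL βR γL γR ((Iio (0 : ℝ)).indicator vL) ((Ioi (0 : ℝ)).indicator vR)
        x t := by
  have hL' := (integrable_indicator_iff measurableSet_Iio).2 hL
  have hR' := (integrable_indicator_iff measurableSet_Ioi).2 hR
  have hτ : 0 < σR * t := by positivity
  have hpi : (Real.pi : ℂ) ≠ 0 := by exact_mod_cast Real.pi_ne_zero
  have hsL : (Real.sqrt σL : ℂ) ≠ 0 := by exact_mod_cast (Real.sqrt_pos.2 hσL).ne'
  have hsR : (Real.sqrt σR : ℂ) ≠ 0 := by exact_mod_cast (Real.sqrt_pos.2 hσR).ne'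
  have eL : (σL : ℂ) = (Real.sqrt σL : ℂ) ^ 2 := by exact_mod_cast (Real.sq_sqrt hσL.le).symm
  have eR : (σR : ℂ) = (Real.sqrt σR : ℂ) ^ 2 := by exact_mod_cast (Real.sq_sqrt hσR.le).symm
  rw [formulaR, hatR_eq, hatR_neg_eq, hatL_mul_eq, lineIntegral_of_pos hR' hτ,
    dPlusIntegral_of_pos hL' hτ hx (nonpos_of_indicator_Iio (Real.sqrt_nonneg _)),
    dPlusIntegral_of_pos hR' hτ hx (nonpos_of_indicator_Ioi (by norm_num)),
    phi_eq hσR ht, Real.sign_of_pos hx, rightFlow, Real.sqrt_mul hσL.le, Real.sqrt_mul hσR.le,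
    Complex.ofReal_mul, Complex.ofReal_mul, eL, eR]
  generalize (Real.sqrt σL : ℂ) = sL at *
  generalize (Real.sqrt σR : ℂ) = sR at *
  have d1 : βR * sL ^ 2 + βL * (sR * sL) = sL * (βR * sL + βL * sR) := by ring
  rw [d1]
  generalize hD : βR * sL + βL * sR = D at *
  push_cast
  field_simp
  ring

end Formulas

/-! The interface conditions. -/

section Interface

variable {σL σR : ℝ}

lemma superpose_zero_neg {K : ℂ → ℝ → ℂ} {ε : ℂ} (hK : ∀ w z, K w (-z) = ε * K w z)
    (σ c : ℝ) (g : ℝ → ℂ) (t : ℝ) :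
    superpose K σ (-c) g 0 t = ε * superpose K σ c g 0 t := by
  rw [superpose, superpose, ← integral_const_mul]
  refine integral_congr_ae (.of_forall fun y => ?_)
  simp only
  rw [← mul_assoc, ← hK]
  congr 2
  ring

lemma superpose_zero_scale {K : ℂ → ℝ → ℂ} {n : ℕ} (hK : ∀ r τ : ℝ, 0 < r → 0 < τ → ∀ z : ℝ,
      K (-Complex.I * (r ^ 2 * τ : ℝ)) (r * z) = ((r : ℂ)⁻¹) ^ n * K (-Complex.I * (τ : ℝ)) z)
    {σ σ' : ℝ} (hσ : 0 < σ) (hσ' : 0 < σ') (g : ℝ → ℂ) {t : ℝ} (ht : 0 < t) :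
    superpose K σ (Real.sqrt (σ / σ')) g 0 t =
      ((Real.sqrt σ' : ℂ) / Real.sqrt σ) ^ n * superpose K σ' 1 g 0 t := by
  have hr : 0 < Real.sqrt (σ / σ') := Real.sqrt_pos.2 (by positivity)
  have h1 : ((Real.sqrt (σ / σ') : ℝ) : ℂ)⁻¹ = (Real.sqrt σ' : ℂ) / Real.sqrt σ := by
    rw [Real.sqrt_div hσ.le, Complex.ofReal_div, inv_div]
  rw [superpose, superpose, ← integral_const_mul]
  refine integral_congr_ae (.of_forall fun y => ?_)
  have h2 := hK (Real.sqrt (σ / σ')) (σ' * t) hr (by positivity) (0 - 1 * y)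
  rw [Real.sq_sqrt (by positivity), h1] at h2
  simp only
  rw [← mul_assoc, ← h2]
  congr 2
  · congr 2; field_simp
  · ring

variable {gL gR : ℝ → ℂ} {βL βR : ℂ}

/-- The derivative of `leftFlow` in space. -/
def leftFlow₁ (σL σR : ℝ) (βL βR γL γR : ℂ) (gL gR : ℝ → ℂ) (x t : ℝ) : ℂ :=
  0 + βR * Real.sqrt σL * (γR - γL) / (βR * Real.sqrt σL + βL * Real.sqrt σR) *
      (0 + 2 * heatKernel (-Complex.I * (σL * t : ℝ)) x)
    + superpose heatKernel₁ σL 1 gL x t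
    + -((βR * Real.sqrt σL - βL * Real.sqrt σR) / (βR * Real.sqrt σL + βL * Real.sqrt σR)) *
      superpose heatKernel₁ σL (-1) gL x t
    + 2 * βR * Real.sqrt σL ^ 2 / (Real.sqrt σR * (βR * Real.sqrt σL + βL * Real.sqrt σR)) *
      superpose heatKernel₁ σL (Real.sqrt (σL / σR)) gR x t

/-- The derivative of `rightFlow` in space. -/
def rightFlow₁ (σL σR : ℝ) (βL βR γL γR : ℂ) (gL gR : ℝ → ℂ) (x t : ℝ) : ℂ :=
  0 + βL * Real.sqrt σR * (γR - γL) / (βR * Real.sqrt σL + βL * Real.sqrt σR) *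
      (0 + 2 * heatKernel (-Complex.I * (σR * t : ℝ)) x)
    + superpose heatKernel₁ σR 1 gR x t
    + (βR * Real.sqrt σL - βL * Real.sqrt σR) / (βR * Real.sqrt σL + βL * Real.sqrt σR) *
      superpose heatKernel₁ σR (-1) gR x t
    + 2 * βL * Real.sqrt σR ^ 2 / (Real.sqrt σL * (βR * Real.sqrt σL + βL * Real.sqrt σR)) *
      superpose heatKernel₁ σR (Real.sqrt (σR / σL)) gL x t

lemma exists_isFlow_leftFlow (hσL : 0 < σL) (σR : ℝ) (βL βR γL γR : ℂ) (hgL : Integrable gL)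
    (hgL2 : Integrable fun y : ℝ => (y : ℂ) ^ 2 * gL y) (hgR : Integrable gR)
    (hgR2 : Integrable fun y : ℝ => (y : ℂ) ^ 2 * gR y) :
    ∃ Q₂, IsFlow σL (leftFlow σL σR βL βR γL γR gL gR) (leftFlow₁ σL σR βL βR γL γR gL gR) Q₂ :=
  ⟨_, (((((IsFlow.const σL γL).add (((IsFlow.const σL 1).add
    (isFlow_erfFlow hσL)).const_mul _)).add (isFlow_propagate hgL hgL2 hσL 1)).add
    ((isFlow_propagate hgL hgL2 hσL (-1)).const_mul _)).add
    ((isFlow_propagate hgR hgR2 hσL (Real.sqrt (σL / σR))).const_mul _))⟩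

lemma exists_isFlow_rightFlow (σL : ℝ) (hσR : 0 < σR) (βL βR γL γR : ℂ) (hgL : Integrable gL)
    (hgL2 : Integrable fun y : ℝ => (y : ℂ) ^ 2 * gL y) (hgR : Integrable gR)
    (hgR2 : Integrable fun y : ℝ => (y : ℂ) ^ 2 * gR y) :
    ∃ Q₂, IsFlow σR (rightFlow σL σR βL βR γL γR gL gR)
      (rightFlow₁ σL σR βL βR γL γR gL gR) Q₂ :=
  ⟨_, (((((IsFlow.const σR γR).add (((IsFlow.const σR (-1)).add
    (isFlow_erfFlow hσR)).const_mul _)).add (isFlow_propagate hgR hgR2 hσR 1)).add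
    ((isFlow_propagate hgR hgR2 hσR (-1)).const_mul _)).add
    ((isFlow_propagate hgL hgL2 hσR (Real.sqrt (σR / σL))).const_mul _))⟩

lemma leftFlow_zero_eq_rightFlow_zero (hσL : 0 < σL) (hσR : 0 < σR)
    (hβ : βR * Real.sqrt σL + βL * Real.sqrt σR ≠ 0) (γL γR : ℂ) (gL gR : ℝ → ℂ) {t : ℝ}
    (ht : 0 < t) :
    leftFlow σL σR βL βR γL γR gL gR 0 t = rightFlow σL σR βL βR γL γR gL gR 0 t := by
  have hsL : (Real.sqrt σL : ℂ) ≠ 0 := by exact_mod_cast (Real.sqrt_pos.2 hσL).ne'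
  have hsR : (Real.sqrt σR : ℂ) ≠ 0 := by exact_mod_cast (Real.sqrt_pos.2 hσR).ne'
  have hneg : ∀ σ g, propagate σ (-1) g 0 t = propagate σ 1 g 0 t := fun σ g => by
    have := superpose_zero_neg (K := heatKernel) (ε := 1)
      (fun w z => by rw [heatKernel_neg, one_mul]) σ 1 g t
    rwa [one_mul] at this
  have hscale : ∀ {σ σ' : ℝ}, 0 < σ → 0 < σ' → ∀ g, propagate σ (Real.sqrt (σ / σ')) g 0 t =
      (Real.sqrt σ' : ℂ) / Real.sqrt σ * propagate σ' 1 g 0 t := fun hσ hσ' g => by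
    have := superpose_zero_scale (K := heatKernel) (n := 1)
      (fun r τ hr hτ z => by rw [heatKernel_scale hr hτ, pow_one]) hσ hσ' g ht
    rwa [pow_one] at this
  rw [leftFlow, rightFlow, hneg, hneg, hscale hσL hσR, hscale hσR hσL, erfFlow_zero, erfFlow_zero]
  generalize (Real.sqrt σL : ℂ) = sL at *
  generalize (Real.sqrt σR : ℂ) = sR at *
  field_simp
  ring

lemma leftFlow₁_zero_eq_rightFlow₁_zero (hσL : 0 < σL) (hσR : 0 < σR)
    (hβ : βR * Real.sqrt σL + βL * Real.sqrt σR ≠ 0) (γL γR : ℂ) (gL gR : ℝ → ℂ) {t : ℝ}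
    (ht : 0 < t) :
    βL * leftFlow₁ σL σR βL βR γL γR gL gR 0 t = βR * rightFlow₁ σL σR βL βR γL γR gL gR 0 t := by
  have hsL : (Real.sqrt σL : ℂ) ≠ 0 := by exact_mod_cast (Real.sqrt_pos.2 hσL).ne'
  have hsR : (Real.sqrt σR : ℂ) ≠ 0 := by exact_mod_cast (Real.sqrt_pos.2 hσR).ne'
  have hneg : ∀ σ g, superpose heatKernel₁ σ (-1) g 0 t = -superpose heatKernel₁ σ 1 g 0 t :=
    fun σ g => by
      have := superpose_zero_neg (K := heatKernel₁) (ε := -1)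
        (fun w z => by rw [heatKernel₁_neg, neg_one_mul]) σ 1 g t
      rwa [neg_one_mul] at this
  have hscale : ∀ {σ σ' : ℝ}, 0 < σ → 0 < σ' → ∀ g,
      superpose heatKernel₁ σ (Real.sqrt (σ / σ')) g 0 t =
      ((Real.sqrt σ' : ℂ) / Real.sqrt σ) ^ 2 * superpose heatKernel₁ σ' 1 g 0 t :=
    fun hσ hσ' g => superpose_zero_scale (K := heatKernel₁) (n := 2)
      (fun r τ hr hτ z => heatKernel₁_scale hr hτ z) hσ hσ' g ht
  have hH : heatKernel (-Complex.I * (σL * t : ℝ)) 0 =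
      (Real.sqrt σR : ℂ) / Real.sqrt σL * heatKernel (-Complex.I * (σR * t : ℝ)) 0 := by
    have hr : 0 < Real.sqrt (σL / σR) := Real.sqrt_pos.2 (by positivity)
    have h1 := heatKernel_scale hr (show 0 < σR * t by positivity) 0
    rw [mul_zero, Real.sq_sqrt (by positivity), Real.sqrt_div hσL.le, Complex.ofReal_div,
      inv_div] at h1
    rw [← h1]
    congr 3
    field_simp
  rw [leftFlow₁, rightFlow₁, hneg, hneg, hscale hσL hσR, hscale hσR hσL, hH]
  generalize (Real.sqrt σL : ℂ) = sL at *
  generalize (Real.sqrt σR : ℂ) = sR at *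
  field_simp
  ring

end Interface

/-! ### Existence for regular data -/

lemma indicator_Iio_eq_comp_neg (v : ℝ → ℂ) :
    (Iio (0 : ℝ)).indicator v = fun y => (Ioi (0 : ℝ)).indicator (fun y => v (-y)) (-y) := by
  funext y
  simp [indicator]

lemma tendsto_nhdsWithin_of_eq {Q q : ℝ → ℝ → ℂ} {S : Set ℝ} {t : ℝ}
    (hQ : ∀ x, ∀ t > 0, ContinuousAt (Function.uncurry Q) (x, t))
    (hq : ∀ x ∈ S, ∀ t > 0, q x t = Q x t) (ht : 0 < t) :
    Tendsto (Function.uncurry q) (𝓝[S ×ˢ Ioi 0] (0, t)) (𝓝 (Q 0 t)) := by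
  refine Tendsto.congr' ?_ ((hQ 0 t ht).tendsto.mono_left nhdsWithin_le_nhds)
  filter_upwards [self_mem_nhdsWithin] with p hp
  exact (hq p.1 hp.1 p.2 hp.2).symm

section Existence

variable {σL σR : ℝ} {βL βR γL γR : ℂ} {q0L q0R : ℝ → ℂ}

/-- For regular data the integrals also converge at time zero, and the formulas reproduce the
data. -/
lemma formulaL_zero (hσL : 0 < σL) (hσR : 0 < σR)
    (hL : IntegrableOn (fun x => q0L x - γL) (Iio 0))
    (hR : IntegrableOn (fun x => q0R x - γR) (Ioi 0)) (hdL : IsRegularDatum (Iio 0) γL q0L)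
    {x : ℝ} (hx : x < 0) :
    LeftIntegralsConverge σL σR (fun x => q0L x - γL) (fun x => q0R x - γR) x 0 ∧
      formulaL σL σR βL βR γL γR (fun x => q0L x - γL) (fun x => q0R x - γR) x 0 = q0L x := by
  have hL' := (integrable_indicator_iff measurableSet_Iio).2 hL
  have hR' := (integrable_indicator_iff measurableSet_Ioi).2 hR
  have hd : DifferentiableAt ℝ ((Iio (0 : ℝ)).indicator fun x => q0L x - γL) x := by
    have h1 := ((hdL.contDiffOn.differentiableOn (by norm_num)).differentiableAt
      (Iio_mem_nhds hx)).sub_const γL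
    refine h1.congr_of_eventuallyEq ?_
    filter_upwards [Iio_mem_nhds hx] with y hy
    rw [indicator_of_mem hy]
  have hpi : (Real.pi : ℂ) ≠ 0 := by exact_mod_cast Real.pi_ne_zero
  have h1 := line_zero hL' σL hd
  have h2 := dMinus_zero hL' σL (c := -1) (by norm_num) hx
    (nonneg_of_indicator_Iio (by norm_num))
  have h3 := dMinus_zero hR' σL (c := Real.sqrt (σL / σR))
    (Real.sqrt_pos.2 (by positivity)).ne' hx (nonneg_of_indicator_Ioi (Real.sqrt_nonneg _))
  rw [LeftIntegralsConverge, formulaL, hatL_eq, hatL_neg_eq, hatR_mul_eq]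
  refine ⟨⟨h1.1, h2.1, h3.1⟩, ?_⟩
  rw [h1.2, h2.2, h3.2, phi, if_neg (lt_irrefl _), indicator_of_mem (mem_Iio.2 hx)]
  field_simp
  ring

lemma formulaR_zero (hσL : 0 < σL) (hσR : 0 < σR)
    (hL : IntegrableOn (fun x => q0L x - γL) (Iio 0))
    (hR : IntegrableOn (fun x => q0R x - γR) (Ioi 0)) (hdR : IsRegularDatum (Ioi 0) γR q0R)
    {x : ℝ} (hx : 0 < x) :
    RightIntegralsConverge σL σR (fun x => q0L x - γL) (fun x => q0R x - γR) x 0 ∧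
      formulaR σL σR βL βR γL γR (fun x => q0L x - γL) (fun x => q0R x - γR) x 0 = q0R x := by
  have hL' := (integrable_indicator_iff measurableSet_Iio).2 hL
  have hR' := (integrable_indicator_iff measurableSet_Ioi).2 hR
  have hd : DifferentiableAt ℝ ((Ioi (0 : ℝ)).indicator fun x => q0R x - γR) x := by
    have h1 := ((hdR.contDiffOn.differentiableOn (by norm_num)).differentiableAt
      (Ioi_mem_nhds hx)).sub_const γR
    refine h1.congr_of_eventuallyEq ?_
    filter_upwards [Ioi_mem_nhds hx] with y hy
    rw [indicator_of_mem hy]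
  have hpi : (Real.pi : ℂ) ≠ 0 := by exact_mod_cast Real.pi_ne_zero
  have h1 := line_zero hR' σR hd
  have h2 := dPlus_zero hR' σR (c := -1) (by norm_num) hx
    (nonpos_of_indicator_Ioi (by norm_num))
  have h3 := dPlus_zero hL' σR (c := Real.sqrt (σR / σL))
    (Real.sqrt_pos.2 (by positivity)).ne' hx (nonpos_of_indicator_Iio (Real.sqrt_nonneg _))
  rw [RightIntegralsConverge, formulaR, hatR_eq, hatR_neg_eq, hatL_mul_eq]
  refine ⟨⟨h1.1, h3.1, h2.1⟩, ?_⟩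
  rw [h1.2, h2.2, h3.2, phi, if_neg (lt_irrefl _), indicator_of_mem (mem_Ioi.2 hx)]
  field_simp
  ring

/-- The formulas solve the interface problem with regular data. -/
theorem isSolution_formula (hσL : 0 < σL) (hσR : 0 < σR)
    (hβ : βR * Real.sqrt σL + βL * Real.sqrt σR ≠ 0)
    (hL : IntegrableOn (fun x => q0L x - γL) (Iio 0))
    (hR : IntegrableOn (fun x => q0R x - γR) (Ioi 0))
    (hdL : IsRegularDatum (Iio 0) γL q0L) (hdR : IsRegularDatum (Ioi 0) γR q0R) :
    IsSolution σL σR βL βR γL γR q0L q0R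
      (formulaL σL σR βL βR γL γR (fun x => q0L x - γL) (fun x => q0R x - γR))
      (formulaR σL σR βL βR γL γR (fun x => q0L x - γL) (fun x => q0R x - γR)) := by
  have pL := hdL.left_profile hL
  have pR := hdR.right_profile hR
  set vL : ℝ → ℂ := fun x => q0L x - γL with hvL
  set vR : ℝ → ℂ := fun x => q0R x - γR with hvR
  have hgL : Integrable ((Iio (0 : ℝ)).indicator vL) :=
    (integrable_indicator_iff measurableSet_Iio).2 hL
  have hgR := pR.integrable_indicator
  have hgL2 : Integrable fun y : ℝ => (y : ℂ) ^ 2 * (Iio (0 : ℝ)).indicator vL y := by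
    refine pL.integrable_moment_indicator.comp_neg.congr (.of_forall fun y => ?_)
    rw [indicator_Iio_eq_comp_neg]
    simp [hvL]
  have hgR2 := pR.integrable_moment_indicator
  set gL := (Iio (0 : ℝ)).indicator vL with hgLdef
  set gR := (Ioi (0 : ℝ)).indicator vR with hgRdef
  set hL' := (Ioi (0 : ℝ)).indicator (fun y => q0L (-y) - γL) with hL'def
  have hgLneg : gL = fun y => hL' (-y) := indicator_Iio_eq_comp_neg vL
  have hpropL : ∀ σ c x t, propagate σ c gL x t = propagate σ c hL' (-x) t := fun σ c x t => by
    rw [hgLneg, propagate_comp_neg]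
  have hcL : 0 < Real.sqrt (σL / σR) := Real.sqrt_pos.2 (by positivity)
  have hcR : 0 < Real.sqrt (σR / σL) := Real.sqrt_pos.2 (by positivity)
  have eL : ∀ x ∈ Iio (0 : ℝ), ∀ t > 0, formulaL σL σR βL βR γL γR vL vR x t =
      leftFlow σL σR βL βR γL γR gL gR x t := fun x hx t ht =>
    formulaL_of_pos hσL hσR hβ hL hR hx ht
  have eR : ∀ x ∈ Ioi (0 : ℝ), ∀ t > 0, formulaR σL σR βL βR γL γR vL vR x t =
      rightFlow σL σR βL βR γL γR gL gR x t := fun x hx t ht =>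
    formulaR_of_pos hσL hσR hβ hL hR hx ht
  obtain ⟨QL, flowL⟩ := exists_isFlow_leftFlow hσL σR βL βR γL γR hgL hgL2 hgR hgR2
  obtain ⟨QR, flowR⟩ := exists_isFlow_rightFlow σL hσR βL βR γL γR hgL hgL2 hgR hgR2
  obtain ⟨solL, dL⟩ := flowL.isClassicalSolutionOn isOpen_Iio eL
  obtain ⟨solR, dR⟩ := flowR.isClassicalSolutionOn isOpen_Ioi eR
  refine ⟨solL, solR, fun t ht => ?_, fun t ht => ?_, fun x hx => ⟨?_, ?_⟩,
    fun x hx => ⟨?_, ?_⟩, fun t ht => ⟨leftFlow σL σR βL βR γL γR gL gR 0 t, ?_, ?_⟩,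
    fun t ht => ⟨leftFlow₁ σL σR βL βR γL γR gL gR 0 t, rightFlow₁ σL σR βL βR γL γR gL gR 0 t,
      tendsto_nhdsWithin_of_eq flowL.continuousAt₁ dL ht,
      tendsto_nhdsWithin_of_eq flowR.continuousAt₁ dR ht,
      leftFlow₁_zero_eq_rightFlow₁_zero hσL hσR hβ _ _ _ _ ht⟩, ?_, ?_⟩
  · have hz : ∀ c, c ≠ 0 → ∀ g, Tendsto (fun x => propagate σL c g x t) atBot (𝓝 0) :=
      fun c hc g => (tendsto_propagate_cocompact (by positivity) hc g).mono_left
        atBot_le_cocompact_real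
    have := ((((((tendsto_erfFlow_atBot hσL ht).const_add 1).const_mul (βR * Real.sqrt σL *
      (γR - γL) / (βR * Real.sqrt σL + βL * Real.sqrt σR))).const_add γL).add
      (hz 1 one_ne_zero gL)).add ((hz (-1) (by norm_num) gL).const_mul
      (-((βR * Real.sqrt σL - βL * Real.sqrt σR) / (βR * Real.sqrt σL + βL * Real.sqrt σR))))).add
      ((hz _ hcL.ne' gR).const_mul (2 * βR * Real.sqrt σL ^ 2 /
        (Real.sqrt σR * (βR * Real.sqrt σL + βL * Real.sqrt σR))))
    simp only [add_neg_cancel, mul_zero, add_zero] at this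
    refine this.congr' ?_
    filter_upwards [eventually_lt_atBot 0] with x hx
    exact (eL x hx t ht).symm
  · have hz : ∀ c, c ≠ 0 → ∀ g, Tendsto (fun x => propagate σR c g x t) atTop (𝓝 0) :=
      fun c hc g => (tendsto_propagate_cocompact (by positivity) hc g).mono_left
        atTop_le_cocompact_real
    have := ((((((tendsto_erfFlow_atTop hσR ht).const_add (-1)).const_mul (βL * Real.sqrt σR *
      (γR - γL) / (βR * Real.sqrt σL + βL * Real.sqrt σR))).const_add γR).add
      (hz 1 one_ne_zero gR)).add ((hz (-1) (by norm_num) gR).const_mul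
      ((βR * Real.sqrt σL - βL * Real.sqrt σR) / (βR * Real.sqrt σL + βL * Real.sqrt σR)))).add
      ((hz _ hcR.ne' gL).const_mul (2 * βL * Real.sqrt σR ^ 2 /
        (Real.sqrt σL * (βR * Real.sqrt σL + βL * Real.sqrt σR))))
    simp only [neg_add_cancel, mul_zero, add_zero] at this
    refine this.congr' ?_
    filter_upwards [eventually_gt_atTop 0] with x hx
    exact (eR x hx t ht).symm
  · exact (formulaL_zero hσL hσR hL hR hdL hx).2
  · have l1 : Tendsto (fun t => propagate σL 1 gL x t) (𝓝[>] 0) (𝓝 (q0L x - γL)) := by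
      have := pL.tendsto_propagate_self hσL (x := -x) (by linarith)
      rw [neg_neg] at this
      exact this.congr fun t => (hpropL σL 1 x t).symm
    have l2 : Tendsto (fun t => propagate σL (-1) gL x t) (𝓝[>] 0) (𝓝 0) :=
      (pL.tendsto_propagate_of_neg hσL (c := -1) (x := -x) (by linarith)).congr fun t =>
        (hpropL σL (-1) x t).symm
    have l3 := pR.tendsto_propagate_of_neg hσL (c := Real.sqrt (σL / σR)) (x := x)
      (mul_neg_of_pos_of_neg hcL hx)
    have := ((((((tendsto_erfFlow_zero hσL x).const_add 1).const_mul (βR * Real.sqrt σL *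
      (γR - γL) / (βR * Real.sqrt σL + βL * Real.sqrt σR))).const_add γL).add l1).add
      (l2.const_mul (-((βR * Real.sqrt σL - βL * Real.sqrt σR) /
        (βR * Real.sqrt σL + βL * Real.sqrt σR))))).add
      (l3.const_mul (2 * βR * Real.sqrt σL ^ 2 /
        (Real.sqrt σR * (βR * Real.sqrt σL + βL * Real.sqrt σR))))
    rw [Real.sign_of_neg hx] at this
    simp only [Complex.ofReal_neg, Complex.ofReal_one, add_neg_cancel, mul_zero, add_zero,
      add_sub_cancel] at this
    exact this.congr' (eventually_nhdsWithin_of_forall fun t ht => (eL x hx t ht).symm)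
  · exact (formulaR_zero hσL hσR hL hR hdR hx).2
  · have l1 := pR.tendsto_propagate_self hσR hx
    have l2 := pR.tendsto_propagate_of_neg hσR (c := -1) (x := x) (by linarith)
    have l3 : Tendsto (fun t => propagate σR (Real.sqrt (σR / σL)) gL x t) (𝓝[>] 0) (𝓝 0) :=
      (pL.tendsto_propagate_of_neg hσR (c := Real.sqrt (σR / σL)) (x := -x)
        (mul_neg_of_pos_of_neg hcR (by linarith))).congr fun t =>
          (hpropL σR (Real.sqrt (σR / σL)) x t).symm
    have := ((((((tendsto_erfFlow_zero hσR x).const_add (-1)).const_mul (βL * Real.sqrt σR *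
      (γR - γL) / (βR * Real.sqrt σL + βL * Real.sqrt σR))).const_add γR).add l1).add
      (l2.const_mul ((βR * Real.sqrt σL - βL * Real.sqrt σR) /
        (βR * Real.sqrt σL + βL * Real.sqrt σR)))).add
      (l3.const_mul (2 * βL * Real.sqrt σR ^ 2 /
        (Real.sqrt σL * (βR * Real.sqrt σL + βL * Real.sqrt σR))))
    rw [Real.sign_of_pos hx] at this
    simp only [Complex.ofReal_one, neg_add_cancel, mul_zero, add_zero, hvR,
      add_sub_cancel] at this
    exact this.congr' (eventually_nhdsWithin_of_forall fun t ht => (eR x hx t ht).symm)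
  · exact tendsto_nhdsWithin_of_eq flowL.continuousAt eL ht
  · rw [leftFlow_zero_eq_rightFlow_zero hσL hσR hβ _ _ _ _ ht]
    exact tendsto_nhdsWithin_of_eq flowR.continuousAt eR ht
  · obtain ⟨B0, -, hB0⟩ := exists_norm_erfFlow_le σL
    obtain ⟨B1, hB1⟩ := pL.exists_norm_propagate_le hσL one_ne_zero
    obtain ⟨B2, hB2⟩ := pL.exists_norm_propagate_le hσL (c := -1) (by norm_num)
    obtain ⟨B3, hB3⟩ := pR.exists_norm_propagate_le hσL hcL.ne'
    refine hasTemperedGrowthOn_of_bounded measurableSet_Iio (B := ‖γL‖ + ‖(βR * Real.sqrt σL *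
      (γR - γL) / (βR * Real.sqrt σL + βL * Real.sqrt σR))‖ * (1 + B0) + B1 +
      ‖-((βR * Real.sqrt σL - βL * Real.sqrt σR) /
        (βR * Real.sqrt σL + βL * Real.sqrt σR))‖ * B2 + ‖(2 * βR * Real.sqrt σL ^ 2 /
        (Real.sqrt σR * (βR * Real.sqrt σL + βL * Real.sqrt σR)))‖ * B3) fun x hx t ht => ?_
    rw [eL x hx t ht, leftFlow]
    refine norm_add_le_of_le (norm_add_le_of_le (norm_add_le_of_le (norm_add_le_of_le le_rfl ?_)
      ?_) ?_) ?_
    · rw [norm_mul]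
      exact mul_le_mul_of_nonneg_left (norm_add_le_of_le (by simp) (hB0 _ _)) (norm_nonneg _)
    · rw [hpropL]; exact hB1 _ t ht
    · rw [norm_mul, hpropL]; exact mul_le_mul_of_nonneg_left (hB2 _ t ht) (norm_nonneg _)
    · rw [norm_mul]; exact mul_le_mul_of_nonneg_left (hB3 _ t ht) (norm_nonneg _)
  · obtain ⟨B0, -, hB0⟩ := exists_norm_erfFlow_le σR
    obtain ⟨B1, hB1⟩ := pR.exists_norm_propagate_le hσR one_ne_zero
    obtain ⟨B2, hB2⟩ := pR.exists_norm_propagate_le hσR (c := -1) (by norm_num)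
    obtain ⟨B3, hB3⟩ := pL.exists_norm_propagate_le hσR hcR.ne'
    refine hasTemperedGrowthOn_of_bounded measurableSet_Ioi (B := ‖γR‖ + ‖(βL * Real.sqrt σR *
      (γR - γL) / (βR * Real.sqrt σL + βL * Real.sqrt σR))‖ * (1 + B0) + B1 +
      ‖((βR * Real.sqrt σL - βL * Real.sqrt σR) /
        (βR * Real.sqrt σL + βL * Real.sqrt σR))‖ * B2 + ‖(2 * βL * Real.sqrt σR ^ 2 /
        (Real.sqrt σL * (βR * Real.sqrt σL + βL * Real.sqrt σR)))‖ * B3) fun x hx t ht => ?_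
    rw [eR x hx t ht, rightFlow]
    refine norm_add_le_of_le (norm_add_le_of_le (norm_add_le_of_le (norm_add_le_of_le le_rfl ?_)
      ?_) ?_) ?_
    · rw [norm_mul]
      exact mul_le_mul_of_nonneg_left (norm_add_le_of_le (by simp) (hB0 _ _)) (norm_nonneg _)
    · exact hB1 _ t ht
    · rw [norm_mul]; exact mul_le_mul_of_nonneg_left (hB2 _ t ht) (norm_nonneg _)
    · rw [norm_mul, hpropL]; exact mul_le_mul_of_nonneg_left (hB3 _ t ht) (norm_nonneg _)

end Existence

/-! ### Green's identity up to the boundary -/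

/-- `f` is a test function on space-time, with space derivatives `f₁`, `f₂` and time derivative
`fₜ`, all of them continuous. -/
structure IsTestFunction (f f₁ f₂ fₜ : ℝ → ℝ → ℂ) : Prop where
  hasDerivAt_x : ∀ y s, HasDerivAt (fun y => f y s) (f₁ y s) y
  hasDerivAt_xx : ∀ y s, HasDerivAt (fun y => f₁ y s) (f₂ y s) y
  hasDerivAt_t : ∀ y s, HasDerivAt (fun s => f y s) (fₜ y s) s
  continuous : Continuous (Function.uncurry f)
  continuous₁ : Continuous (Function.uncurry f₁)
  continuous₂ : Continuous (Function.uncurry f₂)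
  continuousₜ : Continuous (Function.uncurry fₜ)

lemma continuousOn_slice_left {F : ℝ → ℝ → ℂ} {S T : Set ℝ}
    (hF : ContinuousOn (Function.uncurry F) (S ×ˢ T)) {s : ℝ} (hs : s ∈ T) :
    ContinuousOn (fun y => F y s) S :=
  hF.comp (by fun_prop : ContinuousOn (fun y : ℝ => (y, s)) S) fun _ hy => ⟨hy, hs⟩

lemma continuousOn_slice_right {F : ℝ → ℝ → ℂ} {S T : Set ℝ}
    (hF : ContinuousOn (Function.uncurry F) (S ×ˢ T)) {y : ℝ} (hy : y ∈ S) :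
    ContinuousOn (fun s => F y s) T :=
  hF.comp (by fun_prop : ContinuousOn (fun s : ℝ => (y, s)) T) fun _ hs => ⟨hy, hs⟩

/-- Green's identity for a classical solution, on a rectangle inside the domain. -/
lemma green_rectangle {S : Set ℝ} {σ : ℝ} {q f f₁ f₂ fₜ : ℝ → ℝ → ℂ}
    (hq : IsClassicalSolutionOn S σ q) (hf : IsTestFunction f f₁ f₂ fₜ) {a b s₁ s₂ : ℝ}
    (hab : a ≤ b) (hS : Icc a b ⊆ S) (hs₁ : 0 < s₁) (hs : s₁ ≤ s₂) :
    (∫ y in a..b, q y s₂ * f y s₂) - (∫ y in a..b, q y s₁ * f y s₁) =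
      ∫ s in s₁..s₂, (-Complex.I * σ * ((dx q b s * f b s - q b s * f₁ b s) -
        (dx q a s * f a s - q a s * f₁ a s)) +
        ∫ y in a..b, q y s * (fₜ y s - Complex.I * σ * f₂ y s)) := by
  have hT : Icc s₁ s₂ ⊆ Ioi (0 : ℝ) := fun s hs => hs₁.trans_le hs.1
  have hsub : Icc a b ×ˢ Icc s₁ s₂ ⊆ S ×ˢ Ioi 0 := prod_mono hS hT
  have cq := hq.continuous_q.mono hsub
  have cqt := hq.continuous_dt.mono hsub
  have cqx := hq.continuous_dx.mono hsub
  have cqxx := hq.continuous_dxx.mono hsub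
  have cf := hf.continuous.continuousOn (s := Icc a b ×ˢ Icc s₁ s₂)
  have cf₁ := hf.continuous₁.continuousOn (s := Icc a b ×ˢ Icc s₁ s₂)
  have cf₂ := hf.continuous₂.continuousOn (s := Icc a b ×ˢ Icc s₁ s₂)
  have cft := hf.continuousₜ.continuousOn (s := Icc a b ×ˢ Icc s₁ s₂)
  have hG : ContinuousOn (Function.uncurry fun y s => dt q y s * f y s + q y s * fₜ y s)
      (Icc a b ×ˢ Icc s₁ s₂) := (cqt.mul cf).add (cq.mul cft)
  have ha : a ∈ Icc a b := left_mem_Icc.2 hab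
  have ii : ∀ {F : ℝ → ℝ → ℂ}, ContinuousOn (Function.uncurry F) (Icc a b ×ˢ Icc s₁ s₂) →
      ∀ s ∈ Icc s₁ s₂, IntervalIntegrable (fun y => F y s) volume a b := fun hF s hs => by
    refine ContinuousOn.intervalIntegrable ?_
    rw [uIcc_of_le hab]
    exact continuousOn_slice_left hF hs
  have htime : ∀ y ∈ Icc a b, q y s₂ * f y s₂ - q y s₁ * f y s₁ =
      ∫ s in s₁..s₂, (dt q y s * f y s + q y s * fₜ y s) := by
    intro y hy
    refine (intervalIntegral.integral_eq_sub_of_hasDerivAt (f := fun s => q y s * f y s)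
      (fun s hs' => ?_) ?_).symm
    · rw [uIcc_of_le hs] at hs'
      exact (hq.differentiable_t y (hS hy) s (hT hs')).hasDerivAt.mul (hf.hasDerivAt_t y s)
    · refine ContinuousOn.intervalIntegrable ?_
      rw [uIcc_of_le hs]
      exact continuousOn_slice_right hG hy
  have hspace : ∀ s ∈ Icc s₁ s₂, (∫ y in a..b, (dt q y s * f y s + q y s * fₜ y s)) =
      -Complex.I * σ * ((dx q b s * f b s - q b s * f₁ b s) -
        (dx q a s * f a s - q a s * f₁ a s)) +
        ∫ y in a..b, q y s * (fₜ y s - Complex.I * σ * f₂ y s) := by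
    intro s hs'
    have hs0 : 0 < s := hT hs'
    have c1 : ContinuousOn (Function.uncurry fun y s => dx (dx q) y s * f y s - q y s * f₂ y s)
        (Icc a b ×ˢ Icc s₁ s₂) := (cqxx.mul cf).sub (cq.mul cf₂)
    have c2 : ContinuousOn (Function.uncurry fun y s =>
        q y s * (fₜ y s - Complex.I * σ * f₂ y s)) (Icc a b ×ˢ Icc s₁ s₂) :=
      cq.mul (cft.sub (continuousOn_const.mul cf₂))
    have h1 := intervalIntegral.integral_eq_sub_of_hasDerivAt (a := a) (b := b)
      (f := fun y => dx q y s * f y s - q y s * f₁ y s)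
      (f' := fun y => dx (dx q) y s * f y s - q y s * f₂ y s) (fun y hy => by
        rw [uIcc_of_le hab] at hy
        refine (((hq.differentiable_xx y (hS hy) s hs0).hasDerivAt.mul
          (hf.hasDerivAt_x y s)).sub ((hq.differentiable_x y (hS hy) s hs0).hasDerivAt.mul
          (hf.hasDerivAt_xx y s))).congr_deriv ?_
        simp only [dx]
        ring) (ii c1 s hs')
    rw [← h1, ← intervalIntegral.integral_const_mul,
      ← intervalIntegral.integral_add ((ii c1 s hs').const_mul _) (ii c2 s hs')]
    refine intervalIntegral.integral_congr fun y hy => ?_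
    rw [uIcc_of_le hab] at hy
    have he := hq.equation y (hS hy) s hs0
    have he2 : dt q y s = -Complex.I * σ * dx (dx q) y s := by
      linear_combination (-Complex.I) * he + dt q y s * Complex.I_mul_I
    rw [he2]
    ring
  have c3 : ContinuousOn (Function.uncurry fun y s => q y s * f y s) (Icc a b ×ˢ Icc s₁ s₂) :=
    cq.mul cf
  rw [← intervalIntegral.integral_sub (ii c3 s₂ (right_mem_Icc.2 hs))
    (ii c3 s₁ (left_mem_Icc.2 hs))]
  calc _ = ∫ y in a..b, ∫ s in s₁..s₂, (dt q y s * f y s + q y s * fₜ y s) := by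
        refine intervalIntegral.integral_congr fun y hy => ?_
        rw [uIcc_of_le hab] at hy
        exact htime y hy
    _ = ∫ s in s₁..s₂, ∫ y in a..b, (dt q y s * f y s + q y s * fₜ y s) := by
        refine intervalIntegral_intervalIntegral_swap ?_
        rw [uIoc_of_le hab, uIoc_of_le hs]
        exact (hG.integrableOn_compact (isCompact_Icc.prod isCompact_Icc)).mono_set
          (prod_mono Ioc_subset_Icc_self Ioc_subset_Icc_self)
    _ = _ := by
        refine intervalIntegral.integral_congr fun s hs' => ?_
        rw [uIcc_of_le hs] at hs'
        exact hspace s hs'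

lemma continuous_integral_moving {X : Type*} [TopologicalSpace X] [FirstCountableTopology X]
    {F : X → ℝ → ℂ} (hF : Continuous (Function.uncurry F)) {a b : X → ℝ} (ha : Continuous a)
    (hb : Continuous b) : Continuous fun p => ∫ y in a p..b p, F p y := by
  have h1 := intervalIntegral.continuous_parametric_intervalIntegral_of_continuous
    (μ := volume) (a₀ := 0) hF hb
  have h2 := intervalIntegral.continuous_parametric_intervalIntegral_of_continuous
    (μ := volume) (a₀ := 0) hF ha
  refine (h1.sub h2).congr fun p => ?_
  have hFp : Continuous (F p) := hF.comp (by fun_prop : Continuous fun y : ℝ => (p, y))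
  exact intervalIntegral.integral_interval_sub_left (hFp.intervalIntegrable _ _)
    (hFp.intervalIntegrable _ _)

/-- Green's identity for a classical solution that extends continuously, with its slope, to the
endpoints of an interval: the limit of the identities on smaller rectangles. -/
lemma green_closed {S : Set ℝ} {σ : ℝ} {q f f₁ f₂ fₜ F F₁ : ℝ → ℝ → ℂ}
    (hq : IsClassicalSolutionOn S σ q) (hf : IsTestFunction f f₁ f₂ fₜ) {A B s₁ s₂ : ℝ}
    (hAB : A < B) (hS : Ioo A B ⊆ S) (hs₁ : 0 < s₁) (hs : s₁ ≤ s₂)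
    (hF : ContinuousOn (Function.uncurry F) (Icc A B ×ˢ Ioi 0))
    (hF₁ : ContinuousOn (Function.uncurry F₁) (Icc A B ×ˢ Ioi 0))
    (hqF : ∀ y ∈ Ioo A B, ∀ s > 0, q y s = F y s)
    (hqF₁ : ∀ y ∈ Ioo A B, ∀ s > 0, dx q y s = F₁ y s) :
    (∫ y in A..B, F y s₂ * f y s₂) - (∫ y in A..B, F y s₁ * f y s₁) =
      ∫ s in s₁..s₂, (-Complex.I * σ * ((F₁ B s * f B s - F B s * f₁ B s) -
        (F₁ A s * f A s - F A s * f₁ A s)) +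
        ∫ y in A..B, F y s * (fₜ y s - Complex.I * σ * f₂ y s)) := by
  -- clamp the arguments to make the extensions globally continuous
  set κ : ℝ × ℝ → ℝ × ℝ := fun p => (projIcc A B hAB.le p.1, projIcc s₁ s₂ hs p.2) with hκ
  have hκc : Continuous κ := by
    have h1 : Continuous (projIcc A B hAB.le) := continuous_projIcc
    have h2 : Continuous (projIcc s₁ s₂ hs) := continuous_projIcc
    fun_prop
  have hκm : ∀ p, κ p ∈ Icc A B ×ˢ Ioi (0 : ℝ) := fun p =>
    ⟨(projIcc A B hAB.le p.1).2, hs₁.trans_le (projIcc s₁ s₂ hs p.2).2.1⟩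
  have hκe : ∀ y ∈ Icc A B, ∀ s ∈ Icc s₁ s₂, κ (y, s) = (y, s) := fun y hy s hs' => by
    simp only [hκ, projIcc_of_mem _ hy, projIcc_of_mem _ hs']
  set U : ℝ → ℝ → ℂ := fun y s => Function.uncurry F (κ (y, s)) with hU
  set U₁ : ℝ → ℝ → ℂ := fun y s => Function.uncurry F₁ (κ (y, s)) with hU₁
  have hUc : Continuous (Function.uncurry U) :=
    hF.comp_continuous hκc hκm
  have hU₁c : Continuous (Function.uncurry U₁) := hF₁.comp_continuous hκc hκm
  have hUe : ∀ y ∈ Icc A B, ∀ s ∈ Icc s₁ s₂, U y s = F y s := fun y hy s hs' => by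
    simp only [hU, hκe y hy s hs', Function.uncurry]
  have hU₁e : ∀ y ∈ Icc A B, ∀ s ∈ Icc s₁ s₂, U₁ y s = F₁ y s := fun y hy s hs' => by
    simp only [hU₁, hκe y hy s hs', Function.uncurry]
  have m1 : s₁ ∈ Icc s₁ s₂ := left_mem_Icc.2 hs
  have m2 : s₂ ∈ Icc s₁ s₂ := right_mem_Icc.2 hs
  set lhs : ℝ → ℂ := fun δ => (∫ y in (A + δ)..(B - δ), U y s₂ * f y s₂) -
    ∫ y in (A + δ)..(B - δ), U y s₁ * f y s₁ with hlhs
  set rhs : ℝ → ℂ := fun δ => ∫ s in s₁..s₂,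
    (-Complex.I * σ * ((U₁ (B - δ) s * f (B - δ) s - U (B - δ) s * f₁ (B - δ) s) -
      (U₁ (A + δ) s * f (A + δ) s - U (A + δ) s * f₁ (A + δ) s)) +
      ∫ y in (A + δ)..(B - δ), U y s * (fₜ y s - Complex.I * σ * f₂ y s)) with hrhs
  have cf := hf.continuous
  have cf₁ := hf.continuous₁
  have cf₂ := hf.continuous₂
  have cft := hf.continuousₜ
  have comp : ∀ {X : Type} [TopologicalSpace X] {G : ℝ → ℝ → ℂ}, Continuous (Function.uncurry G) →
      ∀ {u v : X → ℝ}, Continuous u → Continuous v → Continuous fun x => G (u x) (v x) :=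
    fun hG _ _ hu hv => hG.comp₂ hu hv
  have hlhsc : Continuous lhs := by
    have h : ∀ s, Continuous fun δ : ℝ => ∫ y in (A + δ)..(B - δ), U y s * f y s := fun s =>
      continuous_integral_moving (X := ℝ) (F := fun _ y => U y s * f y s)
        ((comp hUc (by fun_prop) (by fun_prop)).mul (comp cf (by fun_prop) (by fun_prop)))
        (by fun_prop) (by fun_prop)
    exact (h s₂).sub (h s₁)
  have hrhsc : Continuous rhs := by
    refine intervalIntegral.continuous_parametric_intervalIntegral_of_continuous' ?_ s₁ s₂
    refine Continuous.add (continuous_const.mul (Continuous.sub (Continuous.sub ?_ ?_)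
      (Continuous.sub ?_ ?_))) ?_
    · exact (comp hU₁c (by fun_prop) (by fun_prop)).mul (comp cf (by fun_prop) (by fun_prop))
    · exact (comp hUc (by fun_prop) (by fun_prop)).mul (comp cf₁ (by fun_prop) (by fun_prop))
    · exact (comp hU₁c (by fun_prop) (by fun_prop)).mul (comp cf (by fun_prop) (by fun_prop))
    · exact (comp hUc (by fun_prop) (by fun_prop)).mul (comp cf₁ (by fun_prop) (by fun_prop))
    · refine continuous_integral_moving (X := ℝ × ℝ)
        (F := fun p y => U y p.2 * (fₜ y p.2 - Complex.I * σ * f₂ y p.2)) ?_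
        (by fun_prop) (by fun_prop)
      exact (comp hUc (by fun_prop) (by fun_prop)).mul ((comp cft (by fun_prop) (by fun_prop)).sub
        (continuous_const.mul (comp cf₂ (by fun_prop) (by fun_prop))))
  have heq : ∀ δ ∈ Ioo 0 ((B - A) / 2), lhs δ = rhs δ := by
    intro δ hδ
    have hab : A + δ ≤ B - δ := by linarith [hδ.2]
    have hmem : ∀ y ∈ Icc (A + δ) (B - δ), y ∈ Ioo A B := fun y hy =>
      ⟨by linarith [hy.1, hδ.1], by linarith [hy.2, hδ.1]⟩
    have hq' : ∀ y ∈ Icc (A + δ) (B - δ), ∀ s ∈ Icc s₁ s₂, U y s = q y s := fun y hy s hs' => by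
      rw [hUe y (Ioo_subset_Icc_self (hmem y hy)) s hs',
        hqF y (hmem y hy) s (hs₁.trans_le hs'.1)]
    have hq₁' : ∀ y ∈ Icc (A + δ) (B - δ), ∀ s ∈ Icc s₁ s₂, U₁ y s = dx q y s :=
      fun y hy s hs' => by
        rw [hU₁e y (Ioo_subset_Icc_self (hmem y hy)) s hs',
          hqF₁ y (hmem y hy) s (hs₁.trans_le hs'.1)]
    have hg := green_rectangle hq hf hab (fun y hy => hS (hmem y hy)) hs₁ hs
    have int : ∀ s ∈ Icc s₁ s₂, ∀ G : ℝ → ℂ, (∫ y in (A + δ)..(B - δ), U y s * G y) =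
        ∫ y in (A + δ)..(B - δ), q y s * G y := fun s hs' G => by
      refine intervalIntegral.integral_congr fun y hy => ?_
      rw [uIcc_of_le hab] at hy
      simp only [hq' y hy s hs']
    rw [hlhs, hrhs]
    simp only
    rw [int s₂ m2, int s₁ m1, hg]
    refine intervalIntegral.integral_congr fun s hs' => ?_
    rw [uIcc_of_le hs] at hs'
    rw [int s hs', hq' _ (left_mem_Icc.2 hab) s hs', hq' _ (right_mem_Icc.2 hab) s hs',
      hq₁' _ (left_mem_Icc.2 hab) s hs', hq₁' _ (right_mem_Icc.2 hab) s hs']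
  have h0 : lhs 0 = rhs 0 := by
    have t1 := (hlhsc.tendsto 0).mono_left (nhdsWithin_le_nhds (s := Ioi 0))
    have t2 := (hrhsc.tendsto 0).mono_left (nhdsWithin_le_nhds (s := Ioi 0))
    refine tendsto_nhds_unique (t1.congr' ?_) t2
    filter_upwards [Ioo_mem_nhdsGT (show (0 : ℝ) < (B - A) / 2 by linarith)] with δ hδ
    exact heq δ hδ
  have int : ∀ s ∈ Icc s₁ s₂, ∀ G : ℝ → ℂ, (∫ y in A..B, U y s * G y) =
      ∫ y in A..B, F y s * G y := fun s hs' G => by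
    refine intervalIntegral.integral_congr fun y hy => ?_
    rw [uIcc_of_le hAB.le] at hy
    simp only [hUe y hy s hs']
  rw [hlhs, hrhs] at h0
  simp only [add_zero, sub_zero] at h0
  rw [int s₂ m2, int s₁ m1] at h0
  rw [h0]
  refine intervalIntegral.integral_congr fun s hs' => ?_
  rw [uIcc_of_le hs] at hs'
  have mA := left_mem_Icc.2 hAB.le
  have mB := right_mem_Icc.2 hAB.le
  rw [int s hs', hUe A mA s hs', hUe B mB s hs', hU₁e A mA s hs', hU₁e B mB s hs']

/-- A function with limits at the interface extends continuously to the closed half-line. -/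
lemma exists_extension {S : Set ℝ} (hS : (0 : ℝ) ∈ closure S) {q : ℝ → ℝ → ℂ}
    (hq : ContinuousOn (Function.uncurry q) (S ×ˢ Ioi 0))
    (hlim : ∀ t > (0 : ℝ), ∃ a, Tendsto (Function.uncurry q) (𝓝[S ×ˢ Ioi 0] (0, t)) (𝓝 a)) :
    ∃ F : ℝ → ℝ → ℂ, ContinuousOn (Function.uncurry F) ((insert 0 S) ×ˢ Ioi 0) ∧
      (∀ y ∈ S, ∀ t > 0, q y t = F y t) ∧
      ∀ t > (0 : ℝ), Tendsto (Function.uncurry q) (𝓝[S ×ˢ Ioi 0] (0, t)) (𝓝 (F 0 t)) := by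
  have hcl : ∀ t > (0 : ℝ), ((0 : ℝ), t) ∈ closure (S ×ˢ Ioi (0 : ℝ)) := fun t ht => by
    rw [closure_prod_eq]
    exact ⟨hS, subset_closure ht⟩
  refine ⟨fun y t => extendFrom (S ×ˢ Ioi 0) (Function.uncurry q) (y, t), ?_, ?_, ?_⟩
  · refine continuousOn_extendFrom ?_ ?_
    · rintro ⟨y, t⟩ ⟨hy, ht⟩
      rcases hy with rfl | hy
      · exact hcl t ht
      · exact subset_closure ⟨hy, ht⟩
    · rintro ⟨y, t⟩ ⟨hy, ht⟩
      rcases hy with rfl | hy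
      · exact hlim t ht
      · exact ⟨_, hq (y, t) ⟨hy, ht⟩⟩
  · intro y hy t ht
    exact (extendFrom_extends hq (y, t) ⟨hy, ht⟩).symm
  · intro t ht
    exact tendsto_extendFrom (hlim t ht)

/-! ### Gaussian test flows and weights -/

/-- `ψ` is a solution of the adjoint equation `ψ_t = i σ ψ_yy` on the whole line, with space
derivatives `ψ₁` and `ψ₂`; `ψ` and `ψ₁` decay faster than any power of `y`, uniformly for times
in `[0, T]`. -/
structure IsTestFlow (σ T : ℝ) (ψ ψ₁ ψ₂ : ℝ → ℝ → ℂ) : Prop extends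
    IsTestFunction ψ ψ₁ ψ₂ (fun y s => Complex.I * σ * ψ₂ y s) where
  decay : ∀ m : ℕ, ∃ C ≥ 0, ∀ y, ∀ s ∈ Icc 0 T, ‖ψ y s‖ ≤ C / (1 + |y|) ^ m
  decay₁ : ∀ m : ℕ, ∃ C ≥ 0, ∀ y, ∀ s ∈ Icc 0 T, ‖ψ₁ y s‖ ≤ C / (1 + |y|) ^ m

lemma IsTestFlow.const_mul {σ T : ℝ} {ψ ψ₁ ψ₂ : ℝ → ℝ → ℂ} (h : IsTestFlow σ T ψ ψ₁ ψ₂) (a : ℂ) :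
    IsTestFlow σ T (fun y s => a * ψ y s) (fun y s => a * ψ₁ y s) (fun y s => a * ψ₂ y s) where
  hasDerivAt_x y s := (h.hasDerivAt_x y s).const_mul a
  hasDerivAt_xx y s := (h.hasDerivAt_xx y s).const_mul a
  hasDerivAt_t y s := ((h.hasDerivAt_t y s).const_mul a).congr_deriv (by ring)
  continuous := continuous_const.mul h.continuous
  continuous₁ := continuous_const.mul h.continuous₁
  continuous₂ := continuous_const.mul h.continuous₂
  continuousₜ := continuous_const.mul (continuous_const.mul h.continuous₂)
  decay m := by
    obtain ⟨C, hC, hb⟩ := h.decay m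
    refine ⟨‖a‖ * C, by positivity, fun y s hs => ?_⟩
    rw [norm_mul, mul_div_assoc]
    exact mul_le_mul_of_nonneg_left (hb y s hs) (norm_nonneg a)
  decay₁ m := by
    obtain ⟨C, hC, hb⟩ := h.decay₁ m
    refine ⟨‖a‖ * C, by positivity, fun y s hs => ?_⟩
    rw [norm_mul, mul_div_assoc]
    exact mul_le_mul_of_nonneg_left (hb y s hs) (norm_nonneg a)

lemma IsTestFlow.add {σ T : ℝ} {ψ ψ₁ ψ₂ θ θ₁ θ₂ : ℝ → ℝ → ℂ} (h : IsTestFlow σ T ψ ψ₁ ψ₂)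
    (k : IsTestFlow σ T θ θ₁ θ₂) :
    IsTestFlow σ T (fun y s => ψ y s + θ y s) (fun y s => ψ₁ y s + θ₁ y s)
      (fun y s => ψ₂ y s + θ₂ y s) where
  hasDerivAt_x y s := (h.hasDerivAt_x y s).add (k.hasDerivAt_x y s)
  hasDerivAt_xx y s := (h.hasDerivAt_xx y s).add (k.hasDerivAt_xx y s)
  hasDerivAt_t y s := ((h.hasDerivAt_t y s).add (k.hasDerivAt_t y s)).congr_deriv (by ring)
  continuous := h.continuous.add k.continuous
  continuous₁ := h.continuous₁.add k.continuous₁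
  continuous₂ := h.continuous₂.add k.continuous₂
  continuousₜ := continuous_const.mul (h.continuous₂.add k.continuous₂)
  decay m := by
    obtain ⟨C, hC, hb⟩ := h.decay m
    obtain ⟨C', hC', hb'⟩ := k.decay m
    refine ⟨C + C', by positivity, fun y s hs => ?_⟩
    rw [add_div]
    exact (norm_add_le _ _).trans (add_le_add (hb y s hs) (hb' y s hs))
  decay₁ m := by
    obtain ⟨C, hC, hb⟩ := h.decay₁ m
    obtain ⟨C', hC', hb'⟩ := k.decay₁ m
    refine ⟨C + C', by positivity, fun y s hs => ?_⟩
    rw [add_div]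
    exact (norm_add_le _ _).trans (add_le_add (hb y s hs) (hb' y s hs))

lemma one_add_abs_pow_mul_exp_le {κ : ℝ} (hκ : 0 < κ) (m : ℕ) (z : ℝ) :
    (1 + |z|) ^ m * Real.exp (-κ * z ^ 2) ≤ (2 / κ) ^ m * m.factorial * Real.exp κ := by
  have h1 : (1 + |z|) ^ m ≤ (2 / κ) ^ m * (κ * (1 + z ^ 2)) ^ m := by
    rw [← mul_pow]
    refine pow_le_pow_left₀ (by positivity) ?_ m
    have : 2 / κ * (κ * (1 + z ^ 2)) = 2 * (1 + z ^ 2) := by field_simp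
    rw [this, ← sq_abs z]
    nlinarith [sq_nonneg (|z| - 1), abs_nonneg z]
  have h2 := Real.pow_div_factorial_le_exp (κ * (1 + z ^ 2)) (by positivity) m
  rw [div_le_iff₀ (by positivity)] at h2
  calc (1 + |z|) ^ m * Real.exp (-κ * z ^ 2)
      ≤ (2 / κ) ^ m * (Real.exp (κ * (1 + z ^ 2)) * m.factorial) * Real.exp (-κ * z ^ 2) := by
        gcongr
        exact h1.trans (by gcongr)
    _ = (2 / κ) ^ m * m.factorial * (Real.exp (κ * (1 + z ^ 2)) * Real.exp (-κ * z ^ 2)) := by ring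
    _ = _ := by rw [← Real.exp_add]; ring_nf

/-- The complex time of the Gaussian test flows: its real part `ε` smooths the backward
Schrödinger kernel, and at `s = T` it is real. -/
def testTime (ε σ T s : ℝ) : ℂ := ε - Complex.I * (σ * (T - s) : ℝ)

@[simp] lemma testTime_re (ε σ T s : ℝ) : (testTime ε σ T s).re = ε := by simp [testTime]

lemma testTime_mem_slitPlane {ε : ℝ} (hε : 0 < ε) (σ T s : ℝ) :
    testTime ε σ T s ∈ Complex.slitPlane := by
  rw [Complex.mem_slitPlane_iff]; left; simpa using hε

lemma testTime_self (ε σ T : ℝ) : testTime ε σ T T = ε := by simp [testTime]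

/-- The heat kernel at the complex times `testTime` decays in space faster than any power. -/
lemma exists_norm_heatKernel_testTime_le {ε : ℝ} (hε : 0 < ε) (σ T x c : ℝ) (hc : c ≠ 0) (m : ℕ) :
    ∃ C ≥ 0, ∀ y, ∀ s ∈ Icc 0 T,
      (1 + |x - c * y|) * ‖heatKernel (testTime ε σ T s) (x - c * y)‖ ≤ C / (1 + |y|) ^ m := by
  set M : ℝ := ε ^ 2 + (σ * T) ^ 2 with hM
  have hMp : 0 < M := by positivity
  set κ : ℝ := ε / (4 * M) with hκ
  have hκp : 0 < κ := by positivity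
  set A : ℝ := 1 + (|x| + 1) / |c| with hA
  have hcp : 0 < |c| := abs_pos.2 hc
  set B : ℝ := (4 * Real.pi * ε) ^ (-(1 / 2) : ℝ) with hB
  have hB0 : 0 ≤ B := by positivity
  refine ⟨A ^ m * (B * ((2 / κ) ^ (m + 1) * (m + 1).factorial * Real.exp κ)), by positivity,
    fun y s hs => ?_⟩
  set z := x - c * y with hz
  set w := testTime ε σ T s with hw
  have hw0 : w ≠ 0 := Complex.slitPlane_ne_zero (testTime_mem_slitPlane hε σ T s)
  have hre : w.re = ε := testTime_re ε σ T s
  have hεw : ε ≤ ‖w‖ := by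
    have := Complex.re_le_norm w
    rwa [hre] at this
  have hwM : ‖w‖ ^ 2 ≤ M := by
    rw [← Complex.normSq_eq_norm_sq, Complex.normSq_apply, hre]
    have him : w.im = -(σ * (T - s)) := by simp [hw, testTime]
    rw [him, hM]
    have h1 : (T - s) ^ 2 ≤ T ^ 2 := by nlinarith [hs.1, hs.2]
    nlinarith [mul_le_mul_of_nonneg_left h1 (sq_nonneg σ)]
  have hy : 1 + |y| ≤ A * (1 + |z|) := by
    have e : y = (x - z) / c := by rw [hz]; field_simp; ring
    have h1 : |y| ≤ (|x| + |z|) / |c| := by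
      rw [e, abs_div]
      gcongr
      exact abs_sub x z
    have h2 : (|x| + |z|) / |c| ≤ (|x| + 1) / |c| * (1 + |z|) := by
      rw [div_mul_eq_mul_div]
      gcongr
      nlinarith [abs_nonneg x, abs_nonneg z]
    rw [hA]
    nlinarith [abs_nonneg z]
  have hH : ‖heatKernel w z‖ ≤ B * Real.exp (-κ * z ^ 2) := by
    rw [norm_heatKernel hw0, hre]
    gcongr ?_ * Real.exp ?_
    · exact Real.rpow_le_rpow_of_nonpos (by positivity) (by gcongr) (by norm_num)
    · rw [neg_mul, neg_mul, neg_le_neg_iff, hκ]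
      gcongr
  rw [le_div_iff₀ (by positivity)]
  calc (1 + |z|) * ‖heatKernel w z‖ * (1 + |y|) ^ m
      ≤ (1 + |z|) * (B * Real.exp (-κ * z ^ 2)) * (A * (1 + |z|)) ^ m := by gcongr
    _ = A ^ m * (B * ((1 + |z|) ^ (m + 1) * Real.exp (-κ * z ^ 2))) := by rw [mul_pow]; ring
    _ ≤ _ := mul_le_mul_of_nonneg_left (mul_le_mul_of_nonneg_left
        (one_add_abs_pow_mul_exp_le hκp (m + 1) z) hB0) (by positivity)

/-- The backward Gaussian flow started at `x / c` at time `T`. -/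
lemma isTestFlow_heatKernel {ε : ℝ} (hε : 0 < ε) (σ T x c : ℝ) (hc : c ≠ 0) :
    IsTestFlow σ T (fun y s => heatKernel (testTime ε (σ * c ^ 2) T s) (x - c * y))
      (fun y s => -c * heatKernel₁ (testTime ε (σ * c ^ 2) T s) (x - c * y))
      (fun y s => c ^ 2 * heatKernel₂ (testTime ε (σ * c ^ 2) T s) (x - c * y)) := by
  have hz : ∀ y : ℝ, HasDerivAt (fun y => x - c * y) (-c) y := fun y => by
    simpa using ((hasDerivAt_id y).const_mul c).const_sub x
  have hmem := testTime_mem_slitPlane hε (σ * c ^ 2) T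
  have hcont : ∀ {K : ℂ → ℝ → ℂ}, (∀ {w : ℂ}, w ∈ Complex.slitPlane → ∀ z : ℝ,
      ContinuousAt (fun p : ℂ × ℝ => K p.1 p.2) (w, z)) →
      Continuous (Function.uncurry fun y s => K (testTime ε (σ * c ^ 2) T s) (x - c * y)) :=
    fun hK => continuous_iff_continuousAt.2 fun p => by
      refine ContinuousAt.comp (f := fun p : ℝ × ℝ => (testTime ε (σ * c ^ 2) T p.2, x - c * p.1))
        (hK (hmem p.2) (x - c * p.1)) ?_
      unfold testTime
      fun_prop
  have c0 := hcont continuousAt_heatKernel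
  have c1 := hcont continuousAt_heatKernel₁
  have c2 := hcont continuousAt_heatKernel₂
  refine ⟨⟨fun y s => ?_, fun y s => ?_, fun y s => ?_, c0, continuous_const.mul c1,
    continuous_const.mul c2, continuous_const.mul (continuous_const.mul c2)⟩, fun m => ?_,
    fun m => ?_⟩
  · refine ((hasDerivAt_heatKernel _ _).scomp y (hz y)).congr_deriv ?_
    simp
  · refine (((hasDerivAt_heatKernel₁ _ _).scomp y (hz y)).const_mul (-c : ℂ)).congr_deriv ?_
    simp
    ring
  · have hw : HasDerivAt (fun s : ℝ => testTime ε (σ * c ^ 2) T s)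
        (Complex.I * (σ * c ^ 2 : ℝ)) s := by
      have h1 : HasDerivAt (fun s : ℝ => σ * c ^ 2 * (T - s)) (-(σ * c ^ 2)) s := by
        simpa using ((hasDerivAt_id s).const_sub T).const_mul (σ * c ^ 2)
      refine ((h1.ofReal_comp.const_mul Complex.I).const_sub (ε : ℂ)).congr_deriv ?_
      push_cast
      ring
    refine ((hasDerivAt_heatKernel_time (hmem s) (x - c * y)).comp s hw).congr_deriv ?_
    push_cast
    ring
  · obtain ⟨C, hC, hb⟩ := exists_norm_heatKernel_testTime_le hε (σ * c ^ 2) T x c hc m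
    refine ⟨C, hC, fun y s hs => le_trans ?_ (hb y s hs)⟩
    nlinarith [abs_nonneg (x - c * y),
      norm_nonneg (heatKernel (testTime ε (σ * c ^ 2) T s) (x - c * y))]
  · obtain ⟨C, hC, hb⟩ := exists_norm_heatKernel_testTime_le hε (σ * c ^ 2) T x c hc m
    refine ⟨|c| / (2 * ε) * C, by positivity, fun y s hs => ?_⟩
    have hεw : ε ≤ ‖testTime ε (σ * c ^ 2) T s‖ := by
      have := Complex.re_le_norm (testTime ε (σ * c ^ 2) T s)
      rwa [testTime_re] at this
    rw [heatKernel₁, mul_div_assoc]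
    simp only [norm_mul, norm_neg, norm_div, Complex.norm_real, Real.norm_eq_abs,
      Complex.norm_ofNat]
    calc |c| * (|x - c * y| / (2 * ‖testTime ε (σ * c ^ 2) T s‖) *
          ‖heatKernel (testTime ε (σ * c ^ 2) T s) (x - c * y)‖)
        ≤ |c| * ((1 + |x - c * y|) / (2 * ε) *
          ‖heatKernel (testTime ε (σ * c ^ 2) T s) (x - c * y)‖) := by
          gcongr
          linarith
      _ = |c| / (2 * ε) * ((1 + |x - c * y|) *
          ‖heatKernel (testTime ε (σ * c ^ 2) T s) (x - c * y)‖) := by ring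
      _ ≤ _ := by
          gcongr
          exact hb y s hs

lemma integrable_one_div_one_add_abs_pow {m : ℕ} (hm : 2 ≤ m) :
    Integrable fun y : ℝ => 1 / (1 + |y|) ^ m := by
  have h := integrable_one_add_norm (E := ℝ) (μ := volume) (r := m) (by
    simp only [Module.finrank_self, Nat.cast_one]
    exact_mod_cast hm)
  refine h.congr (ae_of_all _ fun y => ?_)
  simp only [Real.norm_eq_abs]
  rw [Real.rpow_neg (by positivity), Real.rpow_natCast, one_div]

/-- Polynomial growth in mean square bounds weighted `L²` and `L¹` norms, uniformly in time. -/
lemma HasTemperedGrowthOn.exists_bound {S : Set ℝ} {q : ℝ → ℝ → ℂ}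
    (hq : HasTemperedGrowthOn S q)
    (hm : ∀ t > 0, AEStronglyMeasurable (fun y => q y t) (volume.restrict S)) {T : ℝ} (hT : 0 < T) :
    ∃ m : ℕ, ∃ K ≥ 0, 2 ≤ m ∧ ∀ t ∈ Ioc 0 T,
      (IntegrableOn (fun y => ‖q y t‖ ^ 2 / (1 + |y|) ^ m) S ∧
        ∫ y in S, ‖q y t‖ ^ 2 / (1 + |y|) ^ m ≤ K) ∧
      (IntegrableOn (fun y => ‖q y t‖ / (1 + |y|) ^ m) S ∧
        ∫ y in S, ‖q y t‖ / (1 + |y|) ^ m ≤ K) := by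
  obtain ⟨m, C, hC⟩ := hq T hT
  have hI2 := (integrable_one_div_one_add_abs_pow (le_refl 2)).integrableOn (s := S)
  have hI20 : 0 ≤ ∫ y in S, 1 / (1 + |y|) ^ 2 := integral_nonneg fun y => by positivity
  refine ⟨m + 2, max C 0 + ∫ y in S, 1 / (1 + |y|) ^ 2, by positivity, by omega, fun t ht => ?_⟩
  have hmt := hm t ht.1
  have hwm : ∀ k : ℕ, AEStronglyMeasurable (fun y : ℝ => ((1 + |y|) ^ k)⁻¹) (volume.restrict S) :=
    fun k => by
      refine Continuous.aestronglyMeasurable (Continuous.inv₀ (by fun_prop) fun y => ?_)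
      positivity
  have m2 : ∀ k : ℕ, AEStronglyMeasurable (fun y => ‖q y t‖ ^ 2 / (1 + |y|) ^ k)
      (volume.restrict S) := fun k => by
    simp only [div_eq_mul_inv]
    exact (hmt.norm.pow 2).mul (hwm k)
  have m1 : AEStronglyMeasurable (fun y => ‖q y t‖ / (1 + |y|) ^ (m + 2))
      (volume.restrict S) := by
    simp only [div_eq_mul_inv]
    exact hmt.norm.mul (hwm (m + 2))
  have n2 : 0 ≤ᵐ[volume.restrict S] fun y => ‖q y t‖ ^ 2 / (1 + |y|) ^ m :=
    ae_of_all _ fun y => by simp only [Pi.zero_apply]; positivity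
  have hG : IntegrableOn (fun y => ‖q y t‖ ^ 2 / (1 + |y|) ^ m) S := by
    refine ⟨m2 m, ?_⟩
    rw [hasFiniteIntegral_iff_ofReal n2]
    exact (hC t ht).trans_lt ENNReal.ofReal_lt_top
  have hGle : ∫ y in S, ‖q y t‖ ^ 2 / (1 + |y|) ^ m ≤ max C 0 := by
    rw [integral_eq_lintegral_of_nonneg_ae n2 (m2 m)]
    refine ENNReal.toReal_le_of_le_ofReal (le_max_right _ _) ((hC t ht).trans ?_)
    exact ENNReal.ofReal_le_ofReal (le_max_left _ _)
  have hsum := hG.add hI2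
  have hone : ∀ y : ℝ, 1 ≤ 1 + |y| := fun y => by linarith [abs_nonneg y]
  have b2 : ∀ y, ‖q y t‖ ^ 2 / (1 + |y|) ^ (m + 2) ≤
      ‖q y t‖ ^ 2 / (1 + |y|) ^ m + 1 / (1 + |y|) ^ 2 := fun y => by
    have : ‖q y t‖ ^ 2 / (1 + |y|) ^ (m + 2) ≤ ‖q y t‖ ^ 2 / (1 + |y|) ^ m := by
      gcongr
      · exact hone y
      · omega
    have : 0 ≤ 1 / (1 + |y|) ^ 2 := by positivity
    linarith
  have b1 : ∀ y, ‖q y t‖ / (1 + |y|) ^ (m + 2) ≤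
      ‖q y t‖ ^ 2 / (1 + |y|) ^ m + 1 / (1 + |y|) ^ 2 := fun y => by
    have h1 : ‖q y t‖ ^ 2 / (1 + |y|) ^ (m + 2) ≤ ‖q y t‖ ^ 2 / (1 + |y|) ^ m := by
      gcongr
      · exact hone y
      · omega
    have h2 : 1 / (1 + |y|) ^ (m + 2) ≤ 1 / (1 + |y|) ^ 2 := by
      gcongr
      · exact hone y
      · omega
    have h3 : ‖q y t‖ / (1 + |y|) ^ (m + 2) ≤ (‖q y t‖ ^ 2 + 1) / (1 + |y|) ^ (m + 2) := by
      gcongr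
      nlinarith [sq_nonneg (‖q y t‖ - 1)]
    rw [add_div] at h3
    linarith
  have key : ∀ g : ℝ → ℝ, AEStronglyMeasurable g (volume.restrict S) → (∀ y, 0 ≤ g y) →
      (∀ y, g y ≤ ‖q y t‖ ^ 2 / (1 + |y|) ^ m + 1 / (1 + |y|) ^ 2) →
      IntegrableOn g S ∧ ∫ y in S, g y ≤ max C 0 + ∫ y in S, 1 / (1 + |y|) ^ 2 := by
    intro g hg h0 hle
    have hi : IntegrableOn g S := hsum.mono' hg (ae_of_all _ fun y => by
      rw [Real.norm_of_nonneg (h0 y)]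
      exact hle y)
    refine ⟨hi, (integral_mono hi hsum hle).trans ?_⟩
    have := integral_add hG hI2
    simp only [Pi.add_apply]
    rw [this]
    linarith
  exact ⟨key _ (m2 (m + 2)) (fun y => by positivity) b2, key _ m1 (fun y => by positivity) b1⟩

/-! ### Pairing a solution with a test flow on a half-line -/

/-- A polynomial cut-off on `[-R, R]` that vanishes with its derivative at `±R`. -/
def cutoff (R y : ℝ) : ℝ := (1 - (y / R) ^ 2) ^ 2

/-- The derivative of `cutoff R`. -/
def cutoff₁ (R y : ℝ) : ℝ := -(4 * (y / R) / R) * (1 - (y / R) ^ 2)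

/-- The second derivative of `cutoff R`. -/
def cutoff₂ (R y : ℝ) : ℝ := -(4 / R ^ 2) * (1 - 3 * (y / R) ^ 2)

lemma hasDerivAt_cutoff (R y : ℝ) : HasDerivAt (cutoff R) (cutoff₁ R y) y := by
  have h1 : HasDerivAt (fun y => y / R) (1 / R) y := (hasDerivAt_id y).div_const R
  refine (((h1.fun_pow 2).const_sub 1).fun_pow 2).congr_deriv ?_
  rw [cutoff₁]
  ring

lemma hasDerivAt_cutoff₁ (R y : ℝ) : HasDerivAt (cutoff₁ R) (cutoff₂ R y) y := by
  have h1 : HasDerivAt (fun y => y / R) (1 / R) y := (hasDerivAt_id y).div_const R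
  refine ((((h1.const_mul 4).div_const R).fun_neg).mul ((h1.fun_pow 2).const_sub 1)).congr_deriv ?_
  rw [cutoff₂]
  ring

lemma abs_div_le_one_of_mem {R y : ℝ} (hy : y ∈ Ioo (-R) R) : |y / R| ≤ 1 := by
  have hR : 0 < R := by linarith [hy.1, hy.2]
  rw [abs_div, abs_of_pos hR, div_le_one hR]
  exact (abs_lt.2 hy).le

lemma abs_cutoff_le {R y : ℝ} (hy : y ∈ Ioo (-R) R) : |cutoff R y| ≤ 1 := by
  have h := (sq_le_one_iff_abs_le_one _).2 (abs_div_le_one_of_mem hy)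
  rw [cutoff, abs_of_nonneg (sq_nonneg _)]
  nlinarith [sq_nonneg (y / R)]

lemma abs_cutoff₁_le {R y : ℝ} (hy : y ∈ Ioo (-R) R) : |cutoff₁ R y| ≤ 8 / R := by
  have hR : 0 < R := by linarith [hy.1, hy.2]
  have h1 := abs_div_le_one_of_mem hy
  have h := (sq_le_one_iff_abs_le_one _).2 h1
  rw [cutoff₁, abs_mul, abs_neg, abs_div, abs_mul, abs_of_pos hR]
  have h2 : |1 - (y / R) ^ 2| ≤ 1 := abs_le.2 ⟨by linarith, by nlinarith [sq_nonneg (y / R)]⟩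
  calc |4| * |y / R| / R * |1 - (y / R) ^ 2| ≤ |4| * 1 / R * 1 := by gcongr
    _ ≤ 8 / R := by
      rw [mul_one, mul_one]
      gcongr
      norm_num

lemma abs_cutoff₂_le {R y : ℝ} (hR : 1 ≤ R) (hy : y ∈ Ioo (-R) R) : |cutoff₂ R y| ≤ 8 / R := by
  have h := (sq_le_one_iff_abs_le_one _).2 (abs_div_le_one_of_mem hy)
  rw [cutoff₂, abs_mul, abs_neg, abs_of_pos (by positivity)]
  have h2 : |1 - 3 * (y / R) ^ 2| ≤ 2 :=
    abs_le.2 ⟨by linarith, by nlinarith [sq_nonneg (y / R)]⟩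
  calc 4 / R ^ 2 * |1 - 3 * (y / R) ^ 2| ≤ 4 / R * 2 := by
        gcongr
        nlinarith
    _ = 8 / R := by ring

lemma tendsto_cutoff (y : ℝ) : Tendsto (fun R => cutoff R y) atTop (𝓝 1) := by
  have h : Tendsto (fun R : ℝ => y / R) atTop (𝓝 0) := tendsto_const_nhds.div_atTop tendsto_id
  simpa [cutoff] using ((h.pow 2).const_sub 1).pow 2

lemma IsTestFlow.cutoff {σ T : ℝ} {ψ ψ₁ ψ₂ : ℝ → ℝ → ℂ} (h : IsTestFlow σ T ψ ψ₁ ψ₂) (R : ℝ) :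
    IsTestFunction (fun y s => ψ y s * cutoff R y)
      (fun y s => ψ₁ y s * cutoff R y + ψ y s * cutoff₁ R y)
      (fun y s => (ψ₂ y s * cutoff R y + ψ₁ y s * cutoff₁ R y) +
        (ψ₁ y s * cutoff₁ R y + ψ y s * cutoff₂ R y))
      (fun y s => Complex.I * σ * ψ₂ y s * cutoff R y) := by
  have c := h.continuous
  have c₁ := h.continuous₁
  have c₂ := h.continuous₂
  have k : Continuous fun p : ℝ × ℝ => (LSInterface.cutoff R p.1 : ℂ) := by
    unfold LSInterface.cutoff; fun_prop
  have k₁ : Continuous fun p : ℝ × ℝ => (cutoff₁ R p.1 : ℂ) := by unfold cutoff₁; fun_prop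
  have k₂ : Continuous fun p : ℝ × ℝ => (cutoff₂ R p.1 : ℂ) := by unfold cutoff₂; fun_prop
  exact
  { hasDerivAt_x := fun y s => (h.hasDerivAt_x y s).mul (hasDerivAt_cutoff R y).ofReal_comp
    hasDerivAt_xx := fun y s =>
      ((h.hasDerivAt_xx y s).mul (hasDerivAt_cutoff R y).ofReal_comp).add
        ((h.hasDerivAt_x y s).mul (hasDerivAt_cutoff₁ R y).ofReal_comp)
    hasDerivAt_t := fun y s => (h.hasDerivAt_t y s).mul_const _
    continuous := c.mul k
    continuous₁ := (c₁.mul k).add (c.mul k₁)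
    continuous₂ := ((c₂.mul k).add (c₁.mul k₁)).add ((c₁.mul k₁).add (c.mul k₂))
    continuousₜ := (continuous_const.mul c₂).mul k }

/-- `S` is one of the two open half-lines, and `e` is the sign of its points. -/
def IsHalfLine (S : Set ℝ) (e : ℝ) : Prop := (S = Ioi 0 ∧ e = 1) ∨ (S = Iio 0 ∧ e = -1)

lemma IsHalfLine.isOpen {S : Set ℝ} {e : ℝ} (h : IsHalfLine S e) : IsOpen S := by
  rcases h with ⟨rfl, -⟩ | ⟨rfl, -⟩
  · exact isOpen_Ioi
  · exact isOpen_Iio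

lemma IsClassicalSolutionOn.aestronglyMeasurable {S : Set ℝ} {σ : ℝ} {q : ℝ → ℝ → ℂ}
    (hS : IsOpen S) (hq : IsClassicalSolutionOn S σ q) {t : ℝ} (ht : 0 < t) :
    AEStronglyMeasurable (fun y => q y t) (volume.restrict S) :=
  (continuousOn_slice_left hq.continuous_q ht).aestronglyMeasurable hS.measurableSet

/-- Green's identity on a half-line with the cut-off in place: only the interface contributes
boundary terms. -/
lemma green_cutoff {S : Set ℝ} {e σ T : ℝ} (hSe : IsHalfLine S e) {q ψ ψ₁ ψ₂ F F₁ : ℝ → ℝ → ℂ}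
    (hq : IsClassicalSolutionOn S σ q) (hψ : IsTestFlow σ T ψ ψ₁ ψ₂)
    (hF : ContinuousOn (Function.uncurry F) (insert 0 S ×ˢ Ioi 0))
    (hF₁ : ContinuousOn (Function.uncurry F₁) (insert 0 S ×ˢ Ioi 0))
    (hqF : ∀ y ∈ S, ∀ s > 0, q y s = F y s) (hqF₁ : ∀ y ∈ S, ∀ s > 0, dx q y s = F₁ y s)
    {s₁ s₂ R : ℝ} (hs₁ : 0 < s₁) (hs : s₁ ≤ s₂) (hR : 0 < R) :
    (∫ y in S ∩ Ioo (-R) R, q y s₂ * (ψ y s₂ * cutoff R y)) -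
      (∫ y in S ∩ Ioo (-R) R, q y s₁ * (ψ y s₁ * cutoff R y)) =
    ∫ s in s₁..s₂, (e * (Complex.I * σ * (F₁ 0 s * ψ 0 s - F 0 s * ψ₁ 0 s)) +
      ∫ y in S ∩ Ioo (-R) R,
        q y s * (-Complex.I * σ * (2 * ψ₁ y s * cutoff₁ R y + ψ y s * cutoff₂ R y))) := by
  have k0 : cutoff R 0 = 1 := by simp [cutoff]
  have k0' : cutoff₁ R 0 = 0 := by simp [cutoff₁]
  have kR : cutoff R R = 0 := by simp [cutoff, hR.ne']
  have kR' : cutoff₁ R R = 0 := by simp [cutoff₁, hR.ne']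
  have kn : cutoff R (-R) = 0 := by simp [cutoff, hR.ne']
  have kn' : cutoff₁ R (-R) = 0 := by simp [cutoff₁, hR.ne', neg_div]
  -- both half-lines are handled through the interval `[A, B]`
  obtain ⟨A, B, hAB, hSR, hsub, hbd⟩ : ∃ A B : ℝ, A < B ∧ S ∩ Ioo (-R) R = Ioo A B ∧
      Icc A B ⊆ insert 0 S ∧
      ∀ s, -Complex.I * σ * ((F₁ B s * (ψ B s * cutoff R B) -
          F B s * (ψ₁ B s * cutoff R B + ψ B s * cutoff₁ R B)) -
        (F₁ A s * (ψ A s * cutoff R A) -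
          F A s * (ψ₁ A s * cutoff R A + ψ A s * cutoff₁ R A))) =
        e * (Complex.I * σ * (F₁ 0 s * ψ 0 s - F 0 s * ψ₁ 0 s)) := by
    rcases hSe with ⟨rfl, rfl⟩ | ⟨rfl, rfl⟩
    · refine ⟨0, R, hR, ?_, ?_, fun s => ?_⟩
      · ext y; simp only [mem_inter_iff, mem_Ioi, mem_Ioo]
        exact ⟨fun h => ⟨h.1, h.2.2⟩, fun h => ⟨h.1, by linarith [h.1], h.2⟩⟩
      · intro y hy
        rcases hy.1.eq_or_lt with h | h
        · exact Or.inl h.symm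
        · exact Or.inr h
      · simp only [k0, k0', kR, kR']
        push_cast
        ring
    · refine ⟨-R, 0, by linarith, ?_, ?_, fun s => ?_⟩
      · ext y; simp only [mem_inter_iff, mem_Iio, mem_Ioo]
        exact ⟨fun h => ⟨h.2.1, h.1⟩, fun h => ⟨h.2, h.1, by linarith [h.2]⟩⟩
      · intro y hy
        rcases hy.2.eq_or_lt with h | h
        · exact Or.inl h
        · exact Or.inr h
      · simp only [k0, k0', kn, kn']
        push_cast
        ring
  have hSab : Ioo A B ⊆ S := hSR ▸ inter_subset_left
  have hg := green_closed hq (hψ.cutoff R) hAB hSab hs₁ hs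
    (hF.mono (prod_mono hsub subset_rfl)) (hF₁.mono (prod_mono hsub subset_rfl))
    (fun y hy => hqF y (hSab hy)) (fun y hy => hqF₁ y (hSab hy))
  have conv : ∀ s > 0, ∀ G : ℝ → ℂ, (∫ y in A..B, F y s * G y) =
      ∫ y in S ∩ Ioo (-R) R, q y s * G y := fun s hs G => by
    rw [intervalIntegral.integral_of_le hAB.le, integral_Ioc_eq_integral_Ioo, hSR]
    exact setIntegral_congr_fun measurableSet_Ioo fun y hy => by
      simp only [hqF y (hSab hy) s hs]
  rw [conv s₂ (hs₁.trans_le hs), conv s₁ hs₁] at hg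
  rw [hg]
  refine intervalIntegral.integral_congr fun s hs' => ?_
  rw [uIcc_of_le hs] at hs'
  rw [hbd s, conv s (hs₁.trans_le hs'.1)]
  congr 2
  ext y
  ring

lemma integrableOn_mul_testFlow {S : Set ℝ} {σ T : ℝ} (hS : IsOpen S) {q ψ ψ₁ ψ₂ : ℝ → ℝ → ℂ}
    (hq : IsClassicalSolutionOn S σ q) (hg : HasTemperedGrowthOn S q)
    (hψ : IsTestFlow σ T ψ ψ₁ ψ₂) {s : ℝ} (hs : s ∈ Ioc 0 T) :
    IntegrableOn (fun y => q y s * ψ y s) S := by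
  obtain ⟨m, K, -, -, hb⟩ := hg.exists_bound
    (fun t ht => hq.aestronglyMeasurable hS ht) (hs.1.trans_le hs.2)
  obtain ⟨C, -, hC⟩ := hψ.decay m
  have cψ : Continuous fun y => ψ y s := by
    have := hψ.continuous
    exact this.comp (by fun_prop : Continuous fun y : ℝ => (y, s))
  refine ((hb s hs).2.1.const_mul C).mono'
    ((hq.aestronglyMeasurable hS hs.1).mul cψ.aestronglyMeasurable) (ae_of_all _ fun y => ?_)
  rw [norm_mul]
  calc ‖q y s‖ * ‖ψ y s‖ ≤ ‖q y s‖ * (C / (1 + |y|) ^ m) := by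
        gcongr
        exact hC y s ⟨hs.1.le, hs.2⟩
    _ = _ := by ring

/-- The error caused by the cut-off is of order `1 / R`, uniformly in time. -/
lemma exists_norm_cutoff_error_le {S : Set ℝ} {σ T : ℝ} (hS : IsOpen S) {q ψ ψ₁ ψ₂ : ℝ → ℝ → ℂ}
    (hT : 0 < T) (hq : IsClassicalSolutionOn S σ q) (hg : HasTemperedGrowthOn S q)
    (hψ : IsTestFlow σ T ψ ψ₁ ψ₂) :
    ∃ M, ∀ s ∈ Ioc 0 T, ∀ R ≥ 1, ‖∫ y in S ∩ Ioo (-R) R,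
      q y s * (-Complex.I * σ * (2 * ψ₁ y s * cutoff₁ R y + ψ y s * cutoff₂ R y))‖ ≤ M / R := by
  obtain ⟨m, K, hK, -, hb⟩ := hg.exists_bound (fun t ht => hq.aestronglyMeasurable hS ht) hT
  obtain ⟨C, hC0, hC⟩ := hψ.decay m
  obtain ⟨C₁, hC₁0, hC₁⟩ := hψ.decay₁ m
  refine ⟨|σ| * (16 * C₁ + 8 * C) * K, fun s hs R hR => ?_⟩
  have hR0 : 0 < R := by linarith
  have hi := (hb s hs).2.1
  have hsub : S ∩ Ioo (-R) R ⊆ S := inter_subset_left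
  calc _ ≤ ∫ y in S ∩ Ioo (-R) R,
          |σ| * (16 * C₁ + 8 * C) / R * (‖q y s‖ / (1 + |y|) ^ m) := by
        refine norm_integral_le_of_norm_le ((hi.mono_set hsub).const_mul _) ?_
        refine ae_restrict_of_forall_mem (hS.measurableSet.inter measurableSet_Ioo) fun y hy => ?_
        have e1 : ‖2 * ψ₁ y s * (cutoff₁ R y : ℂ) + ψ y s * (cutoff₂ R y : ℂ)‖ ≤
            2 * (C₁ / (1 + |y|) ^ m) * (8 / R) + C / (1 + |y|) ^ m * (8 / R) := by
          refine (norm_add_le _ _).trans ?_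
          simp only [norm_mul, Complex.norm_ofNat, Complex.norm_real, Real.norm_eq_abs]
          have h1 := hC₁ y s ⟨hs.1.le, hs.2⟩
          have h2 := hC y s ⟨hs.1.le, hs.2⟩
          have h3 := abs_cutoff₁_le hy.2
          have h4 := abs_cutoff₂_le hR hy.2
          gcongr
        simp only [norm_mul, norm_neg, Complex.norm_I, one_mul, Complex.norm_real,
          Real.norm_eq_abs] at e1 ⊢
        calc _ ≤ ‖q y s‖ * (|σ| * (2 * (C₁ / (1 + |y|) ^ m) * (8 / R) +
              C / (1 + |y|) ^ m * (8 / R))) := by gcongr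
          _ = _ := by ring
    _ ≤ ∫ y in S, |σ| * (16 * C₁ + 8 * C) / R * (‖q y s‖ / (1 + |y|) ^ m) := by
        refine setIntegral_mono_set (hi.const_mul _) (ae_of_all _ fun y => ?_)
          hsub.eventuallyLE
        simp only [Pi.zero_apply]
        positivity
    _ = |σ| * (16 * C₁ + 8 * C) / R * ∫ y in S, ‖q y s‖ / (1 + |y|) ^ m := integral_const_mul _ _
    _ ≤ |σ| * (16 * C₁ + 8 * C) / R * K := by
        gcongr
        exact (hb s hs).2.2
    _ = _ := by ring

/-- Green's identity on a half-line: the pairing of a solution with a test flow changes only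
through the interface. -/
lemma green_halfLine {S : Set ℝ} {e σ T : ℝ} (hSe : IsHalfLine S e) {q ψ ψ₁ ψ₂ F F₁ : ℝ → ℝ → ℂ}
    (hq : IsClassicalSolutionOn S σ q) (hg : HasTemperedGrowthOn S q)
    (hψ : IsTestFlow σ T ψ ψ₁ ψ₂)
    (hF : ContinuousOn (Function.uncurry F) (insert 0 S ×ˢ Ioi 0))
    (hF₁ : ContinuousOn (Function.uncurry F₁) (insert 0 S ×ˢ Ioi 0))
    (hqF : ∀ y ∈ S, ∀ s > 0, q y s = F y s) (hqF₁ : ∀ y ∈ S, ∀ s > 0, dx q y s = F₁ y s)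
    {s₁ s₂ : ℝ} (hs₁ : 0 < s₁) (hs : s₁ ≤ s₂) (hs₂ : s₂ ≤ T) :
    (∫ y in S, q y s₂ * ψ y s₂) - (∫ y in S, q y s₁ * ψ y s₁) =
    ∫ s in s₁..s₂, e * (Complex.I * σ * (F₁ 0 s * ψ 0 s - F 0 s * ψ₁ 0 s)) := by
  have hS := hSe.isOpen
  have hT : 0 < T := hs₁.trans_le (hs.trans hs₂)
  obtain ⟨M, hM⟩ := exists_norm_cutoff_error_le hS hT hq hg hψ
  have mem : ∀ s ∈ Icc s₁ s₂, s ∈ Ioc 0 T := fun s h => ⟨hs₁.trans_le h.1, h.2.trans hs₂⟩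
  -- the pairing with the cut-off tends to the pairing without
  have lim : ∀ s ∈ Icc s₁ s₂, Tendsto (fun R => ∫ y in S ∩ Ioo (-R) R,
      q y s * (ψ y s * cutoff R y)) atTop (𝓝 (∫ y in S, q y s * ψ y s)) := by
    intro s hs'
    have hi := integrableOn_mul_testFlow hS hq hg hψ (mem s hs')
    have e1 : ∀ R, (∫ y in S ∩ Ioo (-R) R, q y s * (ψ y s * cutoff R y)) =
        ∫ y in S, (Ioo (-R) R).indicator (fun y => q y s * ψ y s * cutoff R y) y := fun R => by
      rw [setIntegral_indicator measurableSet_Ioo]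
      simp only [mul_assoc]
    simp only [e1]
    refine tendsto_integral_filter_of_dominated_convergence (fun y => ‖q y s * ψ y s‖)
      (Eventually.of_forall fun R => ?_) (Eventually.of_forall fun R => ae_of_all _ fun y => ?_)
      hi.norm (ae_of_all _ fun y => ?_)
    · refine AEStronglyMeasurable.indicator ?_ measurableSet_Ioo
      refine hi.aestronglyMeasurable.mul (Continuous.aestronglyMeasurable ?_)
      unfold LSInterface.cutoff
      fun_prop
    · by_cases hy : y ∈ Ioo (-R) R
      · rw [indicator_of_mem hy, norm_mul]
        refine mul_le_of_le_one_right (norm_nonneg _) ?_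
        rw [Complex.norm_real]
        exact abs_cutoff_le hy
      · rw [indicator_of_notMem hy, norm_zero]
        exact norm_nonneg _
    · have h1 : Tendsto (fun R => q y s * ψ y s * (cutoff R y : ℂ)) atTop
          (𝓝 (q y s * ψ y s * ((1 : ℝ) : ℂ))) :=
        ((Complex.continuous_ofReal.tendsto 1).comp (tendsto_cutoff y)).const_mul _
      rw [Complex.ofReal_one, mul_one] at h1
      refine h1.congr' ?_
      filter_upwards [eventually_gt_atTop |y|] with R hR
      rw [indicator_of_mem (show y ∈ Ioo (-R) R from abs_lt.1 hR)]
  have limd := (lim s₂ (right_mem_Icc.2 hs)).sub (lim s₁ (left_mem_Icc.2 hs))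
  set B : ℝ → ℂ := fun s => e * (Complex.I * σ * (F₁ 0 s * ψ 0 s - F 0 s * ψ₁ 0 s)) with hB
  have hBi : IntervalIntegrable B volume s₁ s₂ := by
    refine ContinuousOn.intervalIntegrable ?_
    rw [uIcc_of_le hs]
    have hsub : Icc s₁ s₂ ⊆ Ioi 0 := fun s h => hs₁.trans_le h.1
    have h1 := (continuousOn_slice_right hF (mem_insert 0 S)).mono hsub
    have h2 := (continuousOn_slice_right hF₁ (mem_insert 0 S)).mono hsub
    have h3 : Continuous fun s => ψ 0 s :=
      hψ.continuous.comp (by fun_prop : Continuous fun s : ℝ => ((0 : ℝ), s))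
    have h4 : Continuous fun s => ψ₁ 0 s :=
      hψ.continuous₁.comp (by fun_prop : Continuous fun s : ℝ => ((0 : ℝ), s))
    exact continuousOn_const.mul (continuousOn_const.mul
      ((h2.mul h3.continuousOn).sub (h1.mul h4.continuousOn)))
  refine tendsto_nhds_unique limd ?_
  rw [tendsto_iff_norm_sub_tendsto_zero]
  refine squeeze_zero' (g := fun R => M / R * |s₂ - s₁|) (Eventually.of_forall fun R =>
    norm_nonneg _) ?_ ?_
  · filter_upwards [eventually_ge_atTop 1] with R hR
    rw [green_cutoff hSe hq hψ hF hF₁ hqF hqF₁ hs₁ hs (by linarith)]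
    set E : ℝ → ℂ := fun s => ∫ y in S ∩ Ioo (-R) R,
      q y s * (-Complex.I * σ * (2 * ψ₁ y s * cutoff₁ R y + ψ y s * cutoff₂ R y)) with hE
    have hEb : ∀ s ∈ uIoc s₁ s₂, ‖E s‖ ≤ M / R := fun s hs' => by
      rw [uIoc_of_le hs] at hs'
      exact hM s (mem s (Ioc_subset_Icc_self hs')) R hR
    have hEi : IntervalIntegrable E volume s₁ s₂ := by
      refine (intervalIntegrable_const (c := M / R)).mono_fun' ?_
        (ae_restrict_of_forall_mem measurableSet_uIoc hEb)
      refine AEStronglyMeasurable.integral_prod_right' (f := fun p : ℝ × ℝ => q p.2 p.1 *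
        (-Complex.I * σ * (2 * ψ₁ p.2 p.1 * cutoff₁ R p.2 + ψ p.2 p.1 * cutoff₂ R p.2))) ?_
      rw [Measure.prod_restrict]
      refine ContinuousOn.aestronglyMeasurable ?_
        (measurableSet_uIoc.prod (hS.measurableSet.inter measurableSet_Ioo))
      refine ContinuousOn.mul ?_ (Continuous.continuousOn ?_)
      · refine hq.continuous_q.comp continuous_swap.continuousOn ?_
        rintro ⟨s, y⟩ ⟨h1, h2⟩
        rw [uIoc_of_le hs] at h1
        exact ⟨h2.1, hs₁.trans h1.1⟩
      · have c := hψ.continuous.comp continuous_swap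
        have c₁ := hψ.continuous₁.comp continuous_swap
        have k₁ : Continuous fun p : ℝ × ℝ => (cutoff₁ R p.2 : ℂ) := by unfold cutoff₁; fun_prop
        have k₂ : Continuous fun p : ℝ × ℝ => (cutoff₂ R p.2 : ℂ) := by unfold cutoff₂; fun_prop
        exact continuous_const.mul (((continuous_const.mul c₁).mul k₁).add (c.mul k₂))
    rw [intervalIntegral.integral_add hBi hEi, add_sub_cancel_left]
    exact intervalIntegral.norm_integral_le_of_norm_le_const hEb
  · have : Tendsto (fun R : ℝ => M / R) atTop (𝓝 0) := tendsto_const_nhds.div_atTop tendsto_id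
    simpa using this.mul_const |s₂ - s₁|

/-! ### Duality between solutions and test flows -/

/-- A bounded substitute for `z`, converging to `z` as `δ → 0`. -/
def truncate (δ : ℝ) (z : ℂ) : ℂ := z / (1 + δ * ‖z‖ : ℝ)

lemma continuous_truncate {δ : ℝ} (hδ : 0 ≤ δ) : Continuous (truncate δ) := by
  refine Continuous.div (by fun_prop) (by fun_prop) fun z => ?_
  have : 0 < 1 + δ * ‖z‖ := by positivity
  exact_mod_cast this.ne'

lemma norm_truncate {δ : ℝ} (hδ : 0 ≤ δ) (z : ℂ) : ‖truncate δ z‖ = ‖z‖ / (1 + δ * ‖z‖) := by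
  rw [truncate, norm_div, Complex.norm_real, Real.norm_of_nonneg (by positivity)]

lemma norm_truncate_le_self {δ : ℝ} (hδ : 0 ≤ δ) (z : ℂ) : ‖truncate δ z‖ ≤ ‖z‖ := by
  rw [norm_truncate hδ]
  exact div_le_self (norm_nonneg z) (by nlinarith [norm_nonneg z])

lemma norm_truncate_le {δ : ℝ} (hδ : 0 < δ) (z : ℂ) : ‖truncate δ z‖ ≤ 1 / δ := by
  rw [norm_truncate hδ.le, div_le_div_iff₀ (by positivity) hδ]
  nlinarith [norm_nonneg z]

lemma norm_sub_truncate_le {δ : ℝ} (hδ : 0 ≤ δ) (z : ℂ) : ‖z - truncate δ z‖ ≤ δ * ‖z‖ ^ 2 := by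
  have hp : 0 < 1 + δ * ‖z‖ := by positivity
  have hp' : ((1 + δ * ‖z‖ : ℝ) : ℂ) ≠ 0 := by exact_mod_cast hp.ne'
  have e : z - truncate δ z = z * (δ * ‖z‖ : ℝ) / (1 + δ * ‖z‖ : ℝ) := by
    rw [truncate]
    field_simp
    push_cast
    ring
  rw [e, norm_div, norm_mul, Complex.norm_real, Complex.norm_real, Real.norm_of_nonneg hp.le,
    Real.norm_of_nonneg (by positivity)]
  calc ‖z‖ * (δ * ‖z‖) / (1 + δ * ‖z‖) ≤ ‖z‖ * (δ * ‖z‖) / 1 := by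
        gcongr
        nlinarith [norm_nonneg z]
    _ = δ * ‖z‖ ^ 2 := by ring

lemma tendsto_truncate (z : ℂ) : Tendsto (fun δ => truncate δ z) (𝓝[>] 0) (𝓝 z) := by
  rw [tendsto_iff_norm_sub_tendsto_zero]
  refine squeeze_zero' (g := fun δ => δ * ‖z‖ ^ 2)
    (Eventually.of_forall fun δ => norm_nonneg _) ?_ ?_
  · filter_upwards [self_mem_nhdsWithin] with δ hδ
    rw [norm_sub_rev]
    exact norm_sub_truncate_le (le_of_lt hδ) z
  · have : Tendsto (fun δ : ℝ => δ) (𝓝[>] 0) (𝓝 0) := tendsto_nhdsWithin_of_tendsto_nhds tendsto_id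
    simpa using this.mul_const (‖z‖ ^ 2)

/-- The pairing with a test flow is continuous down to time zero, although the initial values are
only taken pointwise: the weighted `L²` bound makes the family uniformly integrable. -/
lemma tendsto_pairing_initial {S : Set ℝ} {σ T : ℝ} (hS : IsOpen S) {q ψ ψ₁ ψ₂ : ℝ → ℝ → ℂ}
    {q0 : ℝ → ℂ} (hT : 0 < T) (hq : IsClassicalSolutionOn S σ q) (hg : HasTemperedGrowthOn S q)
    (hψ : IsTestFlow σ T ψ ψ₁ ψ₂) (hq0 : ∀ y ∈ S, Tendsto (fun s => q y s) (𝓝[>] 0) (𝓝 (q0 y)))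
    (hi0 : IntegrableOn (fun y => q0 y * ψ y 0) S)
    (hm0 : AEStronglyMeasurable q0 (volume.restrict S)) :
    Tendsto (fun s => ∫ y in S, q y s * ψ y s) (𝓝[>] 0) (𝓝 (∫ y in S, q0 y * ψ y 0)) := by
  have hm : ∀ t > 0, AEStronglyMeasurable (fun y => q y t) (volume.restrict S) :=
    fun t ht => hq.aestronglyMeasurable hS ht
  obtain ⟨m, K, hK, hm2, hb⟩ := hg.exists_bound hm hT
  obtain ⟨C, hC0, hC⟩ := hψ.decay m
  have hmem : Ioc 0 T ∈ 𝓝[>] (0 : ℝ) := Ioc_mem_nhdsGT hT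
  have cψ : ∀ s, Continuous fun y => ψ y s := fun s =>
    hψ.continuous.comp (by fun_prop : Continuous fun y : ℝ => (y, s))
  have hw := (integrable_one_div_one_add_abs_pow hm2).integrableOn (s := S)
  -- the truncated pairing converges by dominated convergence
  have h1 : ∀ δ > 0, Tendsto (fun s => ∫ y in S, truncate δ (q y s) * ψ y s) (𝓝[>] 0)
      (𝓝 (∫ y in S, truncate δ (q0 y) * ψ y 0)) := by
    intro δ hδ
    refine tendsto_integral_filter_of_dominated_convergence
      (fun y => 1 / δ * C * (1 / (1 + |y|) ^ m)) ?_ ?_ (hw.const_mul _) ?_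
    · filter_upwards [hmem] with s hs
      exact ((continuous_truncate hδ.le).comp_aestronglyMeasurable (hm s hs.1)).mul
        (cψ s).aestronglyMeasurable
    · filter_upwards [hmem] with s hs
      refine ae_of_all _ fun y => ?_
      rw [norm_mul]
      calc ‖truncate δ (q y s)‖ * ‖ψ y s‖ ≤ 1 / δ * (C / (1 + |y|) ^ m) := by
            gcongr
            · exact norm_truncate_le hδ _
            · exact hC y s ⟨hs.1.le, hs.2⟩
        _ = _ := by ring
    · refine ae_restrict_of_forall_mem hS.measurableSet fun y hy => ?_
      refine (((continuous_truncate hδ.le).tendsto _).comp (hq0 y hy)).mul ?_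
      have : Continuous fun s => ψ y s :=
        hψ.continuous.comp (by fun_prop : Continuous fun s : ℝ => (y, s))
      exact tendsto_nhdsWithin_of_tendsto_nhds (this.tendsto 0)
  have h2 : Tendsto (fun δ => ∫ y in S, truncate δ (q0 y) * ψ y 0) (𝓝[>] 0)
      (𝓝 (∫ y in S, q0 y * ψ y 0)) := by
    refine tendsto_integral_filter_of_dominated_convergence (fun y => ‖q0 y * ψ y 0‖) ?_ ?_
      hi0.norm (ae_of_all _ fun y => (tendsto_truncate (q0 y)).mul_const _)
    · filter_upwards [self_mem_nhdsWithin] with δ hδ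
      exact ((continuous_truncate (le_of_lt hδ)).comp_aestronglyMeasurable hm0).mul
        (cψ 0).aestronglyMeasurable
    · filter_upwards [self_mem_nhdsWithin] with δ hδ
      refine ae_of_all _ fun y => ?_
      rw [norm_mul, norm_mul]
      gcongr
      exact norm_truncate_le_self (le_of_lt hδ) _
  -- the truncation error is uniformly small
  have h3 : ∀ δ > 0, ∀ s ∈ Ioc 0 T,
      ‖(∫ y in S, q y s * ψ y s) - ∫ y in S, truncate δ (q y s) * ψ y s‖ ≤ δ * (C * K) := by
    intro δ hδ s hs
    have i1 := integrableOn_mul_testFlow hS hq hg hψ hs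
    have i2 : IntegrableOn (fun y => truncate δ (q y s) * ψ y s) S := by
      refine Integrable.mono i1
        (((continuous_truncate hδ.le).comp_aestronglyMeasurable (hm s hs.1)).mul
        (cψ s).aestronglyMeasurable) (ae_of_all _ fun y => ?_)
      rw [norm_mul, norm_mul]
      gcongr
      exact norm_truncate_le_self hδ.le _
    rw [← integral_sub i1 i2]
    calc _ ≤ ∫ y in S, δ * C * (‖q y s‖ ^ 2 / (1 + |y|) ^ m) := by
          refine norm_integral_le_of_norm_le ((hb s hs).1.1.const_mul _) (ae_of_all _ fun y => ?_)
          rw [← sub_mul, norm_mul]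
          calc _ ≤ δ * ‖q y s‖ ^ 2 * (C / (1 + |y|) ^ m) := by
                gcongr
                · exact norm_sub_truncate_le hδ.le _
                · exact hC y s ⟨hs.1.le, hs.2⟩
            _ = _ := by ring
      _ = δ * C * ∫ y in S, ‖q y s‖ ^ 2 / (1 + |y|) ^ m := integral_const_mul _ _
      _ ≤ δ * C * K := by
          gcongr
          exact (hb s hs).1.2
      _ = _ := by ring
  rw [Metric.tendsto_nhds]
  intro ε hε
  have hδ1 : Tendsto (fun δ : ℝ => δ * (C * K)) (𝓝[>] 0) (𝓝 0) := by
    have : Tendsto (fun δ : ℝ => δ) (𝓝[>] 0) (𝓝 0) := tendsto_nhdsWithin_of_tendsto_nhds tendsto_id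
    simpa using this.mul_const (C * K)
  have hpos : ∀ᶠ δ in 𝓝[>] (0 : ℝ), δ ∈ Ioi 0 := self_mem_nhdsWithin
  obtain ⟨δ, hδ, hδC, hδ0⟩ := (hpos.and
    ((hδ1.eventually (gt_mem_nhds (show (0 : ℝ) < ε / 3 by positivity))).and
    (Metric.tendsto_nhds.1 h2 (ε / 3) (by positivity)))).exists
  filter_upwards [hmem, Metric.tendsto_nhds.1 (h1 δ hδ) (ε / 3) (by positivity)] with s hs hs3
  have h4 := h3 δ hδ s hs
  rw [← dist_eq_norm] at h4
  calc _ ≤ _ := dist_triangle4 _ (∫ y in S, truncate δ (q y s) * ψ y s)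
        (∫ y in S, truncate δ (q0 y) * ψ y 0) _
    _ < ε := by linarith

lemma integrableOn_datum_mul_testFlow {S : Set ℝ} {σ T : ℝ} {ψ ψ₁ ψ₂ : ℝ → ℝ → ℂ}
    {q0 : ℝ → ℂ} {γ : ℂ} (hT : 0 < T) (hψ : IsTestFlow σ T ψ ψ₁ ψ₂)
    (hv : IntegrableOn (fun y => q0 y - γ) S) :
    IntegrableOn (fun y => (q0 y - γ) * ψ y 0) S ∧ IntegrableOn (fun y => q0 y * ψ y 0) S := by
  have h0 : (0 : ℝ) ∈ Icc 0 T := left_mem_Icc.2 hT.le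
  obtain ⟨C, hC0, hC⟩ := hψ.decay 0
  obtain ⟨C', hC'0, hC'⟩ := hψ.decay 2
  have cψ : Continuous fun y => ψ y 0 :=
    hψ.continuous.comp (by fun_prop : Continuous fun y : ℝ => (y, (0 : ℝ)))
  have h1 : IntegrableOn (fun y => (q0 y - γ) * ψ y 0) S := by
    refine Integrable.mul_bdd (c := C) hv cψ.aestronglyMeasurable (ae_of_all _ fun y => ?_)
    simpa using hC y 0 h0
  have h2 : IntegrableOn (fun y => γ * ψ y 0) S := by
    refine Integrable.const_mul ?_ γ
    refine (((integrable_one_div_one_add_abs_pow (le_refl 2)).integrableOn (s := S)).const_mul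
      C').mono' cψ.aestronglyMeasurable (ae_of_all _ fun y => ?_)
    rw [mul_one_div]
    exact hC' y 0 h0
  refine ⟨h1, (h1.add h2).congr (ae_of_all _ fun y => ?_)⟩
  simp only [Pi.add_apply]
  ring

lemma IsHalfLine.zero_mem_closure {S : Set ℝ} {e : ℝ} (h : IsHalfLine S e) :
    (0 : ℝ) ∈ closure S := by
  rcases h with ⟨rfl, -⟩ | ⟨rfl, -⟩
  · rw [closure_Ioi]; exact self_mem_Ici
  · rw [closure_Iio]; exact self_mem_Iic

lemma IsHalfLine.neBot {S : Set ℝ} {e : ℝ} (h : IsHalfLine S e) {t : ℝ} (ht : 0 < t) :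
    (𝓝[S ×ˢ Ioi 0] ((0 : ℝ), t)).NeBot := by
  rw [← mem_closure_iff_nhdsWithin_neBot, closure_prod_eq]
  exact ⟨h.zero_mem_closure, subset_closure ht⟩

/-- The pairing of a solution with a pair of test flows that satisfies the adjoint interface
conditions is conserved. -/
lemma IsSolution.duality {σL σR : ℝ} {βL βR γL γR : ℂ} (hβL : βL ≠ 0) (hβR : βR ≠ 0)
    {q0L q0R : ℝ → ℂ} {qL qR : ℝ → ℝ → ℂ} (h : IsSolution σL σR βL βR γL γR q0L q0R qL qR)
    (hL : IntegrableOn (fun y => q0L y - γL) (Iio 0))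
    (hR : IntegrableOn (fun y => q0R y - γR) (Ioi 0))
    {T : ℝ} (hT : 0 < T) {ψ ψ₁ ψ₂ θ θ₁ θ₂ : ℝ → ℝ → ℂ} (hψ : IsTestFlow σL T ψ ψ₁ ψ₂)
    (hθ : IsTestFlow σR T θ θ₁ θ₂)
    (hval : ∀ s, σL * βR * ψ 0 s = σR * βL * θ 0 s) (hslope : ∀ s, σL * ψ₁ 0 s = σR * θ₁ 0 s) :
    (∫ y in Iio 0, qL y T * ψ y T) + (∫ y in Ioi 0, qR y T * θ y T) =
      (∫ y in Iio 0, q0L y * ψ y 0) + ∫ y in Ioi 0, q0R y * θ y 0 := by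
  have sL : IsHalfLine (Iio 0) (-1) := Or.inr ⟨rfl, rfl⟩
  have sR : IsHalfLine (Ioi 0) 1 := Or.inl ⟨rfl, rfl⟩
  obtain ⟨F, hF, hqF, hFlim⟩ := exists_extension sL.zero_mem_closure h.left_equation.continuous_q
    fun t ht => (h.interface_value t ht).imp fun a ha => ha.1
  obtain ⟨G, hG, hqG, hGlim⟩ := exists_extension sR.zero_mem_closure h.right_equation.continuous_q
    fun t ht => (h.interface_value t ht).imp fun a ha => ha.2
  obtain ⟨F₁, hF₁, hqF₁, hF₁lim⟩ := exists_extension sL.zero_mem_closure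
    h.left_equation.continuous_dx
    fun t ht => by obtain ⟨bL, bR, h1, -⟩ := h.interface_slope t ht; exact ⟨bL, h1⟩
  obtain ⟨G₁, hG₁, hqG₁, hG₁lim⟩ := exists_extension sR.zero_mem_closure
    h.right_equation.continuous_dx
    fun t ht => by obtain ⟨bL, bR, -, h1, -⟩ := h.interface_slope t ht; exact ⟨bR, h1⟩
  have hval' : ∀ t > 0, F 0 t = G 0 t := fun t ht => by
    have := sL.neBot ht
    have := sR.neBot ht
    obtain ⟨a, h1, h2⟩ := h.interface_value t ht
    rw [tendsto_nhds_unique (hFlim t ht) h1, tendsto_nhds_unique (hGlim t ht) h2]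
  have hslope' : ∀ t > 0, βL * F₁ 0 t = βR * G₁ 0 t := fun t ht => by
    have := sL.neBot ht
    have := sR.neBot ht
    obtain ⟨bL, bR, h1, h2, h3⟩ := h.interface_slope t ht
    rw [tendsto_nhds_unique (hF₁lim t ht) h1, tendsto_nhds_unique (hG₁lim t ht) h2, h3]
  set J : ℝ → ℂ := fun s => (∫ y in Iio 0, qL y s * ψ y s) + ∫ y in Ioi 0, qR y s * θ y s with hJ
  have hconst : ∀ s ∈ Ioc 0 T, J s = J T := by
    intro s hs
    have e1 := green_halfLine sL h.left_equation h.left_growth hψ hF hF₁ hqF hqF₁ hs.1 hs.2 le_rfl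
    have e2 := green_halfLine sR h.right_equation h.right_growth hθ hG hG₁ hqG hqG₁ hs.1 hs.2 le_rfl
    have e3 : (∫ s in s..T, ((-1 : ℝ) : ℂ) *
          (Complex.I * σL * (F₁ 0 s * ψ 0 s - F 0 s * ψ₁ 0 s))) =
        -∫ s in s..T, ((1 : ℝ) : ℂ) * (Complex.I * σR * (G₁ 0 s * θ 0 s - G 0 s * θ₁ 0 s)) := by
      rw [← intervalIntegral.integral_neg]
      refine intervalIntegral.integral_congr fun r hr => ?_
      rw [uIcc_of_le hs.2] at hr
      have hr0 : 0 < r := hs.1.trans_le hr.1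
      have k1 : σL * (F₁ 0 r * ψ 0 r) = σR * (G₁ 0 r * θ 0 r) := by
        have := hval r
        have := hslope' r hr0
        refine mul_left_cancel₀ (mul_ne_zero hβL hβR) ?_
        linear_combination βL * F₁ 0 r * hval r + σR * βL * θ 0 r * hslope' r hr0
      have k2 : σL * (F 0 r * ψ₁ 0 r) = σR * (G 0 r * θ₁ 0 r) := by
        rw [hval' r hr0]
        linear_combination G 0 r * hslope r
      push_cast
      linear_combination -Complex.I * k1 + Complex.I * k2
    simp only [hJ]
    rw [e3, ← e2] at e1
    linear_combination -e1
  have iL := integrableOn_datum_mul_testFlow hT hψ hL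
  have iR := integrableOn_datum_mul_testFlow hT hθ hR
  have meas : ∀ {S : Set ℝ} {q0 : ℝ → ℂ} {γ : ℂ}, IntegrableOn (fun y => q0 y - γ) S →
      AEStronglyMeasurable q0 (volume.restrict S) := fun {S q0 γ} hi => by
    refine (hi.aestronglyMeasurable.add (aestronglyMeasurable_const (b := γ))).congr
      (ae_of_all _ fun y => ?_)
    simp
  have hlim : Tendsto J (𝓝[>] 0) (𝓝 ((∫ y in Iio 0, q0L y * ψ y 0) +
      ∫ y in Ioi 0, q0R y * θ y 0)) :=
    (tendsto_pairing_initial isOpen_Iio hT h.left_equation h.left_growth hψ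
      (fun y hy => (h.left_initial y hy).2) iL.2 (meas hL)).add
    (tendsto_pairing_initial isOpen_Ioi hT h.right_equation h.right_growth hθ
      (fun y hy => (h.right_initial y hy).2) iR.2 (meas hR))
  refine tendsto_nhds_unique (tendsto_const_nhds.congr' ?_) hlim
  filter_upwards [Ioc_mem_nhdsGT hT] with s hs
  exact (hconst s hs).symm

/-! ### Removing the smoothing of the test flows -/

lemma heatKernel_ofReal {r : ℝ} (hr : 0 < r) (z : ℝ) :
    heatKernel r z =
      (((4 * Real.pi * r) ^ (-(1 / 2) : ℝ) * Real.exp (-z ^ 2 / (4 * r)) : ℝ) : ℂ) := by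
  rw [heatKernel, Complex.ofReal_mul, Complex.ofReal_cpow (by positivity)]
  push_cast
  ring_nf

lemma heatKernel_sq_mul {r : ℝ} (hr : 0 < r) (z : ℝ) :
    heatKernel ((r ^ 2 : ℝ) : ℂ) (r * z) = (r : ℂ)⁻¹ * heatKernel ((1 : ℝ) : ℂ) z := by
  rw [heatKernel_ofReal (by positivity), heatKernel_ofReal one_pos, ← Complex.ofReal_inv,
    ← Complex.ofReal_mul, ← mul_assoc]
  have h1 : (4 * Real.pi * r ^ 2) ^ (-(1 / 2) : ℝ) = r⁻¹ * (4 * Real.pi * 1) ^ (-(1 / 2) : ℝ) := by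
    rw [Real.mul_rpow (by positivity) (by positivity), mul_one, mul_comm, ← Real.rpow_natCast,
      ← Real.rpow_mul hr.le, ← Real.rpow_neg_one]
    norm_num
  have h2 : -(r * z) ^ 2 / (4 * r ^ 2) = -z ^ 2 / (4 * 1) := by field_simp
  rw [h1, h2]

lemma integral_heatKernel_one : Integrable (heatKernel ((1 : ℝ) : ℂ)) ∧
    ∫ z, heatKernel ((1 : ℝ) : ℂ) z = 1 := by
  have e : heatKernel ((1 : ℝ) : ℂ) = fun z : ℝ =>
      (((4 * Real.pi) ^ (-(1 / 2) : ℝ) * Real.exp (-(1 / 4) * z ^ 2) : ℝ) : ℂ) := by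
    funext z
    rw [heatKernel_ofReal one_pos]
    ring_nf
  rw [e]
  constructor
  · exact ((integrable_exp_neg_mul_sq (by norm_num)).const_mul _).ofReal
  · rw [integral_complex_ofReal, integral_const_mul, integral_gaussian,
      show Real.pi / (1 / 4) = 4 * Real.pi by ring, Real.sqrt_eq_rpow,
      ← Real.rpow_add (by positivity)]
    norm_num

/-- The heat kernel is an approximate identity. -/
lemma tendsto_integral_heatKernel_mul {g : ℝ → ℂ} (hg : AEStronglyMeasurable g) {M : ℝ}
    (hM : ∀ y, ‖g y‖ ≤ M) {x c : ℝ} (hc : c ≠ 0) (hx : ContinuousAt g (x / c)) :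
    Tendsto (fun ε : ℝ => ∫ y, heatKernel ε (x - c * y) * g y) (𝓝[>] 0)
      (𝓝 (|c|⁻¹ * g (x / c))) := by
  obtain ⟨hi, h1⟩ := integral_heatKernel_one
  have hs : ∀ ε : ℝ, ε ∈ Ioi 0 → (∫ y, heatKernel ε (x - c * y) * g y) =
      |c|⁻¹ * ∫ z, heatKernel ((1 : ℝ) : ℂ) z * g (x / c + -(Real.sqrt ε / c) * z) := by
    intro ε hε
    have hr : 0 < Real.sqrt ε := Real.sqrt_pos.2 hε
    set r := Real.sqrt ε with hrd
    have hr2 : ε = r ^ 2 := (Real.sq_sqrt (le_of_lt hε)).symm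
    have hrc : (r : ℂ) ≠ 0 := by exact_mod_cast hr.ne'
    rw [← integral_add_left_eq_self _ (x / c)]
    have h2 := Measure.integral_comp_mul_left
      (fun y => heatKernel ε (x - c * (x / c + y)) * g (x / c + y)) (-(r / c))
    have h3 : ∀ z, heatKernel ε (x - c * (x / c + -(r / c) * z)) * g (x / c + -(r / c) * z) =
        (r : ℂ)⁻¹ * (heatKernel ((1 : ℝ) : ℂ) z * g (x / c + -(r / c) * z)) := fun z => by
      rw [show x - c * (x / c + -(r / c) * z) = r * z by field_simp; ring, hr2,
        heatKernel_sq_mul hr, mul_assoc]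
    simp only [h3] at h2
    rw [integral_const_mul] at h2
    have h4 : |(-(r / c))⁻¹| = |c| * r⁻¹ := by
      rw [inv_neg, abs_neg, inv_div, abs_div, abs_of_pos hr, div_eq_mul_inv]
    rw [h4, Complex.real_smul] at h2
    have hcc : ((|c| : ℝ) : ℂ) ≠ 0 := by exact_mod_cast (abs_pos.2 hc).ne'
    rw [Complex.ofReal_mul, Complex.ofReal_inv] at h2
    have h5 := mul_left_cancel₀ (inv_ne_zero hrc) (h2.trans (by rw [mul_assoc, mul_left_comm]))
    rw [h5, Complex.ofReal_inv, inv_mul_cancel_left₀ hcc]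
  have hlim : Tendsto (fun ε : ℝ => ∫ z, heatKernel ((1 : ℝ) : ℂ) z *
      g (x / c + -(Real.sqrt ε / c) * z)) (𝓝[>] 0)
      (𝓝 (∫ z, heatKernel ((1 : ℝ) : ℂ) z * g (x / c))) := by
    refine tendsto_integral_filter_of_dominated_convergence
      (fun z => ‖heatKernel ((1 : ℝ) : ℂ) z‖ * M) ?_ ?_ (hi.norm.mul_const M)
      (ae_of_all _ fun z => ?_)
    · filter_upwards [self_mem_nhdsWithin] with ε hε
      refine hi.aestronglyMeasurable.mul (hg.comp_quasiMeasurePreserving ?_)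
      have hr : 0 < Real.sqrt ε := Real.sqrt_pos.2 hε
      have h0 : -(Real.sqrt ε / c) ≠ 0 := neg_ne_zero.2 (div_ne_zero hr.ne' hc)
      exact (measurePreserving_add_left volume (x / c)).quasiMeasurePreserving.comp
        ⟨measurable_const_mul _, by
          rw [Real.map_volume_mul_left h0]; exact Measure.smul_absolutelyContinuous⟩
    · refine Eventually.of_forall fun ε => ae_of_all _ fun z => ?_
      rw [norm_mul]
      exact mul_le_mul_of_nonneg_left (hM _) (norm_nonneg _)
    · refine Tendsto.const_mul _ (hx.tendsto.comp ?_)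
      have : Continuous fun ε : ℝ => x / c + -(Real.sqrt ε / c) * z := by fun_prop
      refine tendsto_nhdsWithin_of_tendsto_nhds ?_
      simpa using this.tendsto 0
  rw [integral_mul_const, h1, one_mul] at hlim
  refine (hlim.const_mul ((|c|⁻¹ : ℝ) : ℂ)).congr' ?_
  filter_upwards [self_mem_nhdsWithin] with ε hε
  exact (hs ε hε).symm

/-- The smoothed Schrödinger evolution converges to the Schrödinger evolution. -/
lemma tendsto_smoothed_propagate {g : ℝ → ℂ} (hg : Integrable g) {σ t : ℝ} (hτ : 0 < σ * t)
    (x c : ℝ) :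
    Tendsto (fun ε : ℝ => ∫ y, heatKernel (testTime ε σ t 0) (x - c * y) * g y) (𝓝[>] 0)
      (𝓝 (propagate σ c g x t)) := by
  have hw : ∀ ε : ℝ, σ * t ≤ ‖testTime ε σ t 0‖ := fun ε => by
    refine le_trans ?_ (Complex.abs_im_le_norm _)
    simp [testTime, abs_of_pos hτ]
  refine tendsto_integral_filter_of_dominated_convergence
    (fun y => (4 * Real.pi * (σ * t)) ^ (-(1 / 2) : ℝ) * ‖g y‖) ?_ ?_ (hg.norm.const_mul _)
    (ae_of_all _ fun y => Tendsto.mul_const _ ?_)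
  · refine Eventually.of_forall fun ε => (Continuous.aestronglyMeasurable ?_).mul
      hg.aestronglyMeasurable
    exact (continuous_heatKernel _).comp (by fun_prop)
  · filter_upwards [self_mem_nhdsWithin] with ε hε
    refine ae_of_all _ fun y => ?_
    have hn : 0 < ‖testTime ε σ t 0‖ := hτ.trans_le (hw ε)
    rw [norm_mul]
    gcongr
    refine (norm_heatKernel_le (norm_pos_iff.1 hn) (by simpa using le_of_lt hε) _).trans ?_
    exact Real.rpow_le_rpow_of_nonpos (by positivity) (by gcongr; exact hw ε) (by norm_num)
  · have h1 : Tendsto (fun ε : ℝ => testTime ε σ t 0) (𝓝[>] 0)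
        (𝓝 (-Complex.I * (σ * t : ℝ))) := by
      have : Continuous fun ε : ℝ => testTime ε σ t 0 := by unfold testTime; fun_prop
      refine tendsto_nhdsWithin_of_tendsto_nhds ?_
      simpa [testTime] using this.tendsto 0
    exact Tendsto.comp (f := fun ε : ℝ => (testTime ε σ t 0, x - c * y))
      (g := fun p : ℂ × ℝ => heatKernel p.1 p.2)
      (continuousAt_heatKernel (schrodingerTime_mem_slitPlane hτ) (x - c * y))
      (h1.prodMk_nhds tendsto_const_nhds)

lemma exists_norm_le_of_tendsto_Ioi {f : ℝ → ℂ} (hf : ContinuousOn f (Ioi 0)) {a b : ℂ}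
    (h0 : Tendsto f (𝓝[>] 0) (𝓝 a)) (h1 : Tendsto f atTop (𝓝 b)) :
    ∃ M, ∀ y > 0, ‖f y‖ ≤ M := by
  have e0 := h0.norm.eventually (gt_mem_nhds (lt_add_one ‖a‖))
  have e1 := h1.norm.eventually (gt_mem_nhds (lt_add_one ‖b‖))
  obtain ⟨δ, hδ, hδ'⟩ := mem_nhdsGT_iff_exists_Ioo_subset.1 e0
  obtain ⟨N, hN⟩ := eventually_atTop.1 e1
  obtain ⟨C, hC⟩ := (isCompact_Icc (a := δ) (b := N)).exists_bound_of_continuousOn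
    (hf.mono fun y hy => lt_of_lt_of_le hδ hy.1)
  refine ⟨max (max (‖a‖ + 1) (‖b‖ + 1)) C, fun y hy => ?_⟩
  rcases lt_or_ge y δ with h | h
  · exact (le_of_lt (hδ' ⟨hy, h⟩)).trans ((le_max_left _ _).trans (le_max_left _ _))
  · rcases le_or_gt y N with h' | h'
    · exact (hC y ⟨h, h'⟩).trans (le_max_right _ _)
    · exact (le_of_lt (hN y h'.le)).trans ((le_max_right _ _).trans (le_max_left _ _))

lemma IsSolution.exists_bound {σL σR : ℝ} {βL βR γL γR : ℂ} {q0L q0R : ℝ → ℂ}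
    {qL qR : ℝ → ℝ → ℂ} (h : IsSolution σL σR βL βR γL γR q0L q0R qL qR) {t : ℝ} (ht : 0 < t) :
    ∃ M, (∀ y ∈ Iio 0, ‖qL y t‖ ≤ M) ∧ ∀ y ∈ Ioi 0, ‖qR y t‖ ≤ M := by
  obtain ⟨a, haL, haR⟩ := h.interface_value t ht
  have slice : ∀ S : Set ℝ, Tendsto (fun y : ℝ => (y, t)) (𝓝[S] 0) (𝓝[S ×ˢ Ioi 0] (0, t)) :=
    fun S => by
      rw [nhdsWithin_prod_eq]
      exact tendsto_id.prodMk (tendsto_const_nhds.mono_right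
        (by rw [isOpen_Ioi.nhdsWithin_eq ht]))
  obtain ⟨M, hM⟩ := exists_norm_le_of_tendsto_Ioi
    (continuousOn_slice_left h.right_equation.continuous_q ht) (haR.comp (slice _))
    (h.right_limit t ht)
  have hneg : Tendsto (fun y : ℝ => -y) (𝓝[>] 0) (𝓝[<] 0) := by
    simpa using tendsto_neg_nhdsGT (a := (0 : ℝ))
  obtain ⟨M', hM'⟩ := exists_norm_le_of_tendsto_Ioi (f := fun y => qL (-y) t)
    ((continuousOn_slice_left h.left_equation.continuous_q ht).comp continuousOn_neg
      fun y hy => mem_Iio.2 (neg_lt_zero.2 hy))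
    ((haL.comp (slice _)).comp hneg) ((h.left_limit t ht).comp tendsto_neg_atTop_atBot)
  refine ⟨max M M', fun y hy => ?_, fun y hy => (hM y hy).trans (le_max_left _ _)⟩
  have := hM' (-y) (neg_pos.2 hy)
  rw [neg_neg] at this
  exact this.trans (le_max_right _ _)

lemma IsHalfLine.continuousAt_indicator {S : Set ℝ} {e : ℝ} (h : IsHalfLine S e) {u : ℝ → ℂ}
    (hu : ContinuousOn u S) {z : ℝ} (hz : z ≠ 0) : ContinuousAt (S.indicator u) z := by
  by_cases hzS : z ∈ S
  · refine (hu.continuousAt (h.isOpen.mem_nhds hzS)).congr ?_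
    filter_upwards [h.isOpen.mem_nhds hzS] with y hy
    rw [indicator_of_mem hy]
  · refine (continuousAt_const (y := (0 : ℂ))).congr ?_
    have : Sᶜ ∈ 𝓝 z := by
      rcases h with ⟨rfl, -⟩ | ⟨rfl, -⟩
      · filter_upwards [Iio_mem_nhds (lt_of_le_of_ne (not_lt.1 hzS) hz)] with y hy
        exact not_lt.2 (le_of_lt (mem_Iio.1 hy))
      · filter_upwards [Ioi_mem_nhds (lt_of_le_of_ne (not_lt.1 hzS) hz.symm)] with y hy
        exact not_lt.2 (le_of_lt (mem_Ioi.1 hy))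
    filter_upwards [this] with y hy
    rw [indicator_of_notMem hy]

/-- By how much the pairing with `K` of a solution that is `v` at time `0` and `u` at time `T`
fails to be conserved on the half-line `S`. -/
def pairingDefect (S : Set ℝ) (u v : ℝ → ℂ) (T : ℝ) (K : ℝ → ℝ → ℂ) : ℂ :=
  (∫ y in S, u y * K y T) - ∫ y in S, v y * K y 0

lemma pairingDefect_combination {S : Set ℝ} {u v : ℝ → ℂ} {T : ℝ} {K K' : ℝ → ℝ → ℂ}
    (h1 : IntegrableOn (fun y => u y * K y T) S) (h2 : IntegrableOn (fun y => v y * K y 0) S)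
    (h3 : IntegrableOn (fun y => u y * K' y T) S) (h4 : IntegrableOn (fun y => v y * K' y 0) S)
    (a a' : ℂ) :
    pairingDefect S u v T (fun y s => a * K y s + a' * K' y s) =
      a * pairingDefect S u v T K + a' * pairingDefect S u v T K' := by
  have e : ∀ (f : ℝ → ℂ) (s : ℝ), IntegrableOn (fun y => f y * K y s) S →
      IntegrableOn (fun y => f y * K' y s) S →
      (∫ y in S, f y * (a * K y s + a' * K' y s)) =
        a * (∫ y in S, f y * K y s) + a' * ∫ y in S, f y * K' y s := fun f s i1 i2 => by
    rw [← integral_const_mul, ← integral_const_mul,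
      ← integral_add (i1.const_mul a) (i2.const_mul a')]
    congr 1
    ext y
    ring
  rw [pairingDefect, e u T h1 h3, e v 0 h2 h4, pairingDefect, pairingDefect]
  ring

/-- As the smoothing is removed, the final values of the test flow concentrate at `x / c`, and the
initial values become a Schrödinger kernel. -/
lemma tendsto_pairingDefect {S : Set ℝ} {e : ℝ} (hSe : IsHalfLine S e) {u v : ℝ → ℂ} {σ t M : ℝ}
    (hτ : 0 < σ * t) (hu : ContinuousOn u S) (hM : ∀ y ∈ S, ‖u y‖ ≤ M) (hv : IntegrableOn v S)
    {x c : ℝ} (hx : x ≠ 0) (hc : c ≠ 0) :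
    Tendsto (fun ε : ℝ => pairingDefect S u v t
        fun y s => heatKernel (testTime ε σ t s) (x - c * y)) (𝓝[>] 0)
      (𝓝 (|c|⁻¹ * S.indicator u (x / c) - propagate σ c (S.indicator v) x t)) := by
  have hS := hSe.isOpen.measurableSet
  have e : ∀ (f : ℝ → ℂ) (k : ℝ → ℂ), (∫ y in S, f y * k y) = ∫ y, k y * S.indicator f y :=
    fun f k => by
      rw [← integral_indicator hS]
      congr 1
      ext y
      simp only [indicator]
      split_ifs <;> ring
  refine Tendsto.sub ?_ ?_
  · simp only [e, testTime_self]
    refine tendsto_integral_heatKernel_mul (M := max M 0)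
      ((aestronglyMeasurable_indicator_iff hS).2 (hu.aestronglyMeasurable hS)) (fun y => ?_) hc
      (hSe.continuousAt_indicator hu (div_ne_zero hx hc))
    by_cases hy : y ∈ S
    · rw [indicator_of_mem hy]
      exact (hM y hy).trans (le_max_left _ _)
    · rw [indicator_of_notMem hy, norm_zero]
      exact le_max_right _ _
  · simp only [e]
    exact tendsto_smoothed_propagate ((integrable_indicator_iff hS).2 hv) hτ x c

/-! ### Uniqueness -/

/-- The representation of the difference of two solutions with the same data at infinity, the
second of them with constant initial data on each half-line. The backward flow is composed of four
kernels, centred at `x / cᵢ` with coefficients `aᵢ`, the first two on the left and the last two on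
the right half-line; `hval` and `hslope` are the adjoint interface conditions. -/
lemma IsSolution.representation {σL σR : ℝ} {βL βR γL γR : ℂ} (hβL : βL ≠ 0) (hβR : βR ≠ 0)
    {q0L q0R : ℝ → ℂ} {qL qR pL pR : ℝ → ℝ → ℂ}
    (h : IsSolution σL σR βL βR γL γR q0L q0R qL qR)
    (hp : IsSolution σL σR βL βR γL γR (fun _ => γL) (fun _ => γR) pL pR)
    (hL : IntegrableOn (fun y => q0L y - γL) (Iio 0))
    (hR : IntegrableOn (fun y => q0R y - γR) (Ioi 0)) {σ t x : ℝ} (hσ : 0 < σ) (ht : 0 < t)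
    (hx : x ≠ 0) {c₁ c₂ c₃ c₄ : ℝ} (hc₁ : σL * c₁ ^ 2 = σ) (hc₂ : σL * c₂ ^ 2 = σ)
    (hc₃ : σR * c₃ ^ 2 = σ) (hc₄ : σR * c₄ ^ 2 = σ) {a₁ a₂ a₃ a₄ : ℂ}
    (hval : σL * βR * (a₁ + a₂) = σR * βL * (a₃ + a₄))
    (hslope : σL * (a₁ * c₁ + a₂ * c₂) = σR * (a₃ * c₃ + a₄ * c₄)) :
    a₁ * (|c₁|⁻¹ * (Iio (0 : ℝ)).indicator (fun y => qL y t - pL y t) (x / c₁)) +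
      a₂ * (|c₂|⁻¹ * (Iio (0 : ℝ)).indicator (fun y => qL y t - pL y t) (x / c₂)) +
      (a₃ * (|c₃|⁻¹ * (Ioi (0 : ℝ)).indicator (fun y => qR y t - pR y t) (x / c₃)) +
      a₄ * (|c₄|⁻¹ * (Ioi (0 : ℝ)).indicator (fun y => qR y t - pR y t) (x / c₄))) =
    a₁ * propagate σ c₁ ((Iio (0 : ℝ)).indicator fun y => q0L y - γL) x t +
      a₂ * propagate σ c₂ ((Iio (0 : ℝ)).indicator fun y => q0L y - γL) x t +
      (a₃ * propagate σ c₃ ((Ioi (0 : ℝ)).indicator fun y => q0R y - γR) x t +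
      a₄ * propagate σ c₄ ((Ioi (0 : ℝ)).indicator fun y => q0R y - γR) x t) := by
  have hne : ∀ {s c : ℝ}, s * c ^ 2 = σ → c ≠ 0 := fun {s c} hs hc => by
    rw [hc] at hs; norm_num at hs; exact hσ.ne hs
  have sL : IsHalfLine (Iio 0) (-1) := Or.inr ⟨rfl, rfl⟩
  have sR : IsHalfLine (Ioi 0) 1 := Or.inl ⟨rfl, rfl⟩
  have hτ : 0 < σ * t := by positivity
  have ht' : t ∈ Ioc 0 t := ⟨ht, le_rfl⟩
  obtain ⟨M, hML, hMR⟩ := h.exists_bound ht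
  obtain ⟨N, hNL, hNR⟩ := hp.exists_bound ht
  have cL := (continuousOn_slice_left h.left_equation.continuous_q (s := t) ht).sub
    (continuousOn_slice_left hp.left_equation.continuous_q ht)
  have cR := (continuousOn_slice_left h.right_equation.continuous_q (s := t) ht).sub
    (continuousOn_slice_left hp.right_equation.continuous_q ht)
  have bL : ∀ y ∈ Iio 0, ‖qL y t - pL y t‖ ≤ M + N := fun y hy =>
    (norm_sub_le _ _).trans (add_le_add (hML y hy) (hNL y hy))
  have bR : ∀ y ∈ Ioi 0, ‖qR y t - pR y t‖ ≤ M + N := fun y hy =>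
    (norm_sub_le _ _).trans (add_le_add (hMR y hy) (hNR y hy))
  set K : ℝ → ℝ → ℝ → ℝ → ℂ := fun ε c y s => heatKernel (testTime ε σ t s) (x - c * y) with hK
  have flow : ∀ {s c ε : ℝ}, s * c ^ 2 = σ → 0 < ε → IsTestFlow s t (K ε c)
      (fun y r => -c * heatKernel₁ (testTime ε σ t r) (x - c * y))
      (fun y r => c ^ 2 * heatKernel₂ (testTime ε σ t r) (x - c * y)) := fun {s c ε} hs hε => by
    have := isTestFlow_heatKernel hε s t x c (hne hs)
    rwa [hs] at this
  have limL : ∀ {c : ℝ}, σL * c ^ 2 = σ → _ := fun {c} hs =>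
    tendsto_pairingDefect sL hτ cL bL hL hx (hne hs)
  have limR : ∀ {c : ℝ}, σR * c ^ 2 = σ → _ := fun {c} hs =>
    tendsto_pairingDefect sR hτ cR bR hR hx (hne hs)
  have hlim := (((limL hc₁).const_mul a₁).add ((limL hc₂).const_mul a₂)).add
    (((limR hc₃).const_mul a₃).add ((limR hc₄).const_mul a₄))
  -- for positive smoothing the total defect vanishes, by duality
  have hzero : ∀ ε : ℝ, 0 < ε →
      a₁ * pairingDefect (Iio 0) (fun y => qL y t - pL y t) (fun y => q0L y - γL) t (K ε c₁) +
      a₂ * pairingDefect (Iio 0) (fun y => qL y t - pL y t) (fun y => q0L y - γL) t (K ε c₂) +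
      (a₃ * pairingDefect (Ioi 0) (fun y => qR y t - pR y t) (fun y => q0R y - γR) t (K ε c₃) +
      a₄ * pairingDefect (Ioi 0) (fun y => qR y t - pR y t) (fun y => q0R y - γR) t (K ε c₄)) =
      0 := by
    intro ε hε
    have iL : ∀ {k k₁ k₂ : ℝ → ℝ → ℂ}, IsTestFlow σL t k k₁ k₂ →
        IntegrableOn (fun y => qL y t * k y t) (Iio 0) ∧
        IntegrableOn (fun y => pL y t * k y t) (Iio 0) ∧
        IntegrableOn (fun y => q0L y * k y 0) (Iio 0) ∧
        IntegrableOn (fun y => γL * k y 0) (Iio 0) := fun hk =>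
      ⟨integrableOn_mul_testFlow isOpen_Iio h.left_equation h.left_growth hk ht',
        integrableOn_mul_testFlow isOpen_Iio hp.left_equation hp.left_growth hk ht',
        (integrableOn_datum_mul_testFlow ht hk hL).2,
        (integrableOn_datum_mul_testFlow (q0 := fun _ => γL) (γ := γL) ht hk (by simp)).2⟩
    have iR : ∀ {k k₁ k₂ : ℝ → ℝ → ℂ}, IsTestFlow σR t k k₁ k₂ →
        IntegrableOn (fun y => qR y t * k y t) (Ioi 0) ∧
        IntegrableOn (fun y => pR y t * k y t) (Ioi 0) ∧
        IntegrableOn (fun y => q0R y * k y 0) (Ioi 0) ∧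
        IntegrableOn (fun y => γR * k y 0) (Ioi 0) := fun hk =>
      ⟨integrableOn_mul_testFlow isOpen_Ioi h.right_equation h.right_growth hk ht',
        integrableOn_mul_testFlow isOpen_Ioi hp.right_equation hp.right_growth hk ht',
        (integrableOn_datum_mul_testFlow ht hk hR).2,
        (integrableOn_datum_mul_testFlow (q0 := fun _ => γR) (γ := γR) ht hk (by simp)).2⟩
    have f₁ := flow hc₁ hε
    have f₂ := flow hc₂ hε
    have f₃ := flow hc₃ hε
    have f₄ := flow hc₄ hε
    have hψ := (f₁.const_mul a₁).add (f₂.const_mul a₂)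
    have hθ := (f₃.const_mul a₃).add (f₄.const_mul a₄)
    have subI : ∀ {S : Set ℝ} {f g k : ℝ → ℂ}, IntegrableOn (fun y => f y * k y) S →
        IntegrableOn (fun y => g y * k y) S → IntegrableOn (fun y => (f y - g y) * k y) S ∧
        (∫ y in S, (f y - g y) * k y) = (∫ y in S, f y * k y) - ∫ y in S, g y * k y :=
      fun i j => by
        simp only [sub_mul]
        exact ⟨i.sub j, integral_sub i j⟩
    rw [← pairingDefect_combination (subI (iL f₁).1 (iL f₁).2.1).1
        (subI (iL f₁).2.2.1 (iL f₁).2.2.2).1 (subI (iL f₂).1 (iL f₂).2.1).1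
        (subI (iL f₂).2.2.1 (iL f₂).2.2.2).1,
      ← pairingDefect_combination (subI (iR f₃).1 (iR f₃).2.1).1
        (subI (iR f₃).2.2.1 (iR f₃).2.2.2).1 (subI (iR f₄).1 (iR f₄).2.1).1
        (subI (iR f₄).2.2.1 (iR f₄).2.2.2).1, pairingDefect, pairingDefect,
      (subI (iL hψ).1 (iL hψ).2.1).2, (subI (iL hψ).2.2.1 (iL hψ).2.2.2).2,
      (subI (iR hθ).1 (iR hθ).2.1).2, (subI (iR hθ).2.2.1 (iR hθ).2.2.2).2]
    have hv : ∀ s, σL * βR * (a₁ * K ε c₁ 0 s + a₂ * K ε c₂ 0 s) =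
        σR * βL * (a₃ * K ε c₃ 0 s + a₄ * K ε c₄ 0 s) := fun s => by
      simp only [hK, mul_zero, sub_zero]
      linear_combination heatKernel (testTime ε σ t s) x * hval
    have hs : ∀ s, σL * (a₁ * (-c₁ * heatKernel₁ (testTime ε σ t s) (x - c₁ * 0)) +
          a₂ * (-c₂ * heatKernel₁ (testTime ε σ t s) (x - c₂ * 0))) =
        σR * (a₃ * (-c₃ * heatKernel₁ (testTime ε σ t s) (x - c₃ * 0)) +
          a₄ * (-c₄ * heatKernel₁ (testTime ε σ t s) (x - c₄ * 0))) := fun s => by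
      simp only [mul_zero, sub_zero]
      linear_combination -heatKernel₁ (testTime ε σ t s) x * hslope
    have d1 := h.duality hβL hβR hL hR ht hψ hθ hv hs
    have d2 := hp.duality hβL hβR (by simp) (by simp) ht hψ hθ hv hs
    linear_combination d1 - d2
  have h0 := tendsto_nhds_unique (tendsto_const_nhds.congr' (by
    filter_upwards [self_mem_nhdsWithin] with ε hε
    exact (hzero ε hε).symm)) hlim
  linear_combination -h0

section Uniqueness

variable {σL σR : ℝ} {βL βR γL γR : ℂ} {q0L q0R : ℝ → ℂ}

lemma isRegularDatum_const (S : Set ℝ) (γ : ℂ) : IsRegularDatum S γ fun _ => γ where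
  contDiffOn := contDiffOn_const
  integrable_deriv := by simp
  integrable_moment := by simp

lemma propagate_zero (σ c x t : ℝ) : propagate σ c (fun _ => 0) x t = 0 := by simp [propagate]

/-- Every solution is given by the formulas. Those for constant data on each half-line are a
solution, and `IsSolution.representation` describes how far any other solution is from it. -/
lemma IsSolution.eq_formula (hσL : 0 < σL) (hσR : 0 < σR) (hβL : βL ≠ 0) (hβR : βR ≠ 0)
    (hβ : βR * Real.sqrt σL + βL * Real.sqrt σR ≠ 0)
    (hL : IntegrableOn (fun x => q0L x - γL) (Iio 0))
    (hR : IntegrableOn (fun x => q0R x - γR) (Ioi 0)) {qL qR : ℝ → ℝ → ℂ}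
    (h : IsSolution σL σR βL βR γL γR q0L q0R qL qR) {t : ℝ} (ht : 0 < t) :
    (∀ x < 0, qL x t =
      formulaL σL σR βL βR γL γR (fun x => q0L x - γL) (fun x => q0R x - γR) x t) ∧
    (∀ x > 0, qR x t =
      formulaR σL σR βL βR γL γR (fun x => q0L x - γL) (fun x => q0R x - γR) x t) := by
  have zL : IntegrableOn (fun _ : ℝ => γL - γL) (Iio 0) := by simp
  have zR : IntegrableOn (fun _ : ℝ => γR - γR) (Ioi 0) := by simp
  have hp := isSolution_formula (q0L := fun _ => γL) (q0R := fun _ => γR) hσL hσR hβ zL zR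
    (isRegularDatum_const _ γL) (isRegularDatum_const _ γR)
  have hsL : (Real.sqrt σL : ℂ) ≠ 0 := by exact_mod_cast (Real.sqrt_pos.2 hσL).ne'
  have hsR : (Real.sqrt σR : ℂ) ≠ 0 := by exact_mod_cast (Real.sqrt_pos.2 hσR).ne'
  have eL : (σL : ℂ) = (Real.sqrt σL : ℂ) ^ 2 := by exact_mod_cast (Real.sq_sqrt hσL.le).symm
  have eR : (σR : ℂ) = (Real.sqrt σR : ℂ) ^ 2 := by exact_mod_cast (Real.sq_sqrt hσR.le).symm
  have i0 : ∀ (S : Set ℝ) (γ : ℂ), (S.indicator fun _ => γ - γ) = fun _ => 0 := fun S γ => by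
    simp
  constructor
  · intro x hx
    have hc : 0 < Real.sqrt (σL / σR) := Real.sqrt_pos.2 (by positivity)
    have hc2 : σR * Real.sqrt (σL / σR) ^ 2 = σL := by
      rw [Real.sq_sqrt (by positivity)]; field_simp
    have hsq : (Real.sqrt (σL / σR) : ℂ) = Real.sqrt σL / Real.sqrt σR := by
      rw [Real.sqrt_div hσL.le]; push_cast; rfl
    -- the reflection and transmission coefficients of the left formula
    have key := h.representation hβL hβR hp hL hR hσL ht hx.ne (c₁ := 1) (c₂ := -1)
      (c₃ := Real.sqrt (σL / σR)) (c₄ := Real.sqrt (σL / σR)) (by ring) (by ring) hc2 hc2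
      (a₁ := 1) (a₂ := -((βR * Real.sqrt σL - βL * Real.sqrt σR) /
        (βR * Real.sqrt σL + βL * Real.sqrt σR)))
      (a₃ := 2 * βR * Real.sqrt σL ^ 2 /
        (Real.sqrt σR * (βR * Real.sqrt σL + βL * Real.sqrt σR))) (a₄ := 0)
      (by
        rw [eL, eR]
        generalize (Real.sqrt σL : ℂ) = sL at hβ hsL ⊢
        generalize (Real.sqrt σR : ℂ) = sR at hβ hsR ⊢
        generalize hD : βR * sL + βL * sR = D at hβ ⊢
        field_simp
        rw [← hD]
        ring)
      (by
        rw [hsq, eL, eR]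
        push_cast
        generalize (Real.sqrt σL : ℂ) = sL at hβ hsL ⊢
        generalize (Real.sqrt σR : ℂ) = sR at hβ hsR ⊢
        generalize hD : βR * sL + βL * sR = D at hβ ⊢
        field_simp
        rw [← hD]
        ring)
    have n1 : x / -1 ∉ Iio (0 : ℝ) := by simp only [mem_Iio]; linarith
    have n2 : x / Real.sqrt (σL / σR) ∉ Ioi (0 : ℝ) := not_lt.2 (div_neg_of_neg_of_pos hx hc).le
    rw [indicator_of_notMem n1, indicator_of_notMem n2, div_one, indicator_of_mem (mem_Iio.2 hx),
      formulaL_of_pos hσL hσR hβ zL zR hx ht] at key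
    rw [formulaL_of_pos hσL hσR hβ hL hR hx ht]
    simp only [i0, leftFlow, propagate_zero, abs_one, inv_one, Complex.ofReal_one] at key ⊢
    linear_combination key
  · intro x hx
    have hc : 0 < Real.sqrt (σR / σL) := Real.sqrt_pos.2 (by positivity)
    have hc2 : σL * Real.sqrt (σR / σL) ^ 2 = σR := by
      rw [Real.sq_sqrt (by positivity)]; field_simp
    have hsq : (Real.sqrt (σR / σL) : ℂ) = Real.sqrt σR / Real.sqrt σL := by
      rw [Real.sqrt_div hσR.le]; push_cast; rfl
    -- the reflection and transmission coefficients of the right formula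
    have key := h.representation hβL hβR hp hL hR hσR ht hx.ne' (c₁ := Real.sqrt (σR / σL))
      (c₂ := Real.sqrt (σR / σL)) (c₃ := 1) (c₄ := -1) hc2 hc2 (by ring) (by ring)
      (a₁ := 2 * βL * Real.sqrt σR ^ 2 /
        (Real.sqrt σL * (βR * Real.sqrt σL + βL * Real.sqrt σR))) (a₂ := 0)
      (a₃ := 1) (a₄ := (βR * Real.sqrt σL - βL * Real.sqrt σR) /
        (βR * Real.sqrt σL + βL * Real.sqrt σR))
      (by
        rw [eL, eR]
        generalize (Real.sqrt σL : ℂ) = sL at hβ hsL ⊢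
        generalize (Real.sqrt σR : ℂ) = sR at hβ hsR ⊢
        generalize hD : βR * sL + βL * sR = D at hβ ⊢
        field_simp
        rw [← hD]
        ring)
      (by
        rw [hsq, eL, eR]
        push_cast
        generalize (Real.sqrt σL : ℂ) = sL at hβ hsL ⊢
        generalize (Real.sqrt σR : ℂ) = sR at hβ hsR ⊢
        generalize hD : βR * sL + βL * sR = D at hβ ⊢
        field_simp
        rw [← hD]
        ring)
    have n1 : x / -1 ∉ Ioi (0 : ℝ) := by simp only [mem_Ioi]; linarith
    have n2 : x / Real.sqrt (σR / σL) ∉ Iio (0 : ℝ) := not_lt.2 (div_pos hx hc).le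
    rw [indicator_of_notMem n1, indicator_of_notMem n2, div_one, indicator_of_mem (mem_Ioi.2 hx),
      formulaR_of_pos hσL hσR hβ zL zR hx ht] at key
    rw [formulaR_of_pos hσL hσR hβ hL hR hx ht]
    simp only [i0, rightFlow, propagate_zero, abs_one, inv_one, Complex.ofReal_one] at key ⊢
    linear_combination key

end Uniqueness

end LSInterface

end

theorem mainTheorem1 (σL σR : ℝ) (hσL : 0 < σL) (hσR : 0 < σR)
    (βL βR γL γR : ℂ) (hβL : βL ≠ 0) (hβR : βR ≠ 0)
    (hβ : βR * Real.sqrt σL + βL * Real.sqrt σR ≠ 0)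
    (q0L q0R vL vR : ℝ → ℂ)
    (hvL : vL = fun x => q0L x - γL) (hvR : vR = fun x => q0R x - γR)
    (hL : IntegrableOn vL (Iio 0)) (hR : IntegrableOn vR (Ioi 0)) :
    -- all improper integrals in the formulas converge for positive times
    (∀ t > 0, (∀ x < 0, LSInterface.LeftIntegralsConverge σL σR vL vR x t) ∧
      (∀ x > 0, LSInterface.RightIntegralsConverge σL σR vL vR x t)) ∧
    -- every solution is given by the formulas
    (∀ qL qR : ℝ → ℝ → ℂ, LSInterface.IsSolution σL σR βL βR γL γR q0L q0R qL qR →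
      ∀ t > 0,
        (∀ x < 0, qL x t = LSInterface.formulaL σL σR βL βR γL γR vL vR x t) ∧
        (∀ x > 0, qR x t = LSInterface.formulaR σL σR βL βR γL γR vL vR x t)) ∧
    -- for regular data the formulas, also meaningful at time zero, define a solution
    (LSInterface.IsRegularDatum (Iio 0) γL q0L → LSInterface.IsRegularDatum (Ioi 0) γR q0R →
      (∀ x < 0, LSInterface.LeftIntegralsConverge σL σR vL vR x 0) ∧
      (∀ x > 0, LSInterface.RightIntegralsConverge σL σR vL vR x 0) ∧
      LSInterface.IsSolution σL σR βL βR γL γR q0L q0R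
        (LSInterface.formulaL σL σR βL βR γL γR vL vR)
        (LSInterface.formulaR σL σR βL βR γL γR vL vR)) := by
  subst hvL hvR
  refine ⟨fun t ht => ⟨fun x hx => LSInterface.leftIntegralsConverge_of_pos hσL hL hR hx ht,
    fun x hx => LSInterface.rightIntegralsConverge_of_pos hσR hL hR hx ht⟩,
    fun qL qR h t ht => h.eq_formula hσL hσR hβL hβR hβ hL hR ht, fun hdL hdR => ⟨fun x hx => ?_,
      fun x hx => ?_, LSInterface.isSolution_formula hσL hσR hβ hL hR hdL hdR⟩⟩
  · exact (LSInterface.formulaL_zero (βL := βL) (βR := βR) hσL hσR hL hR hdL hx).1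
  · exact (LSInterface.formulaR_zero (βL := βL) (βR := βR) hσL hσR hL hR hdR hx).1
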